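/- **Setting.** Let $Y$ be a compact smooth manifold without boundary, $R>0$, and let $f:[0,R)\to[0,\infty)$ be continuously differentiable and convex with $f(0)=0$ and $f>0$ on $(0,R)$. The singularity is called conical if $f'(0)>0$ and cuspidal if $f'(0)=0$. Let $(h_r)_{r\in[0,R)}$ be smooth Riemannian metrics on $Y$ such that the family $h$ is of class $C^1$ on $[0,R)\times Y$ (up to and including $r=0$) and $$g=dr^2+f(r)^2h_r$$ is a smooth Riemannian metric on $(0,R)\times Y$. Assume that there is a constant $c\ge 0$ with $Rc<1$ and $-2c\,h_r\le\partial_r h_r\le 2c\,h_r$ for all $r\in(0,R)$. Let $F=f^{-1}$ be the inverse function of $f$ and assume the non-oscillation condition: the limit $$\mathfrak F(\sigma)=\lim_{\epsilon\to0+}\frac{F'(\sigma\epsilon)}{F'(\epsilon)}$$ exists for all $\sigma\in[1,\infty)$, uniformly on compact subsets of $[1,\infty)$. For each $\delta\in(0,R)$ let $\gamma_\delta=(r_\delta,y_\delta):I_\delta\to(0,R)\times Y$ be a maximal unit speed geodesic of $g$, $I_\delta$ an open interval containing $0$, with $\min_t r_\delta(t)=r_\delta(0)=\delta$. Write $|\dot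 y_\delta(t)|$ for the norm of $\dot y_\delta(t)$ with respect to $h_{r_\delta(t)}$. **Theorem C (angular component of geodesics).** (a) The length $\ell(y_\delta)=\int_{I_\delta}|\dot y_\delta(t)|\,dt$ of the $Y$-projection of $\gamma_\delta$ is finite, and $$\frac{\ell(y_\delta)}{C_f/f'(\delta)}\to1\quad(\delta\to0+),\qquad\text{where } C_f=\int_{-\pi/2}^{\pi/2}\mathfrak F\Bigl(\frac1{\cos\vartheta}\Bigr)\,d\vartheta .$$ The constant $C_f$ is well defined and satisfies $2\le C_f\le\pi$, with $C_f=\pi$ in the conical case. For every $\alpha\ge1$ the function $x\mapsto x^\alpha$ satisfies the non-oscillation condition, and $C_{x^\alpha}\to2$ as $\alpha\to\infty$. The sharper the cusp, the smaller the constant: if $f_1,f_2$ are two functions satisfying the assumptions made on $f$ above (each on its own interval), for which the limits $\mathfrak F_1(\sigma),\mathfrak F_2(\sigma)$ exist for all $\sigma\ge1$, and if $f_1=O(f_2)$ near zero, then $\mathfrak F_1\le\mathfrak F_2$ on $[1,\infty)$ and $C_{f_1}\le C_{f_2}$. (The uniformity of the limits is not needed for the last assertion.) (b) Define the rescaled time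 by $\tau_\delta(t)=\int_0^t|\dot y_\delta(s)|\,ds$. It is strictly increasing on $I_\delta$, and $\tilde I_\delta=\tau_\delta(I_\delta)$ is a bounded open interval. Let $\tilde y_\delta:\tilde I_\delta\to Y$ be given by $\tilde y_\delta(\tau_\delta(t))=y_\delta(t)$. Suppose that $(y_\delta(0),f(\delta)\dot y_\delta(0))\to(y_0,v_0)$ in $TY$ as $\delta\to0+$, where $|v_0|_{h_0}=1$. Put $\tilde I=(-\frac\pi2,\frac\pi2)$ in the conical case with $f'(0)=1$, and $\tilde I=\mathbb R$ in the cuspidal case. Then in both cases, as $\delta\to0+$, the endpoints of $\tilde I_\delta$ converge to those of $\tilde I$; there is a unique unit speed geodesic $\tilde y:\tilde I\to Y$ of $(Y,h_0)$ with $\tilde y(0)=y_0$, $\dot{\tilde y}(0)=v_0$; and $\tilde y_\delta\to\tilde y$ uniformly on compact subsets of $\tilde I$. -/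

import Mathlib

open Set Filter Topology MeasureTheory Bundle
open scoped Manifold ContDiff

noncomputable section

namespace WarpedGeodesics

/-! ### Geodesics of a metric tensor on a manifold without boundary -/

section Geodesics

variable {E : Type*} [NormedAddCommGroup E] [NormedSpace ℝ E]
  {H : Type*} [TopologicalSpace H] (I : ModelWithCorners ℝ E H)
  {M : Type*} [TopologicalSpace M] [ChartedSpace H M]

/-- The velocity `γ'(t)`, a tangent vector at `γ t`. -/
def velocity (γ : ℝ → M) (t : ℝ) : TangentSpace I (γ t) :=
  mfderiv 𝓘(ℝ, ℝ) I γ t (1 : ℝ)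

/-- The coordinate expression `g_u(v, w)` of a field `G` of bilinear forms, in the preferred chart
at `x₀` and at the point with coordinates `u`: the pullback of `G` under the inverse chart. -/
def coordMetric (G : (x : M) → TangentSpace I x →L[ℝ] TangentSpace I x →L[ℝ] ℝ)
    (x₀ : M) (u v w : E) : ℝ :=
  G ((extChartAt I x₀).symm u)
    (mfderiv 𝓘(ℝ, E) I (extChartAt I x₀).symm u v)
    (mfderiv 𝓘(ℝ, E) I (extChartAt I x₀).symm u w)

/-- `γ` is a (constant speed) geodesic of the metric tensor `G` on the open set of times `J`: it is
of class `C²` and in every chart its coordinates `x` satisfy the geodesic equation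
`d/dt g_x(x', w) = (1/2) (∂_w g)_x(x', x')` for all `w`, i.e. the Euler-Lagrange equation of
the energy, or equivalently the Hamilton equations for the momentum `g_x(x', ·)`. -/
def IsGeodesicOn (G : (x : M) → TangentSpace I x →L[ℝ] TangentSpace I x →L[ℝ] ℝ)
    (γ : ℝ → M) (J : Set ℝ) : Prop :=
  ContMDiffOn 𝓘(ℝ, ℝ) I 2 γ J ∧
  ∀ (x₀ : M), ∀ t ∈ J, γ t ∈ (extChartAt I x₀).source →
    let x : ℝ → E := fun s => extChartAt I x₀ (γ s)
    ∀ w : E, HasDerivAt (fun s => coordMetric I G x₀ (x s) (deriv x s) w)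
      ((1 / 2 : ℝ) * fderiv ℝ (fun u => coordMetric I G x₀ u (deriv x t) (deriv x t)) (x t) w) t

/-- `γ` is a geodesic of `G` in the open set `U`, defined on the open interval `J`, which cannot
be extended, as a geodesic in `U`, to a larger interval. -/
structure IsMaximalGeodesicIn
    (G : (x : M) → TangentSpace I x →L[ℝ] TangentSpace I x →L[ℝ] ℝ)
    (U : Set M) (γ : ℝ → M) (J : Set ℝ) : Prop where
  isOpen : IsOpen J
  ordConnected : J.OrdConnected
  mapsTo : MapsTo γ J U
  isGeodesicOn : IsGeodesicOn I G γ J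
  maximal : ∀ (γ' : ℝ → M) (J' : Set ℝ), IsOpen J' → J'.OrdConnected → MapsTo γ' J' U →
    IsGeodesicOn I G γ' J' → J ⊆ J' → EqOn γ' γ J → J' = J

/-- `γ` has unit speed with respect to `G` at all times in `J`. -/
def HasUnitSpeedOn (G : (x : M) → TangentSpace I x →L[ℝ] TangentSpace I x →L[ℝ] ℝ)
    (γ : ℝ → M) (J : Set ℝ) : Prop :=
  ∀ t ∈ J, G (γ t) (velocity I γ t) (velocity I γ t) = 1

end Geodesics

/-! ### Warping functions, the non-oscillation condition, and the constant `C_f` -/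

/-- `f : [0, R) → [0, ∞)` is a warping function: `C¹` up to `0`, positive on `(0, R)`,
`f 0 = 0`, and convex. -/
structure IsWarpingFunction (R : ℝ) (f : ℝ → ℝ) : Prop where
  contDiffOn : ContDiffOn ℝ 1 f (Ico 0 R)
  pos : ∀ r ∈ Ioo 0 R, 0 < f r
  zero : f 0 = 0
  convexOn : ConvexOn ℝ (Ico 0 R) f

/-- The inverse function `F` of `f : [0, R) → [0, ∞)`. -/
def inverse (R : ℝ) (f : ℝ → ℝ) : ℝ → ℝ := Function.invFunOn f (Ico 0 R)

/-- The quotient `F'(σ ε) / F'(ε)`, where `F` is the inverse of `f`. -/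
def derivRatio (R : ℝ) (f : ℝ → ℝ) (ε σ : ℝ) : ℝ :=
  deriv (inverse R f) (σ * ε) / deriv (inverse R f) ε

/-- `𝔉(σ) = lim_{ε → 0+} F'(σ ε) / F'(ε)` (meaningful when this limit exists). -/
def frakF (R : ℝ) (f : ℝ → ℝ) (σ : ℝ) : ℝ := limUnder (𝓝[>] 0) (fun ε => derivRatio R f ε σ)

/-- The limit defining `𝔉(σ)` exists for every `σ ≥ 1`. -/
def FrakFExists (R : ℝ) (f : ℝ → ℝ) : Prop :=
  ∀ σ : ℝ, 1 ≤ σ → Tendsto (fun ε => derivRatio R f ε σ) (𝓝[>] 0) (𝓝 (frakF R f σ))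

/-- Non-oscillation condition: the limit defining `𝔉(σ)` exists for `σ ∈ [1, ∞)`, and the
convergence is uniform on compact subsets. -/
def NonOscillation (R : ℝ) (f : ℝ → ℝ) : Prop :=
  FrakFExists R f ∧
  ∀ K ⊆ Ici (1 : ℝ), IsCompact K → TendstoUniformlyOn (derivRatio R f) (frakF R f) (𝓝[>] 0) K

/-- `C_f = ∫_{-π/2}^{π/2} 𝔉(1 / cos ϑ) dϑ`. -/
def angularConst (R : ℝ) (f : ℝ → ℝ) : ℝ :=
  ∫ ϑ in (-(Real.pi / 2))..(Real.pi / 2), frakF R f (1 / Real.cos ϑ)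

/-! ### Generalized warped products `(0, R) × Y` with metric `dr² + f(r)² h_r` -/

section WarpedProduct

variable {m : ℕ} {Y : Type*} [TopologicalSpace Y] [ChartedSpace (EuclideanSpace ℝ (Fin m)) Y]
  [IsManifold (𝓡 m) ∞ Y]

/-- The type of smooth Riemannian metrics on the manifold `Y`. -/
abbrev RiemMetric (m : ℕ) (Y : Type*) [TopologicalSpace Y]
    [ChartedSpace (EuclideanSpace ℝ (Fin m)) Y] [IsManifold (𝓡 m) ∞ Y] :=
  ContMDiffRiemannianMetric (𝓡 m) ∞ (EuclideanSpace ℝ (Fin m))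
    (fun y : Y => TangentSpace (𝓡 m) y)

/-- The metric tensor `g = dr² + f(r)² h_r` on `ℝ × Y`; it is only used over `(0, R) × Y`. -/
def warpedMetric (f : ℝ → ℝ) (h : ℝ → RiemMetric m Y) (p : ℝ × Y) :
    TangentSpace (𝓘(ℝ, ℝ).prod (𝓡 m)) p →L[ℝ]
      TangentSpace (𝓘(ℝ, ℝ).prod (𝓡 m)) p →L[ℝ] ℝ :=
  let E := EuclideanSpace ℝ (Fin m)
  let b : E →L[ℝ] E →L[ℝ] ℝ := (h p.1).inner p.2
  (ContinuousLinearMap.mul ℝ ℝ).bilinearComp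
      (ContinuousLinearMap.fst ℝ ℝ E) (ContinuousLinearMap.fst ℝ ℝ E) +
    f p.1 ^ 2 • b.bilinearComp (ContinuousLinearMap.snd ℝ ℝ E) (ContinuousLinearMap.snd ℝ ℝ E)

/-- Regularity of a generalized warped product: `g = dr² + f(r)² h_r` is smooth on `(0, R) × Y`,
and the family `h_r` (of smooth metrics on `Y`) is of class `C¹` on `[0, R) × Y`,
up to and including `r = 0`. -/
structure IsGeneralizedWarpedProduct (R : ℝ) (f : ℝ → ℝ) (h : ℝ → RiemMetric m Y) : Prop where
  smooth_metric : ContMDiffOn (𝓘(ℝ, ℝ).prod (𝓡 m))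
    ((𝓘(ℝ, ℝ).prod (𝓡 m)).prod 𝓘(ℝ, (ℝ × EuclideanSpace ℝ (Fin m)) →L[ℝ]
      (ℝ × EuclideanSpace ℝ (Fin m)) →L[ℝ] ℝ)) ∞
    (fun p : ℝ × Y => TotalSpace.mk' ((ℝ × EuclideanSpace ℝ (Fin m)) →L[ℝ]
        (ℝ × EuclideanSpace ℝ (Fin m)) →L[ℝ] ℝ)
      (E := fun p : ℝ × Y => TangentSpace (𝓘(ℝ, ℝ).prod (𝓡 m)) p →L[ℝ]
        TangentSpace (𝓘(ℝ, ℝ).prod (𝓡 m)) p →L[ℝ] ℝ)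
      p (warpedMetric f h p))
    (Ioo 0 R ×ˢ univ)
  family_C1 : ContMDiffOn (𝓘(ℝ, ℝ).prod (𝓡 m))
    ((𝓡 m).prod 𝓘(ℝ, EuclideanSpace ℝ (Fin m) →L[ℝ] EuclideanSpace ℝ (Fin m) →L[ℝ] ℝ)) 1
    (fun p : ℝ × Y =>
      TotalSpace.mk' (EuclideanSpace ℝ (Fin m) →L[ℝ] EuclideanSpace ℝ (Fin m) →L[ℝ] ℝ)
        (E := fun y : Y => TangentSpace (𝓡 m) y →L[ℝ] TangentSpace (𝓡 m) y →L[ℝ] ℝ)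
        p.2 ((h p.1).inner p.2))
    (Ico 0 R ×ˢ univ)

/-- The bound `-2 c h ≤ ∂_r h ≤ 2 c h` on `(0, R)`, as an inequality of quadratic forms. -/
def RadialVariationBound (R c : ℝ) (h : ℝ → RiemMetric m Y) : Prop :=
  ∀ r ∈ Ioo 0 R, ∀ (y : Y) (v : TangentSpace (𝓡 m) y),
    -(2 * c * (h r).inner y v v) ≤ deriv (fun s => (h s).inner y v v) r ∧
      deriv (fun s => (h s).inner y v v) r ≤ 2 * c * (h r).inner y v v

/-- `γ_δ : J_δ → (0, R) × Y`, `δ ∈ (0, R)`, is a family of maximal unit speed geodesics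
`γ_δ = (r_δ, y_δ)` with `min r_δ = r_δ(0) = δ`. -/
structure IsGeodesicFamily (R : ℝ) (f : ℝ → ℝ) (h : ℝ → RiemMetric m Y)
    (γ : ℝ → ℝ → ℝ × Y) (J : ℝ → Set ℝ) : Prop where
  maximalGeodesic : ∀ δ ∈ Ioo 0 R, IsMaximalGeodesicIn (𝓘(ℝ, ℝ).prod (𝓡 m)) (warpedMetric f h)
    (Ioo 0 R ×ˢ univ) (γ δ) (J δ)
  unitSpeed : ∀ δ ∈ Ioo 0 R, HasUnitSpeedOn (𝓘(ℝ, ℝ).prod (𝓡 m)) (warpedMetric f h) (γ δ) (J δ)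
  zero_mem : ∀ δ ∈ Ioo 0 R, (0 : ℝ) ∈ J δ
  radius_zero : ∀ δ ∈ Ioo 0 R, (γ δ 0).1 = δ
  radius_min : ∀ δ ∈ Ioo 0 R, ∀ t ∈ J δ, δ ≤ (γ δ t).1

/-- The speed `|y'(t)|_h` of the `Y`-component of `γ = (r, y)`, measured by `h_{r(t)}`. -/
def projSpeed (h : ℝ → RiemMetric m Y) (γ : ℝ → ℝ × Y) (t : ℝ) : ℝ :=
  Real.sqrt ((h (γ t).1).inner (γ t).2
    (velocity (𝓡 m) (fun s => (γ s).2) t) (velocity (𝓡 m) (fun s => (γ s).2) t))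

/-- The length `ℓ(y) = ∫_J |y'(t)|_h dt` of the `Y`-projection of `γ = (r, y)`. -/
def projLength (h : ℝ → RiemMetric m Y) (γ : ℝ → ℝ × Y) (J : Set ℝ) : ℝ :=
  ∫ t in J, projSpeed h γ t

/-- The rescaled time `τ` with `τ(0) = 0` and `dτ/dt = |y'|_h`. -/
def projTime (h : ℝ → RiemMetric m Y) (γ : ℝ → ℝ × Y) (t : ℝ) : ℝ :=
  ∫ s in (0 : ℝ)..t, projSpeed h γ s

/-- The reparametrised `Y`-component `ỹ = y ∘ τ⁻¹`, defined on `τ(J)`. -/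
def projReparam (h : ℝ → RiemMetric m Y) (γ : ℝ → ℝ × Y) (J : Set ℝ) (s : ℝ) : Y :=
  (γ (Function.invFunOn (projTime h γ) J s)).2

/-- The rescaled initial condition `(y(0), f(δ) y'(0))` in `TY` of the `Y`-component of `γ`. -/
def rescaledInitial (f : ℝ → ℝ) (γ : ℝ → ℝ × Y) (δ : ℝ) : TangentBundle (𝓡 m) Y :=
  ⟨(γ 0).2, f δ • velocity (𝓡 m) (fun s => (γ s).2) 0⟩

/-- `z` is a unit speed geodesic of `(Y, k)` on the open interval `S` with
`(z(0), z'(0)) = p₀`. -/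
structure IsUnitGeodesicFrom (k : RiemMetric m Y) (p₀ : TangentBundle (𝓡 m) Y) (S : Set ℝ)
    (z : ℝ → Y) : Prop where
  isGeodesicOn : IsGeodesicOn (𝓡 m) k.inner z S
  unitSpeed : HasUnitSpeedOn (𝓡 m) k.inner z S
  initial : (⟨z 0, velocity (𝓡 m) z 0⟩ : TangentBundle (𝓡 m) Y) = p₀

end WarpedProduct

/-- For `δ ∈ (0, R)` the set `S δ` is a bounded open interval `(a δ, b δ)`, and as `δ → 0+` its
endpoints tend to the limits given by `la` and `lb`. -/
def EndpointsTendsto (R : ℝ) (S : ℝ → Set ℝ) (la lb : Filter ℝ) : Prop :=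
  ∃ a b : ℝ → ℝ, (∀ δ ∈ Ioo 0 R, S δ = Ioo (a δ) (b δ)) ∧
    Tendsto a (𝓝[>] 0) la ∧ Tendsto b (𝓝[>] 0) lb

/-- There is a unit speed geodesic of `(Y, h_0)` on `S` with initial condition `p₀`, and the
`Y`-components of the `γ_δ`, reparametrised to unit speed, converge to it (to any such geodesic, so
that it is unique on `S`) uniformly on compact subsets of `S` as `δ → 0+`. -/
def ReparamConverges {m : ℕ} {Y : Type*} [UniformSpace Y]
    [ChartedSpace (EuclideanSpace ℝ (Fin m)) Y] [IsManifold (𝓡 m) ∞ Y]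
    (h : ℝ → RiemMetric m Y) (γ : ℝ → ℝ → ℝ × Y) (J : ℝ → Set ℝ)
    (p₀ : TangentBundle (𝓡 m) Y) (S : Set ℝ) : Prop :=
  (∃ z : ℝ → Y, IsUnitGeodesicFrom (h 0) p₀ S z) ∧
  ∀ z : ℝ → Y, IsUnitGeodesicFrom (h 0) p₀ S z → ∀ K ⊆ S, IsCompact K →
    TendstoUniformlyOn (fun δ => projReparam h (γ δ) (J δ)) z (𝓝[>] 0) K

end WarpedGeodesics

end

/-! Write γ = (r, y) and ν = |ẏ|, and let θ = arcsin ṙ be the angle between γ and the level sets of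
r, so that f(r) ν = cos θ. The radial geodesic equation reads r̈ = (1 − ṙ²)(f'/f + q), where |q| ≤ c
comes from ∂_r h (`exists_hasDerivAt_radial_deriv`). This has two consequences. The angular momentum
f² ν has logarithmic derivative −q ṙ and so stays between f(δ) e^{−c(r−δ)} and f(δ) e^{c(r−δ)}:
Clairaut's relation f(r) cos θ = f(δ) holds up to a factor tending to 1 as r → 0
(`RadialMotion.angularMomentum_bounds`). Moreover θ̇ = ν (f' + q f)
(`RadialMotion.hasDerivAt_angle`). Convexity and f(0) = 0 give f ≤ r f', so f' + q f lies between f'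
(1 − c r) > 0 and f' (1 + c r). Hence θ can serve as parameter, with ν dt = dθ / (f' + q f).

Since f' = 1 / F'(f), the density f'(δ) ν dt/dθ is close to F'(f(δ)/cos θ) / F'(f(δ)), which tends
to 𝔉(1/cos θ). It is bounded by 1/(1 − cR) because f' increases, and a maximal geodesic leaves every
compact set, so its angles exhaust (−π/2, π/2). Dominated convergence gives the limit over any
measurable set S of angles (`tendsto_integral_angle`). All angles give the length; half-lines give
the endpoints of the rescaled time interval; S = (0, x) and (−x, 0) show that during a fixed
rescaled time below the limiting endpoint the angle stays away from ±π/2, so that r → 0 uniformly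
there.

The bounds on C_f come from 1/σ ≤ 𝔉(σ) ≤ 1. The upper one says that F' decreases. If the lower one
failed, ε F'(ε) would grow geometrically along ε σ^{−n}, although ε F'(ε) ≤ R. The comparison
`frakF_le_of_isBigO` is the same argument for F₂'/F₁', whose growth would contradict f₁ = O(f₂).

For the convergence of the Y-components one works with position and momentum. In rescaled time the
momentum, divided by f(δ), satisfies an equation that contains no r-derivative of h; together with
the position it is an approximate solution of Hamilton's equations of h₀, with an error that
vanishes as r → 0 and f² ν / f(δ) → 1. Gronwall's inequality gives uniform convergence in a chart
(`exists_uniform_convergence`), and connectedness spreads it over the whole interval. The limit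
geodesic exists because a compact Riemannian manifold is geodesically complete. -/

noncomputable section

set_option linter.unusedSectionVars false

namespace WarpedGeodesics

/-! ### Coordinate expressions of fields of bilinear forms. -/

section ChartForms

variable {E : Type*} [NormedAddCommGroup E] [NormedSpace ℝ E]
  {H : Type*} [TopologicalSpace H] (I : ModelWithCorners ℝ E H)
  {M : Type*} [TopologicalSpace M] [ChartedSpace H M]

/-- The derivative of the inverse of the preferred chart at `x₀`, as a map of the model space. -/
def chartDeriv (x₀ : M) (u : E) : E →L[ℝ] E :=
  mfderiv 𝓘(ℝ, E) I (extChartAt I x₀).symm u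

/-- The pullback of a bilinear form on a tangent space under the inverse chart. -/
def pullForm (x₀ : M) (u : E)
    (b : TangentSpace I ((extChartAt I x₀).symm u) →L[ℝ]
      TangentSpace I ((extChartAt I x₀).symm u) →L[ℝ] ℝ) : E →L[ℝ] E →L[ℝ] ℝ :=
  let b' : E →L[ℝ] E →L[ℝ] ℝ := b
  b'.bilinearComp (chartDeriv I x₀ u) (chartDeriv I x₀ u)

/-- The coordinate expression of a field of bilinear forms, as a bilinear form. -/
def coordForm (G : (x : M) → TangentSpace I x →L[ℝ] TangentSpace I x →L[ℝ] ℝ)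
    (x₀ : M) (u : E) : E →L[ℝ] E →L[ℝ] ℝ :=
  pullForm I x₀ u (G ((extChartAt I x₀).symm u))

theorem coordMetric_eq_coordForm
    (G : (x : M) → TangentSpace I x →L[ℝ] TangentSpace I x →L[ℝ] ℝ) (x₀ : M) (u v w : E) :
    coordMetric I G x₀ u v w = coordForm I G x₀ u v w := rfl

variable {I}
variable [I.Boundaryless] [IsManifold I ∞ M]

/-- Links the bundle structure, in which smoothness of a metric is expressed, with the inverse
chart, in which the geodesic equation is expressed. -/
theorem symmL_trivializationAt_eq_chartDeriv {x₀ : M} {u : E}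
    (hu : u ∈ (extChartAt I x₀).target) :
    (trivializationAt E (TangentSpace I) x₀).symmL ℝ ((extChartAt I x₀).symm u) =
      chartDeriv I x₀ u := by
  have : IsManifold I 1 M := IsManifold.of_le (n := ∞) (by simp)
  have hx : (extChartAt I x₀).symm u ∈ (chartAt H x₀).source := by
    rw [← extChartAt_source I]; exact (extChartAt I x₀).map_target hu
  rw [TangentBundle.symmL_trivializationAt hx, (extChartAt I x₀).right_inv hu, I.range_eq_univ,
    mfderivWithin_univ]
  rfl

/-- The coordinate fields of the chart are constant in the trivialization at `x₀`, so a section of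
regularity `n` evaluated on two of them is a scalar function of regularity `n`, and in finite
dimension these functions determine the form. The parameter `p` need not be the base point, which
covers the family `h_r` as well as a single metric. -/
theorem contDiffOn_pullForm [FiniteDimensional ℝ E] {P : Type*} [NormedAddCommGroup P]
    [NormedSpace ℝ P] {n : ℕ∞ω} (hn : n ≤ ∞)
    [ContMDiffVectorBundle n E (TangentSpace I : M → Type _) I] {s : Set P} (x₀ : M) {u : P → E}
    (hu : ContDiffOn ℝ n u s) (hut : MapsTo u s (extChartAt I x₀).target)
    (G : (p : P) → TangentSpace I ((extChartAt I x₀).symm (u p)) →L[ℝ]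
      TangentSpace I ((extChartAt I x₀).symm (u p)) →L[ℝ] ℝ)
    (hG : ContMDiffOn 𝓘(ℝ, P) (I.prod 𝓘(ℝ, E →L[ℝ] E →L[ℝ] ℝ)) n
      (fun p => TotalSpace.mk' (E →L[ℝ] E →L[ℝ] ℝ)
        (E := fun x : M => TangentSpace I x →L[ℝ] TangentSpace I x →L[ℝ] ℝ)
        ((extChartAt I x₀).symm (u p)) (G p)) s) :
    ContDiffOn ℝ n (fun p => pullForm I x₀ (u p) (G p)) s := by
  have : IsManifold I 1 M := IsManifold.of_le (n := ∞) (by simp)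
  have : IsManifold I n M := IsManifold.of_le (n := ∞) hn
  have hbase : ContMDiffOn 𝓘(ℝ, P) I n (fun p => (extChartAt I x₀).symm (u p)) s :=
    (contMDiffOn_extChartAt_symm x₀).comp hu.contMDiffOn hut
  have hsec : ∀ v : E, ContMDiffOn 𝓘(ℝ, P) (I.prod 𝓘(ℝ, E)) n
      (fun p => TotalSpace.mk' E (E := fun x : M => TangentSpace I x)
        ((extChartAt I x₀).symm (u p)) (chartDeriv I x₀ (u p) v)) s := by
    intro v
    set e := trivializationAt E (TangentSpace I) x₀ with he
    have hmem : ∀ p ∈ s, (extChartAt I x₀).symm (u p) ∈ e.baseSet := by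
      intro p hp
      have := (extChartAt I x₀).map_target (hut hp)
      rw [extChartAt_source] at this
      simpa [he] using this
    rw [e.contMDiffOn_iff (fun p hp => by rw [e.mem_source]; exact hmem p hp)]
    refine ⟨hbase, (contMDiffOn_const (c := v)).congr fun p hp => ?_⟩
    have h1 := symmL_trivializationAt_eq_chartDeriv (I := I) (hut hp)
    have h2 := e.apply_mk_symm (hmem p hp) v
    have h3 : chartDeriv I x₀ (u p) v = e.symm ((extChartAt I x₀).symm (u p)) v := by
      rw [← h1]; exact Bundle.Trivialization.symmL_apply e (R := ℝ) (hmem p hp) v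
    exact (congrArg (fun w => (e ⟨(extChartAt I x₀).symm (u p), w⟩).2) h3).trans
      (congrArg Prod.snd h2)
  rw [contDiffOn_clm_apply]
  intro v
  rw [contDiffOn_clm_apply]
  intro w
  have : ContMDiffOn 𝓘(ℝ, P) (I.prod 𝓘(ℝ)) n
      (fun p ↦ TotalSpace.mk' ℝ (E := Bundle.Trivial M ℝ) ((extChartAt I x₀).symm (u p))
        (G p (chartDeriv I x₀ (u p) v) (chartDeriv I x₀ (u p) w))) s := by
    apply ContMDiffOn.clm_bundle_apply₂ (F₁ := E) (F₂ := E) hG (hsec v) (hsec w)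
  intro p hp
  have := this p hp
  simp only [contMDiffWithinAt_totalSpace] at this
  exact this.2.contDiffWithinAt

end ChartForms

end WarpedGeodesics

namespace WarpedGeodesics

/-! ### Hamilton's equations for the energy of a metric in coordinates. -/

section HamiltonianField

variable {E : Type*} [NormedAddCommGroup E] [NormedSpace ℝ E]

instance instNormedAddCommGroupCovector : NormedAddCommGroup (E →L[ℝ] ℝ) :=
  ContinuousLinearMap.toNormedAddCommGroup

instance instNormedSpaceCovector : NormedSpace ℝ (E →L[ℝ] ℝ) :=
  ContinuousLinearMap.toNormedSpace

instance instNormedAddCommGroupCoform : NormedAddCommGroup ((E →L[ℝ] ℝ) →L[ℝ] E) :=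
  ContinuousLinearMap.toNormedAddCommGroup

instance instNormedSpaceCoform : NormedSpace ℝ ((E →L[ℝ] ℝ) →L[ℝ] E) :=
  ContinuousLinearMap.toNormedSpace

instance instNormedAddCommGroupForm : NormedAddCommGroup (E →L[ℝ] E →L[ℝ] ℝ) :=
  ContinuousLinearMap.toNormedAddCommGroup

instance instNormedSpaceForm : NormedSpace ℝ (E →L[ℝ] E →L[ℝ] ℝ) :=
  ContinuousLinearMap.toNormedSpace

instance instNormedAddCommGroupTrilinear : NormedAddCommGroup (E →L[ℝ] E →L[ℝ] E →L[ℝ] ℝ) :=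
  ContinuousLinearMap.toNormedAddCommGroup

instance instNormedSpaceTrilinear : NormedSpace ℝ (E →L[ℝ] E →L[ℝ] E →L[ℝ] ℝ) :=
  ContinuousLinearMap.toNormedSpace

/-- A definite form has trivial kernel as a map to the dual, and the dual has the same dimension. It
ensures that `ContinuousLinearMap.inverse` below is a genuine inverse and not the default value 0.
-/
theorem exists_continuousLinearEquiv_of_pos [FiniteDimensional ℝ E] (b : E →L[ℝ] E →L[ℝ] ℝ)
    (hb : ∀ v, v ≠ 0 → 0 < b v v) : ∃ e : E ≃L[ℝ] (E →L[ℝ] ℝ), (e : E →L[ℝ] E →L[ℝ] ℝ) = b := by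
  have hinj : Function.Injective b := by
    rw [injective_iff_map_eq_zero]
    intro v hv
    by_contra hne
    have := hb v hne
    simp [hv] at this
  have hrank : Module.finrank ℝ E = Module.finrank ℝ (E →L[ℝ] ℝ) := by
    have h1 : Module.finrank ℝ (E →L[ℝ] ℝ) = Module.finrank ℝ (E →ₗ[ℝ] ℝ) :=
      (LinearMap.toContinuousLinearMap (𝕜 := ℝ) (E := E) (F' := ℝ)).symm.finrank_eq
    rw [h1]
    exact (Subspace.dual_finrank_eq (K := ℝ) (V := E)).symm
  have : FiniteDimensional ℝ (E →L[ℝ] ℝ) :=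
    (LinearMap.toContinuousLinearMap (𝕜 := ℝ) (E := E) (F' := ℝ)).finiteDimensional
  refine ⟨(LinearEquiv.ofInjectiveOfFinrankEq (b : E →ₗ[ℝ] E →L[ℝ] ℝ) hinj hrank).toContinuousLinearEquiv, ?_⟩
  ext v w
  rfl

theorem inverse_apply_of_pos [FiniteDimensional ℝ E] {b : E →L[ℝ] E →L[ℝ] ℝ}
    (hb : ∀ v, v ≠ 0 → 0 < b v v) (v : E) : b.inverse (b v) = v := by
  obtain ⟨e, rfl⟩ := exists_continuousLinearEquiv_of_pos b hb
  simp

theorem apply_inverse_of_pos [FiniteDimensional ℝ E] {b : E →L[ℝ] E →L[ℝ] ℝ}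
    (hb : ∀ v, v ≠ 0 → 0 < b v v) (p : E →L[ℝ] ℝ) : b (b.inverse p) = p := by
  obtain ⟨e, rfl⟩ := exists_continuousLinearEquiv_of_pos b hb
  simp

theorem contDiffAt_inverse_of_pos [FiniteDimensional ℝ E] {b : E →L[ℝ] E →L[ℝ] ℝ}
    (hb : ∀ v, v ≠ 0 → 0 < b v v) {n : ℕ∞ω} :
    ContDiffAt ℝ n (ContinuousLinearMap.inverse : (E →L[ℝ] E →L[ℝ] ℝ) → _) b := by
  have : CompleteSpace E := FiniteDimensional.complete ℝ E
  obtain ⟨e, rfl⟩ := exists_continuousLinearEquiv_of_pos b hb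
  exact contDiffAt_map_inverse e

/-- The covector `w ↦ T w v v` associated with a trilinear form `T`. -/
def sqCovector (T : E →L[ℝ] E →L[ℝ] E →L[ℝ] ℝ) (v : E) : E →L[ℝ] ℝ := (T.flip v).flip v

@[simp] theorem sqCovector_apply (T : E →L[ℝ] E →L[ℝ] E →L[ℝ] ℝ) (v w : E) :
    sqCovector T v w = T w v v := rfl

theorem ContDiffAt.sqCovector {F : Type*} [NormedAddCommGroup F] [NormedSpace ℝ F] {n : ℕ∞ω}
    {T : F → E →L[ℝ] E →L[ℝ] E →L[ℝ] ℝ} {v : F → E} {z : F} (hT : ContDiffAt ℝ n T z)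
    (hv : ContDiffAt ℝ n v z) : ContDiffAt ℝ n (fun q => sqCovector (T q) (v q)) z := by
  have h1 : ContDiffAt ℝ n (fun q => (T q).flip) z :=
    (ContinuousLinearMap.flipₗᵢ ℝ E E (E →L[ℝ] ℝ)).contDiff.contDiffAt.comp z hT
  have h2 : ContDiffAt ℝ n (fun q => (T q).flip (v q)) z := h1.clm_apply hv
  have h3 : ContDiffAt ℝ n (fun q => ((T q).flip (v q)).flip) z :=
    (ContinuousLinearMap.flipₗᵢ ℝ E E ℝ).contDiff.contDiffAt.comp z h2
  exact h3.clm_apply hv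

/-- The Hamiltonian vector field of the energy of the metric with coordinate expression `a`, on the
space of pairs (position, momentum). -/
def hamField (a : E → E →L[ℝ] E →L[ℝ] ℝ) (z : E × (E →L[ℝ] ℝ)) : E × (E →L[ℝ] ℝ) :=
  ((a z.1).inverse z.2, (1 / 2 : ℝ) • sqCovector (fderiv ℝ a z.1) ((a z.1).inverse z.2))

theorem contDiffAt_velocity [FiniteDimensional ℝ E] {a : E → E →L[ℝ] E →L[ℝ] ℝ}
    {z : E × (E →L[ℝ] ℝ)} {n : ℕ∞ω} (ha : ContDiffAt ℝ n a z.1)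
    (hpos : ∀ v, v ≠ 0 → 0 < a z.1 v v) :
    ContDiffAt ℝ n (fun z : E × (E →L[ℝ] ℝ) => (a z.1).inverse z.2) z := by
  have h1 : ContDiffAt ℝ n (fun z : E × (E →L[ℝ] ℝ) => a z.1) z := ha.comp z contDiffAt_fst
  have h2 : ContDiffAt ℝ n (fun z : E × (E →L[ℝ] ℝ) => (a z.1).inverse) z :=
    ContDiffAt.comp (g := ContinuousLinearMap.inverse) (f := fun z : E × (E →L[ℝ] ℝ) => a z.1) z
      (contDiffAt_inverse_of_pos hpos) h1
  exact h2.clm_apply contDiffAt_snd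

/-- The field involves one derivative of the metric, so a metric of class `C²` gives a field of
class `C¹`, as required by the Picard–Lindelöf theorem. -/
theorem contDiffAt_hamField [FiniteDimensional ℝ E] {a : E → E →L[ℝ] E →L[ℝ] ℝ}
    {z : E × (E →L[ℝ] ℝ)} (ha : ContDiffAt ℝ 2 a z.1) (hpos : ∀ v, v ≠ 0 → 0 < a z.1 v v) :
    ContDiffAt ℝ 1 (hamField a) z := by
  have h1 := contDiffAt_velocity (ha.of_le (m := 1) (by norm_num)) hpos
  have h2 : ContDiffAt ℝ 1 (fun z : E × (E →L[ℝ] ℝ) => fderiv ℝ a z.1) z :=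
    ContDiffAt.comp z (ha.fderiv_right (m := 1) (by norm_num)) contDiffAt_fst
  have h3 : ContDiffAt ℝ 1 (fun z : E × (E →L[ℝ] ℝ) =>
      sqCovector (fderiv ℝ a z.1) ((a z.1).inverse z.2)) z := ContDiffAt.sqCovector h2 h1
  exact h1.prodMk (h3.const_smul (1 / 2 : ℝ))

/-- Expand in a dual basis. It turns the geodesic equation, which is tested against each vector
separately, into an equation for the momentum covector. -/
theorem hasDerivAt_clm_of_apply [FiniteDimensional ℝ E] {p : ℝ → E →L[ℝ] ℝ} {p' : E →L[ℝ] ℝ}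
    {t : ℝ} (h : ∀ w, HasDerivAt (fun s => p s w) (p' w) t) : HasDerivAt p p' t := by
  let b := Module.finBasis ℝ E
  have key : ∀ q : E →L[ℝ] ℝ, q = ∑ i, q (b i) • LinearMap.toContinuousLinearMap (b.coord i) := by
    intro q
    ext v
    calc q v = q (∑ i, b.repr v i • b i) := by rw [b.sum_repr]
      _ = _ := by rw [map_sum]; simp [mul_comm]
  have h2 : HasDerivAt (fun s => ∑ i, p s (b i) • LinearMap.toContinuousLinearMap (b.coord i))
      (∑ i, p' (b i) • LinearMap.toContinuousLinearMap (b.coord i)) t :=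
    HasDerivAt.fun_sum fun i _ =>
      HasDerivAt.smul_const (h (b i)) (LinearMap.toContinuousLinearMap (b.coord i))
  rw [← key p'] at h2
  exact h2.congr_of_eventuallyEq (Eventually.of_forall fun s => key (p s))

/-- Local flows of a `C¹` vector field, staying in a prescribed neighbourhood. -/
theorem exists_local_flow {F : Type*} [NormedAddCommGroup F] [NormedSpace ℝ F] [CompleteSpace F]
    {V : F → F} {z : F} (hV : ContDiffAt ℝ 1 V z) {Ω : Set F} (hΩ : Ω ∈ 𝓝 z) :
    ∃ N ∈ 𝓝 z, ∃ ε > (0 : ℝ), ∀ x ∈ N, ∀ t₀ : ℝ, ∃ α : ℝ → F, α t₀ = x ∧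
      ∀ t ∈ Ioo (t₀ - ε) (t₀ + ε), HasDerivAt α (V (α t)) t ∧ α t ∈ Ω := by
  obtain ⟨ε, hε, a, r, L, K, hr, hpl⟩ := IsPicardLindelof.of_contDiffAt_one hV
  obtain ⟨α, hα, hcont⟩ := (hpl 0).exists_forall_mem_closedBall_eq_hasDerivWithinAt_continuousOn
  have hnhds : Metric.closedBall z r ×ˢ Icc (0 - ε) (0 + ε) ∈ 𝓝 (z, (0 : ℝ)) :=
    prod_mem_nhds (Metric.closedBall_mem_nhds z (by exact_mod_cast hr))
      (Icc_mem_nhds (by linarith) (by linarith))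
  -- Continuity of the flow at `(z, 0)`, jointly in the initial point and the time, gives one time
  -- span during which all nearby solutions remain in `Ω`. The initial time is arbitrary since the
  -- field is autonomous.
  have hc := hcont.continuousAt hnhds
  have h0 : α (z, 0) = z := (hα z (Metric.mem_closedBall_self (by positivity))).1
  have hev : ∀ᶠ q in 𝓝 (z, (0 : ℝ)), α q ∈ Ω := hc (by rw [h0]; exact hΩ)
  obtain ⟨N, hN, S, hS, hNS⟩ := mem_nhds_prod_iff.1 (hev.and hnhds)
  obtain ⟨ε', hε', hball⟩ := Metric.mem_nhds_iff.1 hS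
  refine ⟨N, hN, min ε ε', lt_min hε hε', fun x hx t₀ => ⟨fun t => α (x, t - t₀), ?_, ?_⟩⟩
  · have := (hNS (mk_mem_prod hx (mem_of_mem_nhds hS))).2.1
    simpa using (hα x this).1
  · intro t ht
    have hb : Metric.ball (0 : ℝ) ε' = Ioo (-ε') ε' := by simp [Real.ball_eq_Ioo]
    have ht1 : t - t₀ ∈ S := hball (by
      rw [hb]; constructor <;>
      linarith [ht.1, ht.2, min_le_left ε ε', min_le_right ε ε'])
    have hmem := hNS (mk_mem_prod hx ht1)
    refine ⟨?_, hmem.1⟩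
    have ht2 : t - t₀ ∈ Ioo (0 - ε) (0 + ε) := by
      constructor <;> linarith [ht.1, ht.2, min_le_left ε ε', min_le_right ε ε']
    have hd := ((hα x hmem.2.1).2 (t - t₀) (Ioo_subset_Icc_self ht2)).hasDerivAt
      (Icc_mem_nhds ht2.1 ht2.2)
    exact hd.comp_sub_const t t₀

/-- Covariance of the Euler-Lagrange equation of the energy under a change of coordinates. -/
theorem hasDerivAt_momentum_of_change {a b : E → E →L[ℝ] E →L[ℝ] ℝ} {ψ : E → E} {x : ℝ → E} {t : ℝ}
    (hψ : ContDiffAt ℝ 2 ψ (x t)) (hx : ContDiffAt ℝ 1 x t)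
    (hab : ∀ᶠ u in 𝓝 (x t), ∀ v w, a u v w = b (ψ u) (fderiv ℝ ψ u v) (fderiv ℝ ψ u w))
    (hb : DifferentiableAt ℝ b (ψ (x t))) (hsymm : ∀ v w, b (ψ (x t)) v w = b (ψ (x t)) w v)
    (h : HasDerivAt (fun s => b (ψ (x s)) (deriv (fun s => ψ (x s)) s))
      ((1 / 2 : ℝ) • sqCovector (fderiv ℝ b (ψ (x t))) (deriv (fun s => ψ (x s)) t)) t) (w : E) :
    HasDerivAt (fun s => a (x s) (deriv x s) w)
      ((1 / 2 : ℝ) * fderiv ℝ (fun u => a u (deriv x t) (deriv x t)) (x t) w) t := by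
  have hxd : ∀ᶠ s in 𝓝 t, DifferentiableAt ℝ x s :=
    (hx.eventually (by simp)).mono fun s hs => hs.differentiableAt (by simp)
  have hψd : ∀ᶠ u in 𝓝 (x t), DifferentiableAt ℝ ψ u :=
    (hψ.eventually (by simp)).mono fun s hs => hs.differentiableAt (by simp)
  have hxt : HasDerivAt x (deriv x t) t := hxd.self_of_nhds.hasDerivAt
  have hderiv : ∀ᶠ s in 𝓝 t, deriv (fun s => ψ (x s)) s = fderiv ℝ ψ (x s) (deriv x s) := by
    filter_upwards [hxd, hx.continuousAt.eventually hψd] with s h1 h2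
    exact (h2.hasFDerivAt.comp_hasDerivAt s h1.hasDerivAt).deriv
  have hD2 : DifferentiableAt ℝ (fderiv ℝ ψ) (x t) :=
    (hψ.fderiv_right (m := 1) (by norm_num)).differentiableAt (by simp)
  set v := deriv x t with hv
  set y' := deriv (fun s => ψ (x s)) t with hy'
  have hy'eq : y' = fderiv ℝ ψ (x t) v := hderiv.self_of_nhds
  -- The second derivative of the change of coordinates enters once through the velocity and once
  -- through the metric; the two contributions agree because it is symmetric.
  have hsym2 : fderiv ℝ (fderiv ℝ ψ) (x t) v w = fderiv ℝ (fderiv ℝ ψ) (x t) w v :=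
    (hψ.isSymmSndFDerivAt (by simp)) v w
  -- left-hand side
  have hDx : HasDerivAt (fun s => fderiv ℝ ψ (x s) w) (fderiv ℝ (fderiv ℝ ψ) (x t) v w) t := by
    have := hD2.hasFDerivAt.comp_hasDerivAt t hxt
    simpa using this.clm_apply (hasDerivAt_const t w)
  have hL := h.clm_apply hDx
  have hR : HasFDerivAt (fun u => b (ψ u) (fderiv ℝ ψ u v) (fderiv ℝ ψ u v)) _ (x t) :=
    ((hb.hasFDerivAt.comp (x t) hψd.self_of_nhds.hasFDerivAt).clm_apply
      (hD2.hasFDerivAt.clm_apply (hasFDerivAt_const v (x t)))).clm_apply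
      (hD2.hasFDerivAt.clm_apply (hasFDerivAt_const v (x t)))
  have hR' : fderiv ℝ (fun u => a u v v) (x t) w =
      fderiv ℝ b (ψ (x t)) (fderiv ℝ ψ (x t) w) y' y' +
        2 * b (ψ (x t)) y' (fderiv ℝ (fderiv ℝ ψ) (x t) w v) := by
    have : (fun u => a u v v) =ᶠ[𝓝 (x t)]
        fun u => b (ψ u) (fderiv ℝ ψ u v) (fderiv ℝ ψ u v) := hab.mono fun u hu => hu v v
    rw [this.fderiv_eq, hR.fderiv, hy'eq]
    simp
    rw [hsymm (fderiv ℝ (fderiv ℝ ψ) (x t) w v)]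
    ring
  have hfun : (fun s => a (x s) (deriv x s) w) =ᶠ[𝓝 t]
      fun s => b (ψ (x s)) (deriv (fun s => ψ (x s)) s) (fderiv ℝ ψ (x s) w) := by
    filter_upwards [hx.continuousAt.eventually hab, hderiv] with s h1 h2
    rw [h1, h2]
  refine (hL.congr_of_eventuallyEq hfun).congr_deriv ?_
  rw [hR', hsym2]
  simp
  ring

end HamiltonianField

end WarpedGeodesics

namespace WarpedGeodesics

theorem two_le_infty : (2 : ℕ∞ω) ≤ ∞ := WithTop.coe_le_coe.2 (le_top : (2 : ℕ∞) ≤ ⊤)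

/-! ### Geodesics in a chart and their independence of the chart. -/

section LocalGeodesics

variable {E : Type*} [NormedAddCommGroup E] [NormedSpace ℝ E]
  {H : Type*} [TopologicalSpace H] (I : ModelWithCorners ℝ E H)
  {M : Type*} [TopologicalSpace M] [ChartedSpace H M]
  (G : (x : M) → TangentSpace I x →L[ℝ] TangentSpace I x →L[ℝ] ℝ)

/-- The value of a field of bilinear forms, as a bilinear form on the model space. -/
def formAt (x : M) : E →L[ℝ] E →L[ℝ] ℝ := G x

/-- The coordinates of the part of `U` covered by the preferred chart at `x₀`. -/
def chartDomain (x₀ : M) (U : Set M) : Set E :=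
  (extChartAt I x₀).target ∩ (extChartAt I x₀).symm ⁻¹' U

/-- `G` is a Riemannian metric of class `C²` on the open set `U`. -/
structure RegularMetricOn (U : Set M) : Prop where
  isOpen : IsOpen U
  contDiffOn : ∀ x₀, ContDiffOn ℝ 2 (coordForm I G x₀) (chartDomain I x₀ U)
  symm : ∀ x ∈ U, ∀ v w, formAt I G x v w = formAt I G x w v
  pos : ∀ x ∈ U, ∀ v, v ≠ 0 → 0 < formAt I G x v v

/-- A curve in the coordinates of the preferred chart at `x₀`. -/
def chartCurve (x₀ : M) (γ : ℝ → M) (s : ℝ) : E := extChartAt I x₀ (γ s)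

/-- The momentum `g(γ', ·)` of a curve, in the coordinates of the preferred chart at `x₀`. -/
def momentum (x₀ : M) (γ : ℝ → M) (s : ℝ) : E →L[ℝ] ℝ :=
  coordForm I G x₀ (chartCurve I x₀ γ s) (deriv (chartCurve I x₀ γ) s)

/-- Position and momentum of a curve, in the coordinates of the preferred chart at `x₀`. -/
def chartState (x₀ : M) (γ : ℝ → M) (s : ℝ) : E × (E →L[ℝ] ℝ) :=
  (chartCurve I x₀ γ s, momentum I G x₀ γ s)

/-- The geodesic equation at time `t` in the preferred chart at `x₀`. -/
def SatisfiesEulerLagrange (x₀ : M) (γ : ℝ → M) (t : ℝ) : Prop :=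
  ∀ w : E, HasDerivAt
    (fun s => coordMetric I G x₀ (chartCurve I x₀ γ s) (deriv (chartCurve I x₀ γ) s) w)
    ((1 / 2 : ℝ) * fderiv ℝ (fun u => coordMetric I G x₀ u (deriv (chartCurve I x₀ γ) t)
      (deriv (chartCurve I x₀ γ) t)) (chartCurve I x₀ γ t) w) t

variable {I G}

theorem coordForm_apply (x₀ : M) (u v w : E) : coordForm I G x₀ u v w =
    formAt I G ((extChartAt I x₀).symm u) (chartDeriv I x₀ u v) (chartDeriv I x₀ u w) := rfl

theorem isOpen_chartDomain [I.Boundaryless] (x₀ : M) {U : Set M} (hU : IsOpen U) :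
    IsOpen (chartDomain I x₀ U) :=
  (continuousOn_extChartAt_symm x₀).isOpen_inter_preimage (isOpen_extChartAt_target x₀) hU

variable [I.Boundaryless] [IsManifold I ∞ M]

theorem chartDeriv_injective {x₀ : M} {u : E} (hu : u ∈ (extChartAt I x₀).target) :
    Function.Injective (chartDeriv I x₀ u) := by
  have : IsManifold I 1 M := IsManifold.of_le (n := ∞) (by simp)
  have h := isInvertible_mfderivWithin_extChartAt_symm (I := I) hu
  rw [I.range_eq_univ, mfderivWithin_univ] at h
  exact h.bijective.injective

theorem hasMFDerivAt_extChartAt_symm {x₀ : M} {u : E} (hu : u ∈ (extChartAt I x₀).target) :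
    HasMFDerivAt 𝓘(ℝ, E) I (extChartAt I x₀).symm u
      (mfderiv 𝓘(ℝ, E) I (extChartAt I x₀).symm u) := by
  have : IsManifold I 1 M := IsManifold.of_le (n := ∞) (by simp)
  have h := mdifferentiableWithinAt_extChartAt_symm (I := I) hu
  rw [I.range_eq_univ, mdifferentiableWithinAt_univ] at h
  exact h.hasMFDerivAt

variable {x₀ x₁ : M} {U : Set M} {γ : ℝ → M} {t : ℝ}

theorem mem_chartDomain (hx : γ t ∈ (extChartAt I x₀).source) (hU : γ t ∈ U) :
    chartCurve I x₀ γ t ∈ chartDomain I x₀ U := by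
  refine ⟨(extChartAt I x₀).map_source hx, ?_⟩
  change (extChartAt I x₀).symm ((extChartAt I x₀) (γ t)) ∈ U
  rwa [(extChartAt I x₀).left_inv hx]

namespace RegularMetricOn

variable (hG : RegularMetricOn I G U)
include hG

theorem coordForm_pos {u : E} (hu : u ∈ chartDomain I x₀ U) :
    ∀ v, v ≠ 0 → 0 < coordForm I G x₀ u v v := by
  intro v hv
  refine hG.pos _ hu.2 _ fun h => hv ?_
  exact chartDeriv_injective hu.1 (h.trans (map_zero _).symm)

theorem coordForm_symm {u : E} (hu : u ∈ chartDomain I x₀ U) (v w : E) :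
    coordForm I G x₀ u v w = coordForm I G x₀ u w v := hG.symm _ hu.2 _ _

theorem contDiffAt {u : E} (hu : u ∈ chartDomain I x₀ U) :
    ContDiffAt ℝ 2 (coordForm I G x₀) u :=
  (hG.contDiffOn x₀).contDiffAt ((isOpen_chartDomain x₀ hG.isOpen).mem_nhds hu)

theorem differentiableAt {u : E} (hu : u ∈ chartDomain I x₀ U) :
    DifferentiableAt ℝ (coordForm I G x₀) u := (hG.contDiffAt hu).differentiableAt (by simp)

theorem contDiffAt_hamField [FiniteDimensional ℝ E] {z : E × (E →L[ℝ] ℝ)}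
    (hu : z.1 ∈ chartDomain I x₀ U) : ContDiffAt ℝ 1 (hamField (coordForm I G x₀)) z :=
  WarpedGeodesics.contDiffAt_hamField (hG.contDiffAt hu) (hG.coordForm_pos hu)

/-- The right-hand side is the second of Hamilton's equations; the first one is the definition of
the momentum. -/
theorem satisfiesEulerLagrange_iff [FiniteDimensional ℝ E]
    (hx : γ t ∈ (extChartAt I x₀).source) (hU : γ t ∈ U) :
    SatisfiesEulerLagrange I G x₀ γ t ↔ HasDerivAt (momentum I G x₀ γ)
      ((1 / 2 : ℝ) • sqCovector (fderiv ℝ (coordForm I G x₀) (chartCurve I x₀ γ t))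
        (deriv (chartCurve I x₀ γ) t)) t := by
  have hd := hG.differentiableAt (mem_chartDomain hx hU)
  have key : ∀ v w : E, fderiv ℝ (fun u => coordMetric I G x₀ u v v) (chartCurve I x₀ γ t) w =
      fderiv ℝ (coordForm I G x₀) (chartCurve I x₀ γ t) w v v := by
    intro v w
    have h1 : HasFDerivAt (fun u => coordForm I G x₀ u v v) _ (chartCurve I x₀ γ t) :=
      (hd.hasFDerivAt.clm_apply (hasFDerivAt_const v _)).clm_apply (hasFDerivAt_const v _)
    change fderiv ℝ (fun u => coordForm I G x₀ u v v) (chartCurve I x₀ γ t) w = _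
    rw [h1.fderiv]
    simp
  constructor
  · intro h
    refine hasDerivAt_clm_of_apply fun w => (h w).congr_deriv ?_
    rw [key]
    rfl
  · intro h w
    rw [key]
    have := h.clm_apply (hasDerivAt_const t w)
    refine this.congr_deriv ?_
    simp

end RegularMetricOn

theorem contDiffAt_chartCurve {n : ℕ∞ω} (hn : n ≤ ∞) (hγ : ContMDiffAt 𝓘(ℝ, ℝ) I n γ t)
    (hx : γ t ∈ (extChartAt I x₀).source) : ContDiffAt ℝ n (chartCurve I x₀ γ) t := by
  have : IsManifold I n M := IsManifold.of_le (n := ∞) hn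
  rw [extChartAt_source] at hx
  exact ((contMDiffAt_extChartAt' hx).comp t hγ).contDiffAt

theorem eventually_mem_source (hγ : ContinuousAt γ t) (hx : γ t ∈ (extChartAt I x₀).source) :
    ∀ᶠ s in 𝓝 t, γ s ∈ (extChartAt I x₀).source :=
  hγ.eventually ((isOpen_extChartAt_source x₀).mem_nhds hx)

/-- The change of coordinates between preferred charts. -/
def chartChange (I : ModelWithCorners ℝ E H) (x₀ x₁ : M) (u : E) : E :=
  extChartAt I x₁ ((extChartAt I x₀).symm u)

theorem contDiffAt_chartChange {u : E} (hu : u ∈ (extChartAt I x₀).target)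
    (hu₁ : (extChartAt I x₀).symm u ∈ (extChartAt I x₁).source) :
    ContDiffAt ℝ ∞ (chartChange I x₀ x₁) u := by
  have h := contDiffWithinAt_ext_coord_change (I := I) (n := ∞) (M := M) x₁ x₀ (y := u)
    (by simp only [PartialEquiv.trans_source, PartialEquiv.symm_source]; exact ⟨hu, hu₁⟩)
  rw [I.range_eq_univ, contDiffWithinAt_univ] at h
  exact h

/-- Near `u` the inverse chart at `x₀` is the inverse chart at `x₁` after the change of coordinates;
apply the chain rule. -/
theorem coordForm_chartChange {u : E} (hu : u ∈ (extChartAt I x₀).target)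
    (hu₁ : (extChartAt I x₀).symm u ∈ (extChartAt I x₁).source) (v w : E) :
    coordForm I G x₀ u v w = coordForm I G x₁ (chartChange I x₀ x₁ u)
      (fderiv ℝ (chartChange I x₀ x₁) u v) (fderiv ℝ (chartChange I x₀ x₁) u w) := by
  have hψ : chartChange I x₀ x₁ u ∈ (extChartAt I x₁).target := (extChartAt I x₁).map_source hu₁
  have hψd : DifferentiableAt ℝ (chartChange I x₀ x₁) u :=
    (contDiffAt_chartChange hu hu₁).differentiableAt (by simp)
  have h1 := (hasMFDerivAt_extChartAt_symm hψ).comp u hψd.hasFDerivAt.hasMFDerivAt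
  have hev : (extChartAt I x₀).symm =ᶠ[𝓝 u] ((extChartAt I x₁).symm ∘ chartChange I x₀ x₁) := by
    filter_upwards [(isOpen_chartDomain (I := I) x₀ (isOpen_extChartAt_source x₁)).mem_nhds
      ⟨hu, hu₁⟩] with u' hu'
    exact ((extChartAt I x₁).left_inv hu'.2).symm
  have h2 := h1.congr_of_eventuallyEq hev
  have h3 : chartDeriv I x₀ u =
      (chartDeriv I x₁ (chartChange I x₀ x₁ u)).comp (fderiv ℝ (chartChange I x₀ x₁) u) :=
    hasMFDerivAt_unique (hasMFDerivAt_extChartAt_symm hu) h2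
  have h4 : (extChartAt I x₁).symm (chartChange I x₀ x₁ u) = (extChartAt I x₀).symm u :=
    (extChartAt I x₁).left_inv hu₁
  rw [coordForm_apply, coordForm_apply, h4, h3]
  rfl

/-- A geodesic has to satisfy its equation in every preferred chart, whereas solutions are
constructed in one; covariance bridges the gap. -/
theorem RegularMetricOn.satisfiesEulerLagrange_of_chart [FiniteDimensional ℝ E]
    (hG : RegularMetricOn I G U) (hγ : ContMDiffAt 𝓘(ℝ, ℝ) I 2 γ t) (hU : γ t ∈ U)
    (hx₁ : γ t ∈ (extChartAt I x₁).source) (h : SatisfiesEulerLagrange I G x₁ γ t)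
    (hx₀ : γ t ∈ (extChartAt I x₀).source) : SatisfiesEulerLagrange I G x₀ γ t := by
  have hmem := mem_chartDomain hx₀ hx₁
  have hev : (fun s => chartChange I x₀ x₁ (chartCurve I x₀ γ s)) =ᶠ[𝓝 t] chartCurve I x₁ γ := by
    filter_upwards [eventually_mem_source hγ.continuousAt hx₀] with s hs
    simp only [chartChange, chartCurve]
    rw [(extChartAt I x₀).left_inv hs]
  have hmom : (fun s => coordForm I G x₁ (chartChange I x₀ x₁ (chartCurve I x₀ γ s))
      (deriv (fun s => chartChange I x₀ x₁ (chartCurve I x₀ γ s)) s)) =ᶠ[𝓝 t]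
      momentum I G x₁ γ := by
    filter_upwards [hev, hev.deriv] with s h1 h2
    rw [h1, h2]
    rfl
  rw [hG.satisfiesEulerLagrange_iff hx₁ hU, ← hev.deriv_eq, ← hev.eq_of_nhds] at h
  have hm₁ := mem_chartDomain hx₁ hU
  rw [← hev.eq_of_nhds] at hm₁
  intro w
  refine hasDerivAt_momentum_of_change (ψ := chartChange I x₀ x₁) (x := chartCurve I x₀ γ)
    (a := coordForm I G x₀) (b := coordForm I G x₁)
    ((contDiffAt_chartChange hmem.1 hmem.2).of_le two_le_infty)
    (contDiffAt_chartCurve (by simp) (hγ.of_le (by norm_num)) hx₀) ?_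
    (hG.differentiableAt hm₁) (hG.coordForm_symm hm₁) (h.congr_of_eventuallyEq hmom) w
  filter_upwards [(isOpen_chartDomain (I := I) x₀ (isOpen_extChartAt_source x₁)).mem_nhds hmem]
    with u hu v w
  exact coordForm_chartChange hu.1 hu.2 v w

theorem chartDeriv_deriv_chartCurve (hγ : MDifferentiableAt 𝓘(ℝ, ℝ) I γ t)
    (hx : γ t ∈ (extChartAt I x₀).source) :
    chartDeriv I x₀ (chartCurve I x₀ γ t) (deriv (chartCurve I x₀ γ) t) = velocity I γ t := by
  have : IsManifold I 1 M := IsManifold.of_le (n := ∞) (by simp)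
  have hu : chartCurve I x₀ γ t ∈ (extChartAt I x₀).target := (extChartAt I x₀).map_source hx
  have hd : DifferentiableAt ℝ (chartCurve I x₀ γ) t := by
    rw [extChartAt_source] at hx
    exact ((mdifferentiableAt_extChartAt hx).comp t hγ).differentiableAt
  have h1 := (hasMFDerivAt_extChartAt_symm hu).comp t hd.hasFDerivAt.hasMFDerivAt
  have hev : γ =ᶠ[𝓝 t] ((extChartAt I x₀).symm ∘ chartCurve I x₀ γ) := by
    filter_upwards [eventually_mem_source hγ.continuousAt hx] with s hs
    exact ((extChartAt I x₀).left_inv hs).symm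
  have h2 := h1.congr_of_eventuallyEq hev
  have h3 := hasMFDerivAt_unique hγ.hasMFDerivAt h2
  unfold velocity
  rw [h3]
  change _ = chartDeriv I x₀ (chartCurve I x₀ γ t) (fderiv ℝ (chartCurve I x₀ γ) t 1)
  rw [fderiv_apply_one_eq_deriv]

theorem coordForm_deriv_chartCurve (hγ : MDifferentiableAt 𝓘(ℝ, ℝ) I γ t)
    (hx : γ t ∈ (extChartAt I x₀).source) :
    coordForm I G x₀ (chartCurve I x₀ γ t) (deriv (chartCurve I x₀ γ) t)
      (deriv (chartCurve I x₀ γ) t) = G (γ t) (velocity I γ t) (velocity I γ t) := by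
  rw [coordForm_apply, chartDeriv_deriv_chartCurve hγ hx]
  have : (extChartAt I x₀).symm (chartCurve I x₀ γ t) = γ t := (extChartAt I x₀).left_inv hx
  rw [this]
  rfl

namespace RegularMetricOn

variable [FiniteDimensional ℝ E] (hG : RegularMetricOn I G U)
include hG

theorem hasDerivAt_chartState {J : Set ℝ} (hJ : IsOpen J) (hγ : IsGeodesicOn I G γ J)
    (ht : t ∈ J) (hU : γ t ∈ U) (hx : γ t ∈ (extChartAt I x₀).source) :
    HasDerivAt (chartState I G x₀ γ) (hamField (coordForm I G x₀) (chartState I G x₀ γ t)) t := by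
  have h2 := hγ.1.contMDiffAt (hJ.mem_nhds ht)
  have hd := (contDiffAt_chartCurve two_le_infty h2 hx).differentiableAt (by simp)
  have hp := (hG.satisfiesEulerLagrange_iff hx hU).1 (hγ.2 x₀ t ht hx)
  have hinv : (coordForm I G x₀ (chartCurve I x₀ γ t)).inverse (momentum I G x₀ γ t) =
      deriv (chartCurve I x₀ γ) t :=
    inverse_apply_of_pos (hG.coordForm_pos (mem_chartDomain hx hU)) _
  have := hd.hasDerivAt.prodMk hp
  rw [← hinv] at this
  exact this

/-- Solutions of Hamilton's equations in a chart are geodesics. -/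
theorem isGeodesicOn_of_hasDerivAt {z : ℝ → E × (E →L[ℝ] ℝ)} {T : Set ℝ} (hT : IsOpen T)
    (hz : ∀ t ∈ T, HasDerivAt z (hamField (coordForm I G x₀) (z t)) t)
    (hzU : ∀ t ∈ T, (z t).1 ∈ chartDomain I x₀ U) :
    IsGeodesicOn I G (fun t => (extChartAt I x₀).symm (z t).1) T ∧
      ∀ t ∈ T, chartState I G x₀ (fun t => (extChartAt I x₀).symm (z t).1) t = z t := by
  set γ : ℝ → M := fun t => (extChartAt I x₀).symm (z t).1 with hγdef
  have hsrc : ∀ t ∈ T, γ t ∈ (extChartAt I x₀).source := fun t ht =>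
    (extChartAt I x₀).map_target (hzU t ht).1
  have hγU : ∀ t ∈ T, γ t ∈ U := fun t ht => (hzU t ht).2
  have hcurve : ∀ t ∈ T, chartCurve I x₀ γ t = (z t).1 := fun t ht =>
    (extChartAt I x₀).right_inv (hzU t ht).1
  have hzd : DifferentiableOn ℝ z T := fun t ht => (hz t ht).differentiableAt.differentiableWithinAt
  have hder : ∀ t ∈ T, deriv z t = hamField (coordForm I G x₀) (z t) := fun t ht => (hz t ht).deriv
  have hcomp : ∀ n : ℕ∞ω, n ≤ 1 → ContDiffOn ℝ n z T →
      ContDiffOn ℝ n (deriv z) T := by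
    intro n hn h
    refine ContDiffOn.congr (f := fun t => hamField (coordForm I G x₀) (z t)) ?_ hder
    intro t ht
    exact ((hG.contDiffAt_hamField (hzU t ht)).of_le hn).comp_contDiffWithinAt t (h t ht)
  -- Bootstrapping: `z` is continuous, so `z'`, the field along `z`, is continuous; then `z` is
  -- `C¹`, so `z'` is `C¹` and `z` is `C²`, as the definition of a geodesic demands.
  have hz1 : ContDiffOn ℝ 1 z T := by
    rw [show (1 : ℕ∞ω) = 0 + 1 by norm_num, contDiffOn_succ_iff_deriv_of_isOpen hT]
    exact ⟨hzd, by simp, hcomp 0 (by simp) (contDiffOn_zero.2 hzd.continuousOn)⟩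
  have hz2 : ContDiffOn ℝ 2 z T := by
    rw [show (2 : ℕ∞ω) = 1 + 1 by norm_num, contDiffOn_succ_iff_deriv_of_isOpen hT]
    exact ⟨hzd, by simp, hcomp 1 le_rfl hz1⟩
  have hγ2 : ContMDiffOn 𝓘(ℝ, ℝ) I 2 γ T := by
    have : IsManifold I 2 M := IsManifold.of_le (n := ∞) two_le_infty
    exact (contMDiffOn_extChartAt_symm x₀).comp (contDiff_fst.comp_contDiffOn hz2).contMDiffOn
      (fun t ht => (hzU t ht).1)
  have hderc : ∀ t ∈ T, deriv (chartCurve I x₀ γ) t = (deriv z t).1 := by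
    intro t ht
    have hev : chartCurve I x₀ γ =ᶠ[𝓝 t] fun s => (z s).1 := by
      filter_upwards [hT.mem_nhds ht] with s hs using hcurve s hs
    rw [hev.deriv_eq, (hz t ht).deriv]
    exact ((ContinuousLinearMap.fst ℝ E (E →L[ℝ] ℝ)).hasFDerivAt.comp_hasDerivAt t (hz t ht)).deriv
  have hmom : ∀ t ∈ T, momentum I G x₀ γ t = (z t).2 := by
    intro t ht
    unfold momentum
    rw [hderc t ht, hcurve t ht, hder t ht]
    exact apply_inverse_of_pos (hG.coordForm_pos (hzU t ht)) _
  refine ⟨⟨hγ2, fun x₁ t ht hx₁ => ?_⟩, fun t ht => Prod.ext (hcurve t ht) (hmom t ht)⟩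
  refine hG.satisfiesEulerLagrange_of_chart (hγ2.contMDiffAt (hT.mem_nhds ht)) (hγU t ht)
    (hsrc t ht) ?_ hx₁
  rw [hG.satisfiesEulerLagrange_iff (hsrc t ht) (hγU t ht), hderc t ht, hcurve t ht, hder t ht]
  refine ((ContinuousLinearMap.snd ℝ E (E →L[ℝ] ℝ)).hasFDerivAt.comp_hasDerivAt t
    (hz t ht)).congr_of_eventuallyEq ?_
  filter_upwards [hT.mem_nhds ht] with s hs using hmom s hs

end RegularMetricOn

end LocalGeodesics

end WarpedGeodesics

/-! ### Uniqueness and extension of geodesics, conservation of energy. -/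

namespace WarpedGeodesics

/-- Minimise over `K` times the unit sphere, which is compact, and use homogeneity in `v`. -/
theorem exists_pos_mul_sq_le_of_isCompact {E : Type*} [NormedAddCommGroup E] [NormedSpace ℝ E]
    [FiniteDimensional ℝ E] {P : Type*} [TopologicalSpace P] {K : Set P} (hK : IsCompact K)
    {b : P → E →L[ℝ] E →L[ℝ] ℝ} (hb : ContinuousOn b K)
    (hpos : ∀ q ∈ K, ∀ v, v ≠ 0 → 0 < b q v v) :
    ∃ m > 0, ∀ q ∈ K, ∀ v, m * ‖v‖ ^ 2 ≤ b q v v := by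
  have : ProperSpace E := FiniteDimensional.proper ℝ E
  have hcont : ContinuousOn (fun q : P × E => b q.1 q.2 q.2) (K ×ˢ Metric.sphere (0 : E) 1) := by
    have h1 : ContinuousOn (fun q : P × E => b q.1) (K ×ˢ Metric.sphere (0 : E) 1) :=
      hb.comp continuousOn_fst fun q hq => hq.1
    exact (h1.clm_apply continuousOn_snd).clm_apply continuousOn_snd
  obtain ⟨m, hm, hle⟩ := (hK.prod (isCompact_sphere (0 : E) 1)).exists_forall_le' hcont
    (a := 0) (fun q hq => hpos q.1 hq.1 q.2 (by
      rintro h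
      have := hq.2
      simp [h] at this))
  refine ⟨m, hm, fun q hq v => ?_⟩
  rcases eq_or_ne v 0 with rfl | hv
  · simp
  have hn : 0 < ‖v‖ := norm_pos_iff.2 hv
  have := hle (q, ‖v‖⁻¹ • v) ⟨hq, by simp [norm_smul, hn.ne']⟩
  simp only [map_smul, _root_.smul_apply, smul_eq_mul] at this
  have h2 := mul_le_mul_of_nonneg_right this (sq_nonneg ‖v‖)
  refine h2.trans_eq ?_
  field_simp

section GlobalGeodesics

variable {E : Type*} [NormedAddCommGroup E] [NormedSpace ℝ E]
  {H : Type*} [TopologicalSpace H] {I : ModelWithCorners ℝ E H}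
  {M : Type*} [TopologicalSpace M] [ChartedSpace H M]
  {G : (x : M) → TangentSpace I x →L[ℝ] TangentSpace I x →L[ℝ] ℝ}
  {x₀ : M} {U : Set M} {γ γ₁ γ₂ : ℝ → M} {J : Set ℝ} {t : ℝ}

theorem SatisfiesEulerLagrange.congr {β : ℝ → M} (h : SatisfiesEulerLagrange I G x₀ β t)
    (hev : γ =ᶠ[𝓝 t] β) : SatisfiesEulerLagrange I G x₀ γ t := by
  have h1 : chartCurve I x₀ γ =ᶠ[𝓝 t] chartCurve I x₀ β :=
    hev.mono fun s hs => congrArg (extChartAt I x₀) hs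
  intro w
  rw [h1.deriv_eq, h1.eq_of_nhds]
  refine (h w).congr_of_eventuallyEq ?_
  filter_upwards [h1, h1.deriv] with s h2 h3
  rw [h2, h3]

/-- The geodesic equation is local in time, so geodesics can be glued. -/
theorem isGeodesicOn_of_locally (h : ∀ t ∈ J, ∃ β T, IsOpen T ∧ t ∈ T ∧ IsGeodesicOn I G β T ∧
    γ =ᶠ[𝓝 t] β) : IsGeodesicOn I G γ J := by
  refine ⟨fun t ht => ?_, fun x₀ t ht hx => ?_⟩
  · obtain ⟨β, T, hT, htT, hβ, hev⟩ := h t ht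
    exact ((hβ.1.contMDiffAt (hT.mem_nhds htT)).congr_of_eventuallyEq hev).contMDiffWithinAt
  · obtain ⟨β, T, hT, htT, hβ, hev⟩ := h t ht
    exact SatisfiesEulerLagrange.congr (hβ.2 x₀ t htT (hev.eq_of_nhds ▸ hx)) hev

theorem IsGeodesicOn.mono {J' : Set ℝ} (h : IsGeodesicOn I G γ J) (hJ : J' ⊆ J) :
    IsGeodesicOn I G γ J' := ⟨h.1.mono hJ, fun x₀ t ht => h.2 x₀ t (hJ ht)⟩

theorem IsGeodesicOn.continuousAt (h : IsGeodesicOn I G γ J) (hJ : IsOpen J) (ht : t ∈ J) :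
    ContinuousAt γ t := (h.1.contMDiffAt (hJ.mem_nhds ht)).continuousAt

/-- Time reversal flips the sign of the velocity, and the momentum acquires a second sign on
differentiation, while the other side of the equation is quadratic in the velocity. It lets
arguments about one end of an interval serve for the other. -/
theorem IsGeodesicOn.comp_neg (h : IsGeodesicOn I G γ J) :
    IsGeodesicOn I G (fun t => γ (-t)) (Neg.neg ⁻¹' J) := by
  refine ⟨h.1.comp contDiff_neg.contMDiff.contMDiffOn (fun t ht => ht), fun x₀ t ht hx w => ?_⟩
  have h1 := h.2 x₀ (-t) ht hx w
  have hd : ∀ s, deriv (chartCurve I x₀ fun t => γ (-t)) s = - deriv (chartCurve I x₀ γ) (-s) :=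
    fun s => deriv_comp_neg (f := chartCurve I x₀ γ) s
  have h2 := h1.comp t (hasDerivAt_neg t)
  change HasDerivAt (fun s => coordMetric I G x₀ (chartCurve I x₀ (fun t => γ (-t)) s)
    (deriv (chartCurve I x₀ fun t => γ (-t)) s) w) ((1 / 2 : ℝ) * fderiv ℝ (fun u =>
      coordMetric I G x₀ u (deriv (chartCurve I x₀ fun t => γ (-t)) t)
      (deriv (chartCurve I x₀ fun t => γ (-t)) t)) (chartCurve I x₀ γ (-t)) w) t
  simp only [hd, coordMetric_eq_coordForm, map_neg, _root_.neg_apply, neg_neg]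
  refine (h2.neg.congr_of_eventuallyEq (Eventually.of_forall fun s => ?_)).congr_deriv ?_
  · rfl
  · simp only [mul_neg, mul_one, neg_neg]
    rfl

variable [I.Boundaryless] [IsManifold I ∞ M] [FiniteDimensional ℝ E]

namespace RegularMetricOn

variable (hG : RegularMetricOn I G U)
include hG

/-- A `C¹` field is locally Lipschitz, so position and momentum determine the solution of Hamilton's
equations; the chart is injective. -/
theorem eventuallyEq_of_chartState_eq (hJ : IsOpen J) (h₁ : IsGeodesicOn I G γ₁ J)
    (h₂ : IsGeodesicOn I G γ₂ J) (hU₁ : MapsTo γ₁ J U) (hU₂ : MapsTo γ₂ J U) (ht : t ∈ J)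
    (hx₁ : γ₁ t ∈ (extChartAt I x₀).source) (hx₂ : γ₂ t ∈ (extChartAt I x₀).source)
    (hs : chartState I G x₀ γ₁ t = chartState I G x₀ γ₂ t) : γ₁ =ᶠ[𝓝 t] γ₂ := by
  obtain ⟨K, S, hS, hK⟩ := (hG.contDiffAt_hamField (z := chartState I G x₀ γ₁ t)
    (mem_chartDomain hx₁ (hU₁ ht))).exists_lipschitzOnWith
  have key : ∀ γ, IsGeodesicOn I G γ J → MapsTo γ J U → γ t ∈ (extChartAt I x₀).source →
      S ∈ 𝓝 (chartState I G x₀ γ t) → ∀ᶠ s in 𝓝 t, HasDerivAt (chartState I G x₀ γ)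
        (hamField (coordForm I G x₀) (chartState I G x₀ γ s)) s ∧ chartState I G x₀ γ s ∈ S := by
    intro γ h hU hx hSt
    have hd := hG.hasDerivAt_chartState hJ h ht (hU ht) hx
    filter_upwards [eventually_mem_source (h.continuousAt hJ ht) hx, hJ.mem_nhds ht,
      hd.continuousAt.eventually hSt] with s h1 h2 h3
    exact ⟨hG.hasDerivAt_chartState hJ h h2 (hU h2) h1, h3⟩
  have heq := ODE_solution_unique_of_eventually
    (v := fun _ => hamField (coordForm I G x₀)) (s := fun _ => S) (K := K)
    (Eventually.of_forall fun _ => hK) (key γ₁ h₁ hU₁ hx₁ hS) (key γ₂ h₂ hU₂ hx₂ (hs ▸ hS)) hs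
  filter_upwards [heq, eventually_mem_source (h₁.continuousAt hJ ht) hx₁,
    eventually_mem_source (h₂.continuousAt hJ ht) hx₂] with s h3 h4 h5
  exact (extChartAt I x₀).injOn h4 h5 (congrArg Prod.fst h3)

/-- The times near which the curves coincide form an open set, nonempty by the local statement. At a
limit time in `J` the positions agree since `M` is Hausdorff, and the momenta agree by continuity,
so this set is also relatively closed. -/
theorem eqOn_of_chartState_eq [T2Space M] (hJ : IsOpen J) (hJc : IsPreconnected J)
    (h₁ : IsGeodesicOn I G γ₁ J) (h₂ : IsGeodesicOn I G γ₂ J) (hU₁ : MapsTo γ₁ J U)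
    (hU₂ : MapsTo γ₂ J U) (ht : t ∈ J)
    (hx₁ : γ₁ t ∈ (extChartAt I x₀).source) (hx₂ : γ₂ t ∈ (extChartAt I x₀).source)
    (hs : chartState I G x₀ γ₁ t = chartState I G x₀ γ₂ t) : EqOn γ₁ γ₂ J := by
  have hopen : IsOpen {s | γ₁ =ᶠ[𝓝 s] γ₂} := isOpen_setOfPred_eventually_nhds
  have hsub : J ⊆ {s | γ₁ =ᶠ[𝓝 s] γ₂} := by
    refine hJc.subset_of_closure_inter_subset hopen
      ⟨t, ht, hG.eventuallyEq_of_chartState_eq hJ h₁ h₂ hU₁ hU₂ ht hx₁ hx₂ hs⟩ ?_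
    rintro s ⟨hsc, hsJ⟩
    have hfreq : ∃ᶠ s' in 𝓝 s, γ₁ =ᶠ[𝓝 s'] γ₂ := mem_closure_iff_frequently.1 hsc
    have heq : γ₁ s = γ₂ s := tendsto_nhds_unique_of_frequently_eq
      (h₁.continuousAt hJ hsJ) (h₂.continuousAt hJ hsJ) (hfreq.mono fun s' h => h.eq_of_nhds)
    have hx : γ₁ s ∈ (extChartAt I (γ₁ s)).source := mem_extChartAt_source _
    have hx' : γ₂ s ∈ (extChartAt I (γ₁ s)).source := heq ▸ hx
    refine hG.eventuallyEq_of_chartState_eq hJ h₁ h₂ hU₁ hU₂ hsJ hx hx' ?_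
    refine tendsto_nhds_unique_of_frequently_eq
      (hG.hasDerivAt_chartState hJ h₁ hsJ (hU₁ hsJ) hx).continuousAt
      (hG.hasDerivAt_chartState hJ h₂ hsJ (hU₂ hsJ) hx').continuousAt
      (hfreq.mono fun s' h => ?_)
    have h1 : chartCurve I (γ₁ s) γ₁ =ᶠ[𝓝 s'] chartCurve I (γ₁ s) γ₂ :=
      h.mono fun s hs => congrArg (extChartAt I _) hs
    simp only [chartState, momentum, h1.deriv_eq, h1.eq_of_nhds]
  exact fun s hs => (hsub hs).eq_of_nhds

/-- Local existence of geodesics, for a uniform time near a given state. -/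
theorem exists_geodesic_near {z₀ : E × (E →L[ℝ] ℝ)} (hz₀ : z₀.1 ∈ chartDomain I x₀ U) :
    ∃ N ∈ 𝓝 z₀, ∃ ε > (0 : ℝ), ∀ z ∈ N, ∀ t₀ : ℝ, ∃ β : ℝ → M,
      IsGeodesicOn I G β (Ioo (t₀ - ε) (t₀ + ε)) ∧ MapsTo β (Ioo (t₀ - ε) (t₀ + ε)) U ∧
      β t₀ ∈ (extChartAt I x₀).source ∧ chartState I G x₀ β t₀ = z := by
  have : CompleteSpace E := FiniteDimensional.complete ℝ E
  obtain ⟨N, hN, ε, hε, h⟩ := exists_local_flow (hG.contDiffAt_hamField hz₀)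
    (Ω := Prod.fst ⁻¹' chartDomain I x₀ U)
    (continuousAt_fst.preimage_mem_nhds ((isOpen_chartDomain x₀ hG.isOpen).mem_nhds hz₀))
  refine ⟨N, hN, ε, hε, fun z hz t₀ => ?_⟩
  obtain ⟨α, hα0, hα⟩ := h z hz t₀
  have ht₀ : t₀ ∈ Ioo (t₀ - ε) (t₀ + ε) := ⟨by linarith, by linarith⟩
  obtain ⟨h1, h2⟩ := hG.isGeodesicOn_of_hasDerivAt (x₀ := x₀) isOpen_Ioo (fun t ht => (hα t ht).1)
    (fun t ht => (hα t ht).2)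
  exact ⟨_, h1, fun t ht => (hα t ht).2.2, (extChartAt I x₀).map_target (hα t₀ ht₀).2.1,
    (h2 t₀ ht₀).trans hα0⟩

/-- Near `z₀` all solutions live for a common time `ε`. Start one from the state of `γ` at a time
less than `ε` before `B`: it passes beyond `B` and coincides with `γ` on the overlap by uniqueness.
-/
theorem exists_extension_of_frequently [T2Space M] {A B : ℝ} (hAB : A < B)
    (hγ : IsGeodesicOn I G γ (Ioo A B)) (hU : MapsTo γ (Ioo A B) U) {z₀ : E × (E →L[ℝ] ℝ)}
    (hz₀ : z₀.1 ∈ chartDomain I x₀ U)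
    (hfreq : ∀ N ∈ 𝓝 z₀, ∃ᶠ t in 𝓝[<] B,
      γ t ∈ (extChartAt I x₀).source ∧ chartState I G x₀ γ t ∈ N) :
    ∃ B' > B, ∃ β, IsGeodesicOn I G β (Ioo A B') ∧ MapsTo β (Ioo A B') U ∧
      EqOn β γ (Ioo A B) := by
  obtain ⟨N, hN, ε, hε, h⟩ := hG.exists_geodesic_near hz₀
  have hev : ∀ᶠ t in 𝓝[<] B, t ∈ Ioo (max A (B - ε)) B :=
    Ioo_mem_nhdsLT (max_lt hAB (by linarith))
  obtain ⟨t₁, ⟨hsrc, hst⟩, ht₁⟩ := ((hfreq N hN).and_eventually hev).exists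
  have ht₁A : A < t₁ := (le_max_left _ _).trans_lt ht₁.1
  have ht₁ε : B - ε < t₁ := (le_max_right _ _).trans_lt ht₁.1
  obtain ⟨α, hα, hαU, hαx, hαs⟩ := h _ hst t₁
  have hsub1 : Ioo (max A (t₁ - ε)) B ⊆ Ioo A B := Ioo_subset_Ioo_left (le_max_left _ _)
  have hsub2 : Ioo (max A (t₁ - ε)) B ⊆ Ioo (t₁ - ε) (t₁ + ε) :=
    Ioo_subset_Ioo (le_max_right _ _) (by linarith)
  have heq : EqOn α γ (Ioo (max A (t₁ - ε)) B) :=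
    hG.eqOn_of_chartState_eq isOpen_Ioo isPreconnected_Ioo (hα.mono hsub2) (hγ.mono hsub1)
      (hαU.mono_left hsub2) (hU.mono_left hsub1) ⟨max_lt ht₁A (by linarith), ht₁.2⟩ hαx hsrc hαs
  have hβ : ∀ t, t ∈ Ioo (max A (t₁ - ε)) (t₁ + ε) → (if t < B then γ t else α t) = α t := by
    intro t ht
    split_ifs with hlt
    · exact (heq ⟨ht.1, hlt⟩).symm
    · rfl
  refine ⟨t₁ + ε, by linarith, fun t => if t < B then γ t else α t,
    isGeodesicOn_of_locally fun t ht => ?_, fun t ht => ?_, fun t ht => if_pos ht.2⟩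
  · by_cases htB : t < B
    · refine ⟨γ, Ioo A B, isOpen_Ioo, ⟨ht.1, htB⟩, hγ, ?_⟩
      filter_upwards [Iio_mem_nhds htB] with s hs using if_pos hs
    · have htm : t ∈ Ioo (max A (t₁ - ε)) (t₁ + ε) :=
        ⟨max_lt ht.1 (by linarith [ht₁.2]), ht.2⟩
      refine ⟨α, Ioo (t₁ - ε) (t₁ + ε), isOpen_Ioo, ⟨(le_max_right _ _).trans_lt htm.1, ht.2⟩, hα, ?_⟩
      filter_upwards [isOpen_Ioo.mem_nhds htm] with s hs using hβ s hs
  · by_cases htB : t < B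
    · simp only [if_pos htB]; exact hU ⟨ht.1, htB⟩
    · simp only [if_neg htB]; exact hαU ⟨by linarith [ht₁.2], ht.2⟩

/-- A geodesic of bounded speed that stays in a compact set can be extended. -/
theorem exists_extension_of_isCompact [T2Space M] {A B : ℝ} (hAB : A < B)
    (hγ : IsGeodesicOn I G γ (Ioo A B)) (hU : MapsTo γ (Ioo A B) U) {K : Set M} (hK : IsCompact K)
    (hKU : K ⊆ U) (hγK : ∀ᶠ t in 𝓝[<] B, γ t ∈ K) {C : ℝ}
    (hC : ∀ t ∈ Ioo A B, G (γ t) (velocity I γ t) (velocity I γ t) ≤ C) :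
    ∃ B' > B, ∃ β, IsGeodesicOn I G β (Ioo A B') ∧ MapsTo β (Ioo A B') U ∧
      EqOn β γ (Ioo A B) := by
  have : ProperSpace E := FiniteDimensional.proper ℝ E
  have : ProperSpace (E →L[ℝ] ℝ) :=
    have : FiniteDimensional ℝ (E →L[ℝ] ℝ) :=
      (LinearMap.toContinuousLinearMap (𝕜 := ℝ) (E := E) (F' := ℝ)).finiteDimensional
    FiniteDimensional.proper ℝ _
  obtain ⟨x, hxK, hx⟩ := hK.exists_mapClusterPt (f := 𝓝[<] B) (u := γ) (by
    rw [le_principal_iff, mem_map]; exact hγK)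
  have hu₀ : extChartAt I x x ∈ chartDomain I x U := by
    refine ⟨mem_extChartAt_target x, ?_⟩
    simpa using hKU hxK
  obtain ⟨ρ, hρ, hball⟩ := Metric.nhds_basis_closedBall.mem_iff.1
    ((isOpen_chartDomain x hG.isOpen).mem_nhds hu₀)
  have hcompact := isCompact_closedBall (extChartAt I x x) ρ
  have hcont : ContinuousOn (coordForm I G x) (Metric.closedBall (extChartAt I x x) ρ) :=
    (hG.contDiffOn x).continuousOn.mono hball
  obtain ⟨m, hm, hmle⟩ := exists_pos_mul_sq_le_of_isCompact hcompact hcont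
    fun u hu => hG.coordForm_pos (hball hu)
  obtain ⟨L, hL⟩ := hcompact.exists_bound_of_continuousOn hcont
  -- The point `x` is only a cluster point of `γ` at `B`, so `γ` need not remain in the chart;
  -- everything below takes place at the times when it is in a closed ball there.
  set S : Set ℝ := {t | γ t ∈ (extChartAt I x).source ∧
    chartCurve I x γ t ∈ Metric.closedBall (extChartAt I x x) ρ} with hS
  have hfr : ∃ᶠ t in 𝓝[<] B, t ∈ S := by
    have hmem : {y | y ∈ (extChartAt I x).source ∧
        extChartAt I x y ∈ Metric.closedBall (extChartAt I x x) ρ} ∈ 𝓝 x :=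
      inter_mem ((isOpen_extChartAt_source x).mem_nhds (mem_extChartAt_source x))
        ((continuousAt_extChartAt x).preimage_mem_nhds (Metric.closedBall_mem_nhds _ hρ))
    exact mapClusterPt_iff_frequently.1 hx _ hmem
  have hne : (𝓝[<] B ⊓ 𝓟 S).NeBot := frequently_mem_iff_neBot.1 hfr
  have hAB' : ∀ᶠ t in 𝓝[<] B, t ∈ Ioo A B := Ioo_mem_nhdsLT hAB
  have hbound : ∀ᶠ t in 𝓝[<] B ⊓ 𝓟 S, chartState I G x γ t ∈
      Metric.closedBall (extChartAt I x x) ρ ×ˢ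
        Metric.closedBall (0 : E →L[ℝ] ℝ) (L * (C / m + 1)) := by
    filter_upwards [mem_inf_of_left hAB', mem_inf_of_right (mem_principal_self S)] with t h1 h2
    refine ⟨h2.2, ?_⟩
    rw [mem_closedBall_zero_iff]
    have hd : MDifferentiableAt 𝓘(ℝ, ℝ) I γ t :=
      (hγ.1.contMDiffAt (isOpen_Ioo.mem_nhds h1)).mdifferentiableAt (by simp)
    have h3 := hmle _ h2.2 (deriv (chartCurve I x γ) t)
    rw [coordForm_deriv_chartCurve hd h2.1] at h3
    have h4 : ‖deriv (chartCurve I x γ) t‖ ^ 2 ≤ C / m := by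
      rw [le_div_iff₀ hm]; linarith [hC t h1]
    have h5 : ‖deriv (chartCurve I x γ) t‖ ≤ C / m + 1 := by
      nlinarith [sq_nonneg (‖deriv (chartCurve I x γ) t‖ - 1), norm_nonneg (deriv (chartCurve I x γ) t)]
    have hL0 : 0 ≤ L := (norm_nonneg _).trans (hL _ h2.2)
    calc ‖momentum I G x γ t‖ ≤ ‖coordForm I G x (chartCurve I x γ t)‖ * _ :=
          ContinuousLinearMap.le_opNorm _ _
      _ ≤ L * (C / m + 1) := mul_le_mul (hL _ h2.2) h5 (norm_nonneg _) hL0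
  -- At these times the speed bound confines the momentum as well to a compact set, so position and
  -- momentum have a common cluster point.
  obtain ⟨z₀, hz₀, hz₀c⟩ := (hcompact.prod (isCompact_closedBall _ _)).exists_mapClusterPt
    (f := 𝓝[<] B ⊓ 𝓟 S) (u := chartState I G x γ) (by
      rw [le_principal_iff, mem_map]; exact hbound)
  refine hG.exists_extension_of_frequently hAB hγ hU (hball hz₀.1) fun N hN => ?_
  have h1 := (mapClusterPt_iff_frequently.1 hz₀c N hN).and_eventually
    (mem_inf_of_right (mem_principal_self S) : ∀ᶠ t in 𝓝[<] B ⊓ 𝓟 S, t ∈ S)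
  exact (h1.filter_mono inf_le_left).mono fun t ht => ⟨ht.2.1, ht.1⟩

/-- Conservation of energy. -/
theorem hasDerivAt_energy (hJ : IsOpen J) (hγ : IsGeodesicOn I G γ J) (hU : MapsTo γ J U)
    (ht : t ∈ J) :
    HasDerivAt (fun s => G (γ s) (velocity I γ s) (velocity I γ s)) 0 t := by
  have h2 := hγ.1.contMDiffAt (hJ.mem_nhds ht)
  have hx : γ t ∈ (extChartAt I (γ t)).source := mem_extChartAt_source _
  have hxc := contDiffAt_chartCurve two_le_infty h2 hx
  set x := chartCurve I (γ t) γ with hxdef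
  have hx1 : HasDerivAt x (deriv x t) t := (hxc.differentiableAt (by simp)).hasDerivAt
  have hx2 : HasDerivAt (deriv x) (deriv (deriv x) t) t := by
    have h4 : ContDiffAt ℝ 1 (fderiv ℝ x) t := hxc.fderiv_right (m := 1) (by norm_num)
    have : DifferentiableAt ℝ (fun s => fderiv ℝ x s 1) t :=
      (h4.differentiableAt (by simp)).clm_apply (differentiableAt_const _)
    simp only [fderiv_apply_one_eq_deriv] at this
    exact this.hasDerivAt
  have hp := (hG.satisfiesEulerLagrange_iff hx (hU ht)).1 (hγ.2 _ t ht hx)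
  have ha := (hG.differentiableAt (mem_chartDomain hx (hU ht))).hasFDerivAt.comp_hasDerivAt t hx1
  have hA := hp.clm_apply hx2
  have hB := (ha.clm_apply hx2).clm_apply hx2
  -- With `a` the metric and `x` the curve in coordinates, the derivative of the energy is ½
  -- Da(x')(x', x') + a(x', x'') by the geodesic equation and Da(x')(x', x') + 2 a(x', x'') by the
  -- product rule. The second is twice the first, so both vanish.
  have huniq := hA.unique hB
  have hsymm := hG.coordForm_symm (mem_chartDomain hx (hU ht)) (deriv (deriv x) t) (deriv x t)
  have hev : (fun s => G (γ s) (velocity I γ s) (velocity I γ s)) =ᶠ[𝓝 t]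
      fun s => momentum I G (γ t) γ s (deriv x s) := by
    filter_upwards [hJ.mem_nhds ht, eventually_mem_source h2.continuousAt hx] with s hs hs'
    exact (coordForm_deriv_chartCurve
      ((hγ.1.contMDiffAt (hJ.mem_nhds hs)).mdifferentiableAt (by simp)) hs').symm
  refine (hA.congr_of_eventuallyEq hev).congr_deriv ?_
  simp only [_root_.smul_apply, sqCovector_apply, momentum, smul_eq_mul,
    _root_.add_apply, Function.comp_apply, ← hxdef] at huniq ⊢
  rw [hsymm] at huniq
  linarith

theorem energy_eq (hJ : IsOpen J) (hJc : IsPreconnected J) (hγ : IsGeodesicOn I G γ J)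
    (hU : MapsTo γ J U) {s : ℝ} (hs : s ∈ J) (ht : t ∈ J) :
    G (γ s) (velocity I γ s) (velocity I γ s) = G (γ t) (velocity I γ t) (velocity I γ t) :=
  hJ.is_const_of_deriv_eq_zero hJc
    (f := fun s => G (γ s) (velocity I γ s) (velocity I γ s))
    (fun _ hs => (hG.hasDerivAt_energy hJ hγ hU hs).differentiableAt.differentiableWithinAt)
    (fun _ hs => (hG.hasDerivAt_energy hJ hγ hU hs).deriv) hs ht

end RegularMetricOn

end GlobalGeodesics

end WarpedGeodesics

namespace WarpedGeodesics

/-! ### Geodesic completeness of compact manifolds. -/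

section Complete

variable {E : Type*} [NormedAddCommGroup E] [NormedSpace ℝ E]
  {H : Type*} [TopologicalSpace H] {I : ModelWithCorners ℝ E H}
  {M : Type*} [TopologicalSpace M] [ChartedSpace H M]
  {G : (x : M) → TangentSpace I x →L[ℝ] TangentSpace I x →L[ℝ] ℝ}
  {x₀ : M}

theorem tangentBundle_mk_eq {x y : M} (h : x = y) {v w : E} (hv : v = w) :
    (⟨x, v⟩ : TangentBundle I M) = ⟨y, w⟩ := by subst h; subst hv; rfl

variable [I.Boundaryless] [IsManifold I ∞ M] [FiniteDimensional ℝ E] [T2Space M]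

/-- Geodesics with the same initial state on symmetric intervals agree on the smaller interval, so
any choice of one of them at each time gives a geodesic on the union. -/
theorem RegularMetricOn.exists_geodesic_of_covering (hG : RegularMetricOn I G univ)
    {z : E × (E →L[ℝ] ℝ)} {L : Set ℝ} (hL : ∀ T ∈ L, 0 < T) (hLne : L.Nonempty)
    (h : ∀ T ∈ L, ∃ γ, IsGeodesicOn I G γ (Ioo (-T) T) ∧ γ 0 ∈ (extChartAt I x₀).source ∧
      chartState I G x₀ γ 0 = z) :
    ∃ γ, IsGeodesicOn I G γ {t | ∃ T ∈ L, t ∈ Ioo (-T) T} ∧ γ 0 ∈ (extChartAt I x₀).source ∧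
      chartState I G x₀ γ 0 = z := by
  classical
  have : Nonempty M := ⟨x₀⟩
  choose! g hg hgs hgz using h
  obtain ⟨T₀, hT₀⟩ := hLne
  let c : ℝ → ℝ := fun t => if ht : ∃ T ∈ L, t ∈ Ioo (-T) T then ht.choose else T₀
  have hc : ∀ t, ∀ T ∈ L, t ∈ Ioo (-T) T → c t ∈ L ∧ t ∈ Ioo (-(c t)) (c t) := by
    intro t T hT ht
    have hex : ∃ T ∈ L, t ∈ Ioo (-T) T := ⟨T, hT, ht⟩
    simp only [c, dif_pos hex]
    exact hex.choose_spec
  have heq : ∀ T ∈ L, EqOn (fun t => g (c t) t) (g T) (Ioo (-T) T) := by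
    intro T hT t ht
    obtain ⟨h1, h2⟩ := hc t T hT ht
    have hsub1 : Ioo (-(min T (c t))) (min T (c t)) ⊆ Ioo (-T) T :=
      Ioo_subset_Ioo (neg_le_neg (min_le_left _ _)) (min_le_left _ _)
    have hsub2 : Ioo (-(min T (c t))) (min T (c t)) ⊆ Ioo (-(c t)) (c t) :=
      Ioo_subset_Ioo (neg_le_neg (min_le_right _ _)) (min_le_right _ _)
    have hpos : 0 < min T (c t) := lt_min (hL T hT) (hL _ h1)
    refine hG.eqOn_of_chartState_eq (x₀ := x₀) (t := 0) isOpen_Ioo isPreconnected_Ioo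
      ((hg _ h1).mono hsub2) ((hg T hT).mono hsub1) (mapsTo_univ _ _) (mapsTo_univ _ _)
      ⟨by linarith, hpos⟩ (hgs _ h1) (hgs T hT) ((hgz _ h1).trans (hgz T hT).symm) ?_
    rcases min_choice T (c t) with h | h <;> rw [h]
    exacts [ht, h2]
  have hev : ∀ T ∈ L, ∀ t ∈ Ioo (-T) T, (fun t => g (c t) t) =ᶠ[𝓝 t] g T := by
    intro T hT t ht
    filter_upwards [isOpen_Ioo.mem_nhds ht] with s hs using heq T hT hs
  have h0 : (0 : ℝ) ∈ Ioo (-T₀) T₀ := ⟨by linarith [hL T₀ hT₀], hL T₀ hT₀⟩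
  refine ⟨fun t => g (c t) t, isGeodesicOn_of_locally ?_, ?_, ?_⟩
  · rintro t ⟨T, hT, ht⟩
    exact ⟨g T, _, isOpen_Ioo, ht, hg T hT, hev T hT t ht⟩
  · have h1 := (hev T₀ hT₀ 0 h0).eq_of_nhds
    dsimp only at h1 ⊢
    rw [h1]; exact hgs T₀ hT₀
  · rw [← hgz T₀ hT₀]
    have h1 : chartCurve I x₀ (fun t => g (c t) t) =ᶠ[𝓝 0] chartCurve I x₀ (g T₀) :=
      (hev T₀ hT₀ 0 h0).mono fun s hs => congrArg (extChartAt I _) hs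
    simp only [chartState, momentum, h1.deriv_eq, h1.eq_of_nhds]

/-- Extend to the right, reverse time, extend to the right again and reverse back. Conservation of
energy and compactness of `M` supply the hypotheses of the extension theorem. -/
theorem RegularMetricOn.exists_extension_symm [CompactSpace M] (hG : RegularMetricOn I G univ)
    {T : ℝ} (hT : 0 < T) {γ : ℝ → M} (hγ : IsGeodesicOn I G γ (Ioo (-T) T)) :
    ∃ T' > T, ∃ β, IsGeodesicOn I G β (Ioo (-T') T') ∧ β =ᶠ[𝓝 0] γ := by
  have hext : ∀ (A B : ℝ) (γ : ℝ → M), A < B → IsGeodesicOn I G γ (Ioo A B) →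
      ∃ B' > B, ∃ β, IsGeodesicOn I G β (Ioo A B') ∧ EqOn β γ (Ioo A B) := by
    intro A B γ hAB hγ
    obtain ⟨s, hs⟩ : (Ioo A B).Nonempty := nonempty_Ioo.2 hAB
    obtain ⟨B', hB', β, h1, -, h3⟩ := hG.exists_extension_of_isCompact hAB hγ (mapsTo_univ _ _)
      isCompact_univ (subset_univ _) (Eventually.of_forall fun _ => mem_univ _)
      (C := G (γ s) (velocity I γ s) (velocity I γ s))
      fun t ht => (hG.energy_eq isOpen_Ioo isPreconnected_Ioo hγ (mapsTo_univ _ _) ht hs).le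
    exact ⟨B', hB', β, h1, h3⟩
  obtain ⟨B₁, hB₁, β₁, h₁, heq₁⟩ := hext _ _ γ (by linarith) hγ
  have h1 := h₁.comp_neg
  have hset : (Neg.neg ⁻¹' Ioo (-T) B₁ : Set ℝ) = Ioo (-B₁) T := by
    ext t; simp only [mem_preimage, mem_Ioo]; constructor <;> rintro ⟨h, h'⟩ <;>
      constructor <;> linarith
  rw [hset] at h1
  obtain ⟨B₂, hB₂, β₂, h₂, heq₂⟩ := hext _ _ _ (by linarith) h1
  have h2 := h₂.comp_neg
  refine ⟨min B₁ B₂, lt_min hB₁ hB₂, fun t => β₂ (-t), h2.mono ?_, ?_⟩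
  · intro t ht
    have h3 := min_le_left B₁ B₂
    have h4 := min_le_right B₁ B₂
    exact ⟨by linarith [ht.2], by linarith [ht.1]⟩
  · filter_upwards [Ioo_mem_nhds (by linarith : -T < 0) hT] with t ht
    have h3 := heq₂ (x := -t) ⟨by linarith [ht.2], by linarith [ht.1]⟩
    simp only [neg_neg] at h3
    rw [h3]
    exact heq₁ ht

/-- Geodesic completeness of compact Riemannian manifolds. -/
theorem RegularMetricOn.exists_geodesic_univ [CompactSpace M] (hG : RegularMetricOn I G univ)
    (p : TangentBundle I M) :
    ∃ γ, IsGeodesicOn I G γ univ ∧ (⟨γ 0, velocity I γ 0⟩ : TangentBundle I M) = p := by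
  have : IsManifold I 1 M := IsManifold.of_le (n := ∞) (by simp)
  obtain ⟨x₀, v⟩ := p
  set u := extChartAt I x₀ x₀ with hu
  have hut : u ∈ (extChartAt I x₀).target := mem_extChartAt_target x₀
  have hdom : u ∈ chartDomain I x₀ univ := ⟨hut, mem_univ _⟩
  obtain ⟨w, hw⟩ : ∃ w, chartDeriv I x₀ u w = v := by
    have h := isInvertible_mfderivWithin_extChartAt_symm (I := I) hut
    rw [I.range_eq_univ, mfderivWithin_univ] at h
    exact h.bijective.surjective v
  set z : E × (E →L[ℝ] ℝ) := (u, coordForm I G x₀ u w) with hz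
  let Q : ℝ → Prop := fun T => ∃ γ, IsGeodesicOn I G γ (Ioo (-T) T) ∧
    γ 0 ∈ (extChartAt I x₀).source ∧ chartState I G x₀ γ 0 = z
  have hQne : ∃ T > 0, Q T := by
    obtain ⟨N, hN, ε, hε, h⟩ := hG.exists_geodesic_near (x₀ := x₀) (z₀ := z) hdom
    obtain ⟨β, h1, -, h2, h3⟩ := h z (mem_of_mem_nhds hN) 0
    exact ⟨ε, hε, β, by simpa using h1, h2, h3⟩
  have hQext : ∀ T > 0, Q T → ∃ T' > T, Q T' := by
    rintro T hT ⟨γ, h1, h2, h3⟩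
    obtain ⟨T', hT', β, h4, h5⟩ := hG.exists_extension_symm hT h1
    have h6 : chartCurve I x₀ β =ᶠ[𝓝 0] chartCurve I x₀ γ :=
      h5.mono fun s hs => congrArg (extChartAt I _) hs
    refine ⟨T', hT', β, h4, by rw [h5.eq_of_nhds]; exact h2, ?_⟩
    rw [← h3]
    simp only [chartState, momentum, h6.deriv_eq, h6.eq_of_nhds]
  obtain ⟨γ, hγ, hγs, hγz⟩ := hG.exists_geodesic_of_covering (x₀ := x₀) (z := z)
    (L := {T | 0 < T ∧ Q T}) (fun T hT => hT.1) hQne fun T hT => hT.2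
  -- If the lifetimes had a finite supremum, the glued geodesic would exist up to the supremum, and
  -- could then be extended beyond it.
  have hunb : ¬ BddAbove {T | 0 < T ∧ Q T} := by
    intro hb
    obtain ⟨T₀, hT₀⟩ := hQne
    have hpos : 0 < sSup {T | 0 < T ∧ Q T} := hT₀.1.trans_le (le_csSup hb hT₀)
    have hQ : Q (sSup {T | 0 < T ∧ Q T}) := by
      refine ⟨γ, hγ.mono fun t ht => ?_, hγs, hγz⟩
      have hlt : |t| < sSup {T | 0 < T ∧ Q T} := abs_lt.2 ht
      obtain ⟨T, hT, hlt'⟩ := exists_lt_of_lt_csSup ⟨T₀, hT₀⟩ hlt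
      exact ⟨T, hT, abs_lt.1 hlt'⟩
    obtain ⟨T', hT', hQ'⟩ := hQext _ hpos hQ
    exact absurd (le_csSup hb ⟨hpos.trans hT', hQ'⟩) (not_le.2 hT')
  have huniv : {t | ∃ T ∈ {T | 0 < T ∧ Q T}, t ∈ Ioo (-T) T} = univ := by
    refine eq_univ_of_forall fun t => ?_
    obtain ⟨T, hT, hlt⟩ := not_bddAbove_iff.1 hunb |t|
    exact ⟨T, hT, abs_lt.1 hlt⟩
  rw [huniv] at hγ
  refine ⟨γ, hγ, ?_⟩
  have hcurve : chartCurve I x₀ γ 0 = u := congrArg Prod.fst hγz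
  have h0 : γ 0 = x₀ := (extChartAt I x₀).injOn hγs (mem_extChartAt_source x₀) hcurve
  have hmom : coordForm I G x₀ u (deriv (chartCurve I x₀ γ) 0) = coordForm I G x₀ u w := by
    have := congrArg Prod.snd hγz
    simp only [chartState, momentum, hcurve] at this
    exact this
  have hder : deriv (chartCurve I x₀ γ) 0 = w := by
    have hp := hG.coordForm_pos hdom
    rw [← inverse_apply_of_pos hp w, ← hmom, inverse_apply_of_pos hp]
  have hvel := chartDeriv_deriv_chartCurve (x₀ := x₀) (t := 0)
    ((hγ.1.contMDiffAt univ_mem).mdifferentiableAt (by simp)) hγs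
  rw [hder, hcurve, hw] at hvel
  exact tangentBundle_mk_eq h0 hvel.symm

end Complete

/-! ### Regularity and coordinates of the warped product metric. -/

section Warped

variable {m : ℕ} {Y : Type*} [TopologicalSpace Y] [ChartedSpace (EuclideanSpace ℝ (Fin m)) Y]
  [IsManifold (𝓡 m) ∞ Y]

theorem regularMetricOn_riemMetric (k : RiemMetric m Y) :
    RegularMetricOn (𝓡 m) k.inner univ where
  isOpen := isOpen_univ
  contDiffOn x₀ := by
    have h := contDiffOn_pullForm (I := 𝓡 m) (n := 2) two_le_infty x₀ (u := id)
      (s := chartDomain (𝓡 m) x₀ univ) contDiffOn_id (fun u hu => hu.1)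
      (fun u => k.inner ((extChartAt (𝓡 m) x₀).symm u)) ?_
    · exact h
    · have : IsManifold (𝓡 m) 2 Y := IsManifold.of_le (n := ∞) two_le_infty
      exact (k.contMDiff.of_le two_le_infty).comp_contMDiffOn
        ((contMDiffOn_extChartAt_symm x₀).mono fun u hu => hu.1)
  symm x _ v w := k.symm x v w
  pos x _ v hv := k.pos x v hv

variable {R : ℝ} {f : ℝ → ℝ} {h : ℝ → RiemMetric m Y}

theorem formAt_warpedMetric (p : ℝ × Y) (v w : ℝ × EuclideanSpace ℝ (Fin m)) :
    formAt (𝓘(ℝ, ℝ).prod (𝓡 m)) (warpedMetric f h) p v w =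
      v.1 * w.1 + f p.1 ^ 2 * formAt (𝓡 m) (h p.1).inner p.2 v.2 w.2 := rfl

theorem regularMetricOn_warpedMetric (hf : IsWarpingFunction R f)
    (hg : IsGeneralizedWarpedProduct R f h) :
    RegularMetricOn (𝓘(ℝ, ℝ).prod (𝓡 m)) (warpedMetric f h) (Ioo 0 R ×ˢ univ) where
  isOpen := isOpen_Ioo.prod isOpen_univ
  contDiffOn x₀ := by
    have h := contDiffOn_pullForm (I := 𝓘(ℝ, ℝ).prod (𝓡 m)) (n := 2) two_le_infty x₀ (u := id)
      (s := chartDomain (𝓘(ℝ, ℝ).prod (𝓡 m)) x₀ (Ioo 0 R ×ˢ univ)) contDiffOn_id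
      (fun u hu => hu.1)
      (fun u => warpedMetric f h ((extChartAt (𝓘(ℝ, ℝ).prod (𝓡 m)) x₀).symm u)) ?_
    · exact h
    · have : IsManifold (𝓘(ℝ, ℝ).prod (𝓡 m)) 2 (ℝ × Y) := IsManifold.of_le (n := ∞) two_le_infty
      exact (hg.smooth_metric.of_le two_le_infty).comp
        ((contMDiffOn_extChartAt_symm x₀).mono fun u hu => hu.1) (fun u hu => hu.2)
  symm x _ v w := by
    rw [formAt_warpedMetric, formAt_warpedMetric, mul_comm v.1]
    congr 2
    exact (h x.1).symm x.2 v.2 w.2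
  pos x hx v hv := by
    rw [formAt_warpedMetric]
    have hfx := hf.pos x.1 hx.1
    rcases eq_or_ne v.2 0 with h2 | h2
    · have h1 : v.1 ≠ 0 := fun h1 => hv (Prod.ext h1 h2)
      rw [h2]
      simp only [map_zero, mul_zero, add_zero]
      exact mul_self_pos.2 h1
    · have := (h x.1).pos x.2 v.2 h2
      have h3 : 0 < f x.1 ^ 2 * formAt (𝓡 m) (h x.1).inner x.2 v.2 v.2 := mul_pos (by positivity) this
      nlinarith [mul_self_nonneg v.1]

/-- The coordinate expression of the family `h`, as a function of `r` and the coordinates. -/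
def famForm (h : ℝ → RiemMetric m Y) (y₀ : Y) (q : ℝ × EuclideanSpace ℝ (Fin m)) :
    EuclideanSpace ℝ (Fin m) →L[ℝ] EuclideanSpace ℝ (Fin m) →L[ℝ] ℝ :=
  coordForm (𝓡 m) (h q.1).inner y₀ q.2

theorem contDiffOn_famForm (hg : IsGeneralizedWarpedProduct R f h) (y₀ : Y) :
    ContDiffOn ℝ 1 (famForm h y₀) (Ico 0 R ×ˢ (extChartAt (𝓡 m) y₀).target) := by
  have : IsManifold (𝓡 m) 1 Y := IsManifold.of_le (n := ∞) (by simp)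
  have hbase : ContMDiffOn 𝓘(ℝ, ℝ × EuclideanSpace ℝ (Fin m)) (𝓘(ℝ, ℝ).prod (𝓡 m)) 1
      (fun q : ℝ × EuclideanSpace ℝ (Fin m) => (q.1, (extChartAt (𝓡 m) y₀).symm q.2))
      (Ico 0 R ×ˢ (extChartAt (𝓡 m) y₀).target) :=
    contDiff_fst.contMDiff.contMDiffOn.prodMk
      ((contMDiffOn_extChartAt_symm y₀).comp contDiff_snd.contMDiff.contMDiffOn fun q hq => hq.2)
  exact contDiffOn_pullForm (I := 𝓡 m) (n := 1) (by simp) y₀ (u := Prod.snd)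
    contDiff_snd.contDiffOn (fun q hq => hq.2)
    (fun q => (h q.1).inner ((extChartAt (𝓡 m) y₀).symm q.2))
    (hg.family_C1.comp hbase fun q hq => ⟨hq.1, mem_univ _⟩)

theorem famForm_pos (h : ℝ → RiemMetric m Y) {y₀ : Y} {q : ℝ × EuclideanSpace ℝ (Fin m)}
    (hq : q.2 ∈ (extChartAt (𝓡 m) y₀).target) : ∀ v, v ≠ 0 → 0 < famForm h y₀ q v v :=
  (regularMetricOn_riemMetric (h q.1)).coordForm_pos ⟨hq, mem_univ _⟩

theorem coordForm_warpedMetric (p₀ : ℝ × Y) {q : ℝ × EuclideanSpace ℝ (Fin m)}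
    (hq : q.2 ∈ (extChartAt (𝓡 m) p₀.2).target) (v w : ℝ × EuclideanSpace ℝ (Fin m)) :
    coordForm (𝓘(ℝ, ℝ).prod (𝓡 m)) (warpedMetric f h) p₀ q v w =
      v.1 * w.1 + f q.1 ^ 2 * famForm h p₀.2 q v.2 w.2 := by
  have hsymm : ((extChartAt (𝓘(ℝ, ℝ).prod (𝓡 m)) p₀).symm : ℝ × EuclideanSpace ℝ (Fin m) → ℝ × Y) =
      Prod.map id (extChartAt (𝓡 m) p₀.2).symm := by
    rw [extChartAt_prod]
    ext u <;> simp [chartAt_self_eq]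
  have hD : ∀ v : ℝ × EuclideanSpace ℝ (Fin m), chartDeriv (𝓘(ℝ, ℝ).prod (𝓡 m)) p₀ q v =
      (v.1, chartDeriv (𝓡 m) p₀.2 q.2 v.2) := by
    have h0 : HasMFDerivAt 𝓘(ℝ, ℝ × EuclideanSpace ℝ (Fin m)) (𝓡 m) (Prod.snd) q
      (ContinuousLinearMap.snd ℝ ℝ (EuclideanSpace ℝ (Fin m))) := hasFDerivAt_snd.hasMFDerivAt
    have h0' : HasMFDerivAt 𝓘(ℝ, ℝ × EuclideanSpace ℝ (Fin m)) 𝓘(ℝ, ℝ) (Prod.fst) q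
      (ContinuousLinearMap.fst ℝ ℝ (EuclideanSpace ℝ (Fin m))) := hasFDerivAt_fst.hasMFDerivAt
    have h1 := h0'.prodMk ((hasMFDerivAt_extChartAt_symm (I := 𝓡 m) hq).comp q h0)
    have h2 := hasMFDerivAt_extChartAt_symm (I := 𝓘(ℝ, ℝ).prod (𝓡 m)) (x₀ := p₀) (u := q) (by
      rw [extChartAt_prod]; exact ⟨by simp [chartAt_self_eq], hq⟩)
    have h3 : (extChartAt (𝓘(ℝ, ℝ).prod (𝓡 m)) p₀).symm =ᶠ[𝓝 q]
        fun u => (u.1, ((extChartAt (𝓡 m) p₀.2).symm ∘ Prod.snd) u) := by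
      rw [hsymm]; exact Eventually.of_forall fun _ => rfl
    have h4 := hasMFDerivAt_unique h2 (h1.congr_of_eventuallyEq h3)
    intro v
    unfold chartDeriv
    rw [h4]
    rfl
  rw [coordForm_apply, hD, hD, formAt_warpedMetric, hsymm]
  rfl

end Warped

end WarpedGeodesics

namespace WarpedGeodesics

/-! ### The radial and angular geodesic equations. -/

section WarpedEquations

variable {m : ℕ} {Y : Type*} [TopologicalSpace Y] [ChartedSpace (EuclideanSpace ℝ (Fin m)) Y]
  [IsManifold (𝓡 m) ∞ Y] {R c : ℝ} {f : ℝ → ℝ} {h : ℝ → RiemMetric m Y}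
  {γ : ℝ → ℝ × Y} {J : Set ℝ} {t : ℝ} {y₀ : Y}

theorem IsWarpingFunction.differentiableAt (hf : IsWarpingFunction R f) {r : ℝ}
    (hr : r ∈ Ioo 0 R) : DifferentiableAt ℝ f r :=
  (hf.contDiffOn.contDiffAt (Ico_mem_nhds hr.1 hr.2)).differentiableAt (by simp)

theorem differentiableAt_famForm (hg : IsGeneralizedWarpedProduct R f h)
    {q : ℝ × EuclideanSpace ℝ (Fin m)} (hq : q ∈ Ioo 0 R ×ˢ (extChartAt (𝓡 m) y₀).target) :
    DifferentiableAt ℝ (famForm h y₀) q := by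
  refine ((contDiffOn_famForm hg y₀).contDiffAt ?_).differentiableAt (by simp)
  exact mem_of_superset ((isOpen_Ioo.prod (isOpen_extChartAt_target y₀)).mem_nhds hq)
    (prod_mono Ioo_subset_Ico_self subset_rfl)

/-- The coordinates of the angular component of a curve. -/
def angCurve (m : ℕ) {Y : Type*} [TopologicalSpace Y]
    [ChartedSpace (EuclideanSpace ℝ (Fin m)) Y] (y₀ : Y) (γ : ℝ → ℝ × Y) : ℝ → EuclideanSpace ℝ (Fin m) :=
  chartCurve (𝓡 m) y₀ fun s => (γ s).2

theorem chartCurve_prod (p₀ : ℝ × Y) (s : ℝ) :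
    chartCurve (𝓘(ℝ, ℝ).prod (𝓡 m)) p₀ γ s = ((γ s).1, angCurve m p₀.2 γ s) := by
  simp only [chartCurve, angCurve, extChartAt_prod]
  refine Prod.ext ?_ rfl
  simp [chartAt_self_eq]

theorem contMDiffOn_angular
    (hγ : ContMDiffOn 𝓘(ℝ, ℝ) (𝓘(ℝ, ℝ).prod (𝓡 m)) 2 γ J) :
    ContMDiffOn 𝓘(ℝ, ℝ) (𝓡 m) 2 (fun s => (γ s).2) J :=
  contMDiff_snd.comp_contMDiffOn hγ

theorem contDiffOn_radial
    (hγ : ContMDiffOn 𝓘(ℝ, ℝ) (𝓘(ℝ, ℝ).prod (𝓡 m)) 2 γ J) :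
    ContDiffOn ℝ 2 (fun s => (γ s).1) J :=
  (contMDiff_fst.comp_contMDiffOn hγ).contDiffOn

section Geodesic

variable (hf : IsWarpingFunction R f) (hg : IsGeneralizedWarpedProduct R f h) (hJ : IsOpen J)
  (hγ : IsGeodesicOn (𝓘(ℝ, ℝ).prod (𝓡 m)) (warpedMetric f h) γ J)
  (hU : MapsTo γ J (Ioo 0 R ×ˢ univ))
include hJ hγ

theorem hasDerivAt_radial (ht : t ∈ J) :
    HasDerivAt (fun s => (γ s).1) (deriv (fun s => (γ s).1) t) t :=
  (((contDiffOn_radial hγ.1).contDiffAt (hJ.mem_nhds ht)).differentiableAt (by simp)).hasDerivAt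

theorem hasDerivAt_angCurve (ht : t ∈ J) (hy : (γ t).2 ∈ (extChartAt (𝓡 m) y₀).source) :
    HasDerivAt (angCurve m y₀ γ) (deriv (angCurve m y₀ γ) t) t :=
  ((contDiffAt_chartCurve two_le_infty ((contMDiffOn_angular hγ.1).contMDiffAt (hJ.mem_nhds ht))
    hy).differentiableAt (by simp)).hasDerivAt

theorem mdifferentiableAt_angular (ht : t ∈ J) :
    MDifferentiableAt 𝓘(ℝ, ℝ) (𝓡 m) (fun s => (γ s).2) t :=
  ((contMDiffOn_angular hγ.1).contMDiffAt (hJ.mem_nhds ht)).mdifferentiableAt (by simp)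

theorem eventually_angular_mem_source (ht : t ∈ J) (hy : (γ t).2 ∈ (extChartAt (𝓡 m) y₀).source) :
    ∀ᶠ s in 𝓝 t, (γ s).2 ∈ (extChartAt (𝓡 m) y₀).source :=
  (mdifferentiableAt_angular hJ hγ ht).continuousAt.eventually
    ((isOpen_extChartAt_source y₀).mem_nhds hy)

theorem deriv_chartCurve_prod (p₀ : ℝ × Y) (ht : t ∈ J)
    (hy : (γ t).2 ∈ (extChartAt (𝓡 m) p₀.2).source) :
    deriv (chartCurve (𝓘(ℝ, ℝ).prod (𝓡 m)) p₀ γ) t =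
      (deriv (fun s => (γ s).1) t, deriv (angCurve m p₀.2 γ) t) := by
  have h1 : chartCurve (𝓘(ℝ, ℝ).prod (𝓡 m)) p₀ γ = fun s => ((γ s).1, angCurve m p₀.2 γ s) :=
    funext (chartCurve_prod p₀)
  rw [h1]
  exact ((hasDerivAt_radial hJ hγ ht).prodMk (hasDerivAt_angCurve hJ hγ ht hy)).deriv

theorem momentum_prod_apply (p₀ : ℝ × Y) (ht : t ∈ J)
    (hy : (γ t).2 ∈ (extChartAt (𝓡 m) p₀.2).source) (w : ℝ × EuclideanSpace ℝ (Fin m)) :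
    momentum (𝓘(ℝ, ℝ).prod (𝓡 m)) (warpedMetric f h) p₀ γ t w =
      deriv (fun s => (γ s).1) t * w.1 + f (γ t).1 ^ 2 *
        famForm h p₀.2 ((γ t).1, angCurve m p₀.2 γ t) (deriv (angCurve m p₀.2 γ) t) w.2 := by
  unfold momentum
  rw [deriv_chartCurve_prod hJ hγ p₀ ht hy, chartCurve_prod]
  exact coordForm_warpedMetric p₀ ((extChartAt (𝓡 m) p₀.2).map_source hy) _ _

include hU in
theorem mem_prod_target (ht : t ∈ J) (hy : (γ t).2 ∈ (extChartAt (𝓡 m) y₀).source) :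
    ((γ t).1, angCurve m y₀ γ t) ∈ Ioo 0 R ×ˢ (extChartAt (𝓡 m) y₀).target :=
  ⟨(hU ht).1, (extChartAt (𝓡 m) y₀).map_source hy⟩

include hf hg hU in
-- The equation in product coordinates, before choosing the test vector: `(0, w)` will give the
-- angular equation and `(1, 0)` the radial one.
theorem hasDerivAt_momentum_prod (p₀ : ℝ × Y) (hp₀ : (γ t).2 ∈ (extChartAt (𝓡 m) p₀.2).source)
    (ht : t ∈ J) (w : ℝ × EuclideanSpace ℝ (Fin m)) :
    HasDerivAt (fun s => momentum (𝓘(ℝ, ℝ).prod (𝓡 m)) (warpedMetric f h) p₀ γ s w)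
      ((1 / 2 : ℝ) * (fderiv ℝ (fun q : ℝ × EuclideanSpace ℝ (Fin m) =>
        deriv (fun s => (γ s).1) t * deriv (fun s => (γ s).1) t + f q.1 ^ 2 *
          famForm h p₀.2 q (deriv (angCurve m p₀.2 γ) t) (deriv (angCurve m p₀.2 γ) t))
        ((γ t).1, angCurve m p₀.2 γ t) w)) t := by
  have hx : γ t ∈ (extChartAt (𝓘(ℝ, ℝ).prod (𝓡 m)) p₀).source := by
    rw [extChartAt_prod]; exact ⟨by simp [chartAt_self_eq], hp₀⟩
  have hG := regularMetricOn_warpedMetric hf hg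
  have h1 := (hG.satisfiesEulerLagrange_iff hx (hU ht)).1 (hγ.2 p₀ t ht hx)
  refine (h1.clm_apply (hasDerivAt_const t w)).congr_deriv ?_
  have hd := (hG.differentiableAt (mem_chartDomain hx (hU ht))).hasFDerivAt
  set X' := deriv (chartCurve (𝓘(ℝ, ℝ).prod (𝓡 m)) p₀ γ) t with hX'
  have h2 := (hd.clm_apply (hasFDerivAt_const X' _)).clm_apply (hasFDerivAt_const X' _)
  have hev : (fun q : ℝ × EuclideanSpace ℝ (Fin m) =>
      deriv (fun s => (γ s).1) t * deriv (fun s => (γ s).1) t + f q.1 ^ 2 *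
        famForm h p₀.2 q (deriv (angCurve m p₀.2 γ) t) (deriv (angCurve m p₀.2 γ) t))
      =ᶠ[𝓝 ((γ t).1, angCurve m p₀.2 γ t)]
      fun q => coordForm (𝓘(ℝ, ℝ).prod (𝓡 m)) (warpedMetric f h) p₀ q X' X' := by
    filter_upwards [(isOpen_Ioo.prod (isOpen_extChartAt_target p₀.2)).mem_nhds
      (mem_prod_target hJ hγ hU ht hp₀)] with q hq
    rw [coordForm_warpedMetric p₀ hq.2, hX', deriv_chartCurve_prod hJ hγ p₀ ht hp₀]
  rw [hev.fderiv_eq, ← chartCurve_prod p₀, h2.fderiv]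
  simp

include hf hg hU in
/-- The angular part of the geodesic equation. -/
theorem hasDerivAt_angular_momentum (ht : t ∈ J) (hy : (γ t).2 ∈ (extChartAt (𝓡 m) y₀).source) :
    HasDerivAt (fun s => f (γ s).1 ^ 2 • famForm h y₀ ((γ s).1, angCurve m y₀ γ s)
        (deriv (angCurve m y₀ γ) s))
      ((1 / 2 * f (γ t).1 ^ 2) • sqCovector (fderiv ℝ (fun u => famForm h y₀ ((γ t).1, u))
        (angCurve m y₀ γ t)) (deriv (angCurve m y₀ γ) t)) t := by
  refine hasDerivAt_clm_of_apply fun w => ?_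
  have h1 := hasDerivAt_momentum_prod hf hg hJ hγ hU (0, y₀) hy ht (0, w)
  have hev : (fun s => (f (γ s).1 ^ 2 • famForm h y₀ ((γ s).1, angCurve m y₀ γ s)
        (deriv (angCurve m y₀ γ) s)) w) =ᶠ[𝓝 t]
      fun s => momentum (𝓘(ℝ, ℝ).prod (𝓡 m)) (warpedMetric f h) (0, y₀) γ s (0, w) := by
    filter_upwards [hJ.mem_nhds ht, eventually_angular_mem_source hJ hγ ht hy] with s hs hys
    rw [momentum_prod_apply hJ hγ (0, y₀) hs hys]
    simp
  refine (h1.congr_of_eventuallyEq hev).congr_deriv ?_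
  have hmem := mem_prod_target hJ hγ hU ht hy
  set v := deriv (angCurve m y₀ γ) t
  set ρ := deriv (fun s => (γ s).1) t
  have hfam := differentiableAt_famForm hg hmem
  have hfd := hf.differentiableAt hmem.1
  have hq : DifferentiableAt ℝ (fun q : ℝ × EuclideanSpace ℝ (Fin m) => ρ * ρ + f q.1 ^ 2 *
      famForm h y₀ q v v) ((γ t).1, angCurve m y₀ γ t) := by
    have h3 : DifferentiableAt ℝ (fun q : ℝ × EuclideanSpace ℝ (Fin m) => f q.1)
      ((γ t).1, angCurve m y₀ γ t) := DifferentiableAt.comp (g := f) _ hfd differentiableAt_fst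
    exact (differentiableAt_const _).add ((h3.pow 2).mul ((hfam.clm_apply
      (differentiableAt_const _)).clm_apply (differentiableAt_const _)))
  -- The test vector has no radial component, so the metric is differentiated only inside the slice
  -- of constant radius. This is why `∂_r h` does not occur in the angular equation.
  have hline : HasFDerivAt (fun u : EuclideanSpace ℝ (Fin m) => ((γ t).1, u))
      (ContinuousLinearMap.inr ℝ ℝ (EuclideanSpace ℝ (Fin m))) (angCurve m y₀ γ t) :=
    hasFDerivAt_prodMk_right _ _
  have h4 := (HasFDerivAt.comp (g := fun q : ℝ × EuclideanSpace ℝ (Fin m) => ρ * ρ + f q.1 ^ 2 *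
      famForm h y₀ q v v) (angCurve m y₀ γ t) hq.hasFDerivAt hline)
  have hd' : DifferentiableAt ℝ (fun u => famForm h y₀ ((γ t).1, u)) (angCurve m y₀ γ t) :=
    DifferentiableAt.comp (g := famForm h y₀) _ hfam hline.differentiableAt
  have h5 := (((hd'.hasFDerivAt.clm_apply (hasFDerivAt_const v _)).clm_apply
    (hasFDerivAt_const v _)).const_mul (f (γ t).1 ^ 2)).const_add (ρ * ρ)
  have h6 := congrArg (fun L => L w) (h4.unique h5)
  have h7 : fderiv ℝ (fun q : ℝ × EuclideanSpace ℝ (Fin m) => ρ * ρ + f q.1 ^ 2 *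
      famForm h y₀ q v v) ((γ t).1, angCurve m y₀ γ t) (0, w) = f (γ t).1 ^ 2 *
        fderiv ℝ (fun u => famForm h y₀ ((γ t).1, u)) (angCurve m y₀ γ t) w v v := by
    refine Eq.trans ?_ (h6.trans ?_)
    · rfl
    · simp
  change 1 / 2 * fderiv ℝ (fun q : ℝ × EuclideanSpace ℝ (Fin m) => ρ * ρ + f q.1 ^ 2 *
      famForm h y₀ q v v) ((γ t).1, angCurve m y₀ γ t) (0, w) = _
  rw [h7]
  simp
  ring

/-- The squared speed of the angular component, in coordinates. -/
theorem famForm_deriv_angCurve (ht : t ∈ J) (hy : (γ t).2 ∈ (extChartAt (𝓡 m) y₀).source) :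
    famForm h y₀ ((γ t).1, angCurve m y₀ γ t) (deriv (angCurve m y₀ γ) t) (deriv (angCurve m y₀ γ) t) =
      projSpeed h γ t ^ 2 := by
  have h1 := coordForm_deriv_chartCurve (G := (h (γ t).1).inner) (x₀ := y₀)
    (mdifferentiableAt_angular hJ hγ ht) hy
  have h0 : 0 ≤ famForm h y₀ ((γ t).1, angCurve m y₀ γ t) (deriv (angCurve m y₀ γ) t)
      (deriv (angCurve m y₀ γ) t) := by
    rcases eq_or_ne (deriv (angCurve m y₀ γ) t) 0 with h2 | h2
    · rw [h2]; simp
    · exact (famForm_pos h (q := ((γ t).1, angCurve m y₀ γ t))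
        ((extChartAt (𝓡 m) y₀).map_source hy) _ h2).le
  have h3 : famForm h y₀ ((γ t).1, angCurve m y₀ γ t) (deriv (angCurve m y₀ γ) t)
      (deriv (angCurve m y₀ γ) t) = (h (γ t).1).inner (γ t).2 (velocity (𝓡 m) (fun s => (γ s).2) t)
        (velocity (𝓡 m) (fun s => (γ s).2) t) := h1
  unfold projSpeed
  rw [Real.sq_sqrt (h3 ▸ h0), h3]

theorem unitSpeed_eq (hunit : HasUnitSpeedOn (𝓘(ℝ, ℝ).prod (𝓡 m)) (warpedMetric f h) γ J)
    (ht : t ∈ J) :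
    deriv (fun s => (γ s).1) t ^ 2 + f (γ t).1 ^ 2 * projSpeed h γ t ^ 2 = 1 := by
  have hy : (γ t).2 ∈ (extChartAt (𝓡 m) (γ t).2).source := mem_extChartAt_source _
  have hx : γ t ∈ (extChartAt (𝓘(ℝ, ℝ).prod (𝓡 m)) (γ t)).source := mem_extChartAt_source _
  have h1 := coordForm_deriv_chartCurve (G := warpedMetric f h) (x₀ := γ t)
    ((hγ.1.contMDiffAt (hJ.mem_nhds ht)).mdifferentiableAt (by simp)) hx
  rw [hunit t ht, chartCurve_prod, deriv_chartCurve_prod hJ hγ (γ t) ht hy,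
    coordForm_warpedMetric (γ t) ((extChartAt (𝓡 m) (γ t).2).map_source hy),
    famForm_deriv_angCurve hJ hγ ht hy] at h1
  rw [← h1]; ring

include hf hg hU in
/-- The radial part of the geodesic equation. -/
theorem exists_hasDerivAt_radial_deriv (hc : 0 ≤ c) (hbound : RadialVariationBound R c h)
    (hunit : HasUnitSpeedOn (𝓘(ℝ, ℝ).prod (𝓡 m)) (warpedMetric f h) γ J) (ht : t ∈ J) :
    ∃ q, |q| ≤ c ∧ HasDerivAt (deriv fun s => (γ s).1)
      ((1 - deriv (fun s => (γ s).1) t ^ 2) * (deriv f (γ t).1 / f (γ t).1 + q)) t := by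
  have hy : (γ t).2 ∈ (extChartAt (𝓡 m) (γ t).2).source := mem_extChartAt_source _
  have h1 := hasDerivAt_momentum_prod hf hg hJ hγ hU (γ t) hy ht (1, 0)
  have hev : (deriv fun s => (γ s).1) =ᶠ[𝓝 t]
      fun s => momentum (𝓘(ℝ, ℝ).prod (𝓡 m)) (warpedMetric f h) (γ t) γ s (1, 0) := by
    filter_upwards [hJ.mem_nhds ht, eventually_angular_mem_source hJ hγ ht hy] with s hs hys
    rw [momentum_prod_apply hJ hγ (γ t) hs hys]
    simp
  have h2 := h1.congr_of_eventuallyEq hev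
  have hmem := mem_prod_target hJ hγ hU ht hy
  have hspeed := famForm_deriv_angCurve (h := h) hJ hγ ht hy
  have hunit' := unitSpeed_eq hJ hγ hunit ht
  set v := deriv (angCurve m (γ t).2 γ) t with hv
  set ρ := deriv (fun s => (γ s).1) t with hρ
  set r := (γ t).1 with hr
  set ξ := angCurve m (γ t).2 γ t with hξ
  have hfr : 0 < f r := hf.pos r hmem.1
  have hfam := differentiableAt_famForm hg hmem
  have hfd := hf.differentiableAt hmem.1
  have hq : DifferentiableAt ℝ (fun q : ℝ × EuclideanSpace ℝ (Fin m) => ρ * ρ + f q.1 ^ 2 *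
      famForm h (γ t).2 q v v) (r, ξ) := by
    have h3 : DifferentiableAt ℝ (fun q : ℝ × EuclideanSpace ℝ (Fin m) => f q.1)
      (r, ξ) := DifferentiableAt.comp (g := f) _ hfd differentiableAt_fst
    exact (differentiableAt_const _).add ((h3.pow 2).mul ((hfam.clm_apply
      (differentiableAt_const _)).clm_apply (differentiableAt_const _)))
  have hline : HasDerivAt (fun s : ℝ => (s, ξ)) ((1 : ℝ), (0 : EuclideanSpace ℝ (Fin m))) r :=
    (hasDerivAt_id r).prodMk (hasDerivAt_const r ξ)
  have h4 := HasFDerivAt.comp_hasDerivAt (l := fun q : ℝ × EuclideanSpace ℝ (Fin m) =>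
    ρ * ρ + f q.1 ^ 2 * famForm h (γ t).2 q v v) (f := fun s : ℝ => (s, ξ)) r hq.hasFDerivAt hline
  have hkd : DifferentiableAt ℝ (fun s => famForm h (γ t).2 (s, ξ) v v) r :=
    ((DifferentiableAt.comp (g := famForm h (γ t).2) r hfam hline.differentiableAt).clm_apply
      (differentiableAt_const _)).clm_apply (differentiableAt_const _)
  have h5 := ((hfd.hasDerivAt.pow 2).mul hkd.hasDerivAt).const_add (ρ * ρ)
  have h6 := h4.unique h5
  have hb := hbound r hmem.1 ((extChartAt (𝓡 m) (γ t).2).symm ξ)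
    (chartDeriv (𝓡 m) (γ t).2 ξ v)
  set k' := deriv (fun s => famForm h (γ t).2 (s, ξ) v v) r with hk'
  set ν := projSpeed h γ t with hν
  have hb' : -(2 * c * ν ^ 2) ≤ k' ∧ k' ≤ 2 * c * ν ^ 2 := by
    rw [← hspeed]; exact hb
  rw [h6] at h2
  simp only [Pi.pow_apply] at h2
  rw [hspeed] at h2
  -- If the angular speed vanishes then `1 - ρ ^ 2 = 0` and both sides are zero, so `q` is
  -- arbitrary.
  rcases eq_or_ne ν 0 with h0 | h0
  · refine ⟨0, by simpa using hc, h2.congr_deriv ?_⟩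
    have hk0 : k' = 0 := by
      rw [h0] at hb'; apply le_antisymm <;> nlinarith [hb'.1, hb'.2]
    have hρ1 : 1 - ρ ^ 2 = 0 := by rw [h0] at hunit'; linarith
    rw [hk0, h0, hρ1]; simp
  · have hν2 : 0 < ν ^ 2 := by positivity
    -- The equation is r̈ = f f' ν² + ½ f² k', where k' is the radial derivative of h(ẏ, ẏ); divide
    -- by f² ν² = 1 − ṙ². The bound on `∂_r h` becomes `|q| ≤ c`.
    refine ⟨k' / (2 * ν ^ 2), ?_, h2.congr_deriv ?_⟩
    · rw [abs_le, le_div_iff₀ (by positivity), div_le_iff₀ (by positivity)]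
      constructor <;> linarith [hb'.1, hb'.2]
    · rw [show 1 - ρ ^ 2 = f r ^ 2 * ν ^ 2 by linarith]
      field_simp
      simp
      ring

end Geodesic

end WarpedEquations

end WarpedGeodesics

/-! ### The radial motion: monotonicity, Clairaut's relation, and the angle. -/

namespace WarpedGeodesics

section MonotoneOfDeriv

variable {D : Set ℝ} {g g' : ℝ → ℝ}

theorem monotoneOn_of_hasDerivAt_nonneg (hD : Convex ℝ D) (h : ∀ x ∈ D, HasDerivAt g (g' x) x)
    (h0 : ∀ x ∈ D, 0 ≤ g' x) : MonotoneOn g D :=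
  monotoneOn_of_deriv_nonneg hD (fun x hx => (h x hx).continuousAt.continuousWithinAt)
    (fun x hx => (h x (interior_subset hx)).differentiableAt.differentiableWithinAt)
    fun x hx => by rw [(h x (interior_subset hx)).deriv]; exact h0 x (interior_subset hx)

theorem antitoneOn_of_hasDerivAt_nonpos (hD : Convex ℝ D) (h : ∀ x ∈ D, HasDerivAt g (g' x) x)
    (h0 : ∀ x ∈ D, g' x ≤ 0) : AntitoneOn g D :=
  antitoneOn_of_deriv_nonpos hD (fun x hx => (h x hx).continuousAt.continuousWithinAt)
    (fun x hx => (h x (interior_subset hx)).differentiableAt.differentiableWithinAt)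
    fun x hx => by rw [(h x (interior_subset hx)).deriv]; exact h0 x (interior_subset hx)

theorem strictMonoOn_of_hasDerivAt_pos (hD : Convex ℝ D) (h : ∀ x ∈ D, HasDerivAt g (g' x) x)
    (h0 : ∀ x ∈ interior D, 0 < g' x) : StrictMonoOn g D :=
  strictMonoOn_of_deriv_pos hD (fun x hx => (h x hx).continuousAt.continuousWithinAt)
    fun x hx => by rw [(h x (interior_subset hx)).deriv]; exact h0 x hx

end MonotoneOfDeriv

theorem exists_eq_Ioo {J : Set ℝ} (hJ : IsOpen J) (hJc : J.OrdConnected) (hne : J.Nonempty)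
    (ha : BddAbove J) (hb : BddBelow J) : J = Ioo (sInf J) (sSup J) := by
  apply Subset.antisymm
  · intro t ht
    obtain ⟨ε, hε, hball⟩ := Metric.isOpen_iff.1 hJ t ht
    rw [Real.ball_eq_Ioo] at hball
    have h1 : t - ε / 2 ∈ J := hball ⟨by linarith, by linarith⟩
    have h2 : t + ε / 2 ∈ J := hball ⟨by linarith, by linarith⟩
    exact ⟨by linarith [csInf_le hb h1], by linarith [le_csSup ha h2]⟩
  · intro t ht
    obtain ⟨s, hs, hst⟩ := exists_lt_of_csInf_lt hne ht.1
    obtain ⟨u, hu, htu⟩ := exists_lt_of_lt_csSup hne ht.2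
    exact hJc.out hs hu ⟨hst.le, htu.le⟩

section WarpingFunction

variable {R : ℝ} {f : ℝ → ℝ} (hf : IsWarpingFunction R f)
include hf

namespace IsWarpingFunction

/-- By convexity the chord from the origin is no steeper than the tangent at its right end. This
makes a perturbation of size `c * f` small compared with `f'` when `r` is small. -/
theorem le_mul_deriv {r : ℝ} (hr : r ∈ Ioo 0 R) : f r ≤ r * deriv f r := by
  have h := hf.convexOn.slope_le_deriv (x := 0) (y := r) ⟨le_rfl, hr.1.trans hr.2⟩
    ⟨hr.1.le, hr.2⟩ hr.1 (hf.differentiableAt hr)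
  rw [slope_def_field, hf.zero, sub_zero, sub_zero, div_le_iff₀ hr.1] at h
  linarith

theorem deriv_pos {r : ℝ} (hr : r ∈ Ioo 0 R) : 0 < deriv f r := by
  have h := hf.le_mul_deriv hr
  have h1 := hf.pos r hr
  by_contra hcon
  nlinarith [mul_nonneg hr.1.le (sub_nonneg.2 (not_lt.1 hcon))]

theorem monotoneOn_deriv : MonotoneOn (deriv f) (Ioo 0 R) :=
  (hf.convexOn.subset Ioo_subset_Ico_self (convex_Ioo 0 R)).monotoneOn_deriv
    fun _ hr => hf.differentiableAt hr

theorem strictMonoOn : StrictMonoOn f (Ico 0 R) :=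
  strictMonoOn_of_deriv_pos (convex_Ico 0 R) hf.contDiffOn.continuousOn fun r hr => by
    rw [interior_Ico] at hr; exact hf.deriv_pos hr

end IsWarpingFunction

end WarpingFunction

/-- The radial component `r` of a unit speed geodesic of a generalized warped product with closest
distance `δ` to the singularity at time `0`, together with the speed `ν` of the angular
component. -/
structure RadialMotion (R c : ℝ) (f : ℝ → ℝ) (δ : ℝ) (r ν : ℝ → ℝ) (J : Set ℝ) : Prop where
  isOpen : IsOpen J
  ordConnected : J.OrdConnected
  zero_mem : (0 : ℝ) ∈ J
  mem : ∀ t ∈ J, r t ∈ Ioo 0 R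
  hasDerivAt : ∀ t ∈ J, HasDerivAt r (deriv r t) t
  acceleration : ∀ t ∈ J, ∃ q, |q| ≤ c ∧ HasDerivAt (deriv r)
    ((1 - deriv r t ^ 2) * (deriv f (r t) / f (r t) + q)) t
  energy : ∀ t ∈ J, deriv r t ^ 2 + f (r t) ^ 2 * ν t ^ 2 = 1
  nonneg : ∀ t, 0 ≤ ν t
  start : r 0 = δ
  min : ∀ t ∈ J, δ ≤ r t

namespace RadialMotion

variable {R c δ : ℝ} {f r ν : ℝ → ℝ} {J : Set ℝ} {t : ℝ}

/-- The hypotheses are symmetric in time, so estimates need only be proved for `t ≥ 0` or at the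
upper end of `J`. -/
theorem comp_neg (M : RadialMotion R c f δ r ν J) :
    RadialMotion R c f δ (fun t => r (-t)) (fun t => ν (-t)) (Neg.neg ⁻¹' J) := by
  have hd : ∀ t, deriv (fun t => r (-t)) t = - deriv r (-t) := fun t => deriv_comp_neg (f := r) t
  have hd' : deriv (fun t => r (-t)) = fun t => - deriv r (-t) := funext hd
  refine ⟨M.isOpen.preimage continuous_neg, ?_, ?_, fun t ht => M.mem _ ht, fun t ht => ?_,
    fun t ht => ?_, fun t ht => ?_, fun t => M.nonneg _, ?_, fun t ht => M.min _ ht⟩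
  · exact ⟨fun a ha b hb x hx => M.ordConnected.out hb ha ⟨neg_le_neg hx.2, neg_le_neg hx.1⟩⟩
  · simpa using M.zero_mem
  · rw [hd]
    exact ((M.hasDerivAt _ ht).comp t (hasDerivAt_neg t)).congr_deriv (by simp)
  · obtain ⟨q, hq, h⟩ := M.acceleration _ ht
    refine ⟨q, hq, ?_⟩
    rw [hd']
    refine ((h.comp t (hasDerivAt_neg t)).neg).congr_deriv ?_
    simp
  · rw [hd]; simpa using M.energy _ ht
  · simpa using M.start

variable (hf : IsWarpingFunction R f) (hc : 0 ≤ c) (hRc : R * c < 1)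
  (M : RadialMotion R c f δ r ν J)
include M

theorem delta_mem : δ ∈ Ioo 0 R := M.start ▸ M.mem 0 M.zero_mem

theorem convex : Convex ℝ J := M.ordConnected.convex

theorem deriv_zero : deriv r 0 = 0 := by
  have h : IsLocalMin r 0 := by
    filter_upwards [M.isOpen.mem_nhds M.zero_mem] with t ht
    rw [M.start]; exact M.min t ht
  exact h.deriv_eq_zero

theorem deriv_sq_le (ht : t ∈ J) : deriv r t ^ 2 ≤ 1 := by
  have := M.energy t ht
  nlinarith [mul_nonneg (sq_nonneg (f (r t))) (sq_nonneg (ν t))]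

include hf in
-- This quantity is the square of the angular momentum f² ν. The terms with f' cancel, as for
-- Clairaut's relation, and only the perturbation `q` survives.
theorem hasDerivAt_mass (ht : t ∈ J) : ∃ q, |q| ≤ c ∧
    HasDerivAt (fun t => f (r t) ^ 2 * (1 - deriv r t ^ 2))
      (-2 * q * deriv r t * (f (r t) ^ 2 * (1 - deriv r t ^ 2))) t := by
  obtain ⟨q, hq, h⟩ := M.acceleration t ht
  refine ⟨q, hq, ?_⟩
  have hfr := hf.pos _ (M.mem t ht)
  have h1 : HasDerivAt (fun t => f (r t)) (deriv f (r t) * deriv r t) t :=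
    (hf.differentiableAt (M.mem t ht)).hasDerivAt.comp t (M.hasDerivAt t ht)
  refine ((h1.pow 2).mul ((h.pow 2).const_sub 1)).congr_deriv ?_
  simp only [Pi.pow_apply]
  field_simp
  simp
  ring

theorem mass_nonneg (ht : t ∈ J) : 0 ≤ f (r t) ^ 2 * (1 - deriv r t ^ 2) :=
  mul_nonneg (sq_nonneg _) (by linarith [M.deriv_sq_le ht])

theorem mass_zero : f (r 0) ^ 2 * (1 - deriv r 0 ^ 2) = f δ ^ 2 := by
  rw [M.deriv_zero, M.start]; ring

include hf hc in
-- Since |q ṙ| ≤ c, the product with exp(2ct) is nondecreasing, and it starts at f(δ)² > 0. Hence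
-- the geodesic never becomes radial.
theorem mass_pos_of_nonneg (ht : t ∈ J) (ht0 : 0 ≤ t) : 0 < f (r t) ^ 2 * (1 - deriv r t ^ 2) := by
  choose! q hq h using fun t (ht : t ∈ J) => M.hasDerivAt_mass hf ht
  have hexp : ∀ t, HasDerivAt (fun t => Real.exp (2 * c * t)) (Real.exp (2 * c * t) * (2 * c)) t :=
    fun t => by simpa using ((hasDerivAt_id t).const_mul (2 * c)).exp
  have hmono := monotoneOn_of_hasDerivAt_nonneg M.convex
    (fun t ht => (h t ht).mul (hexp t)) (fun t ht => by
      have h1 := M.mass_nonneg ht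
      have h2 : |q t * deriv r t| ≤ c := by
        rw [abs_mul]
        have h3 : |deriv r t| ≤ 1 := abs_le_one_iff_mul_self_le_one.2 (by nlinarith [M.deriv_sq_le ht])
        nlinarith [hq t ht, abs_nonneg (q t), abs_nonneg (deriv r t)]
      have h3 : q t * deriv r t ≤ c := (le_abs_self _).trans h2
      have h4 : 0 ≤ Real.exp (2 * c * t) *
          ((f (r t) ^ 2 * (1 - deriv r t ^ 2)) * (2 * (c - q t * deriv r t))) :=
        mul_nonneg (Real.exp_pos _).le (mul_nonneg h1 (by linarith))
      nlinarith [h4])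
  have h1 := hmono M.zero_mem ht ht0
  simp only [Pi.mul_apply] at h1
  rw [M.mass_zero, mul_zero, Real.exp_zero, mul_one] at h1
  have h2 := hf.pos δ M.delta_mem
  have h3 : 0 < f (r t) ^ 2 * (1 - deriv r t ^ 2) * Real.exp (2 * c * t) :=
    (by positivity : 0 < f δ ^ 2).trans_le h1
  exact pos_of_mul_pos_left h3 (Real.exp_pos _).le

include hf hc in
theorem mass_pos (ht : t ∈ J) : 0 < f (r t) ^ 2 * (1 - deriv r t ^ 2) := by
  rcases le_total 0 t with h | h
  · exact M.mass_pos_of_nonneg hf hc ht h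
  · have := M.comp_neg.mass_pos_of_nonneg hf hc (t := -t) (by simpa using ht) (by linarith)
    rw [deriv_comp_neg (f := r)] at this
    simpa using this

include hf hc in
theorem deriv_sq_lt (ht : t ∈ J) : deriv r t ^ 2 < 1 := by
  have := M.mass_pos hf hc ht
  have h2 : 0 < f (r t) ^ 2 := by have := hf.pos _ (M.mem t ht); positivity
  nlinarith [pos_of_mul_pos_right this h2.le]

include hf hc in
theorem speed_pos (ht : t ∈ J) : 0 < ν t := by
  refine lt_of_le_of_ne (M.nonneg t) fun h => ?_
  have h1 := M.energy t ht
  rw [← h] at h1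
  linarith [M.deriv_sq_lt hf hc ht, h1]

omit M in
include hf hc hRc in
-- From f ≤ s f' one gets |q f| ≤ c s f', and c s < 1 because R c < 1.
theorem factor_pos {s q : ℝ} (hs : s ∈ Ioo 0 R) (hq : |q| ≤ c) :
    deriv f s * (1 - c * s) ≤ deriv f s + q * f s ∧
    deriv f s + q * f s ≤ deriv f s * (1 + c * s) ∧ 0 < deriv f s * (1 - c * s) := by
  have h1 := hf.le_mul_deriv hs
  have h2 := hf.deriv_pos hs
  have h3 := hf.pos s hs
  have h4 := abs_le.1 hq
  have h5 : c * s ≤ R * c := by nlinarith [hs.2]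
  have h6 : c * f s ≤ c * (s * deriv f s) := mul_le_mul_of_nonneg_left h1 hc
  refine ⟨?_, ?_, mul_pos h2 (by linarith)⟩
  · nlinarith [mul_le_mul_of_nonneg_right h4.1 h3.le]
  · nlinarith [mul_le_mul_of_nonneg_right h4.2 h3.le]

include hf hc hRc in
-- The sign of r̈ is that of f' + q f, which is positive by `factor_pos`; so r is strictly convex in
-- time.
theorem strictMonoOn_deriv : StrictMonoOn (deriv r) J := by
  choose! q hq h using M.acceleration
  refine strictMonoOn_of_hasDerivAt_pos M.convex h fun t ht => ?_
  have ht' := interior_subset ht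
  have h1 := M.deriv_sq_lt hf hc ht'
  have h2 := factor_pos hf hc hRc (M.mem t ht') (hq t ht')
  have h3 := hf.pos _ (M.mem t ht')
  refine mul_pos (by linarith) ?_
  have : deriv f (r t) / f (r t) + q t = (deriv f (r t) + q t * f (r t)) / f (r t) := by
    field_simp
  rw [this]
  exact div_pos (by linarith [h2.1, h2.2.2]) h3

include hf hc hRc in
theorem deriv_pos (ht : t ∈ J) (h0 : 0 < t) : 0 < deriv r t := by
  rw [← M.deriv_zero]; exact M.strictMonoOn_deriv hf hc hRc M.zero_mem ht h0

include hf hc hRc in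
-- Once ṙ is positive it increases, so r grows at least linearly; but r stays below `R`.
theorem bddAbove : BddAbove J := by
  by_cases hex : ∃ t₁ ∈ J, 0 < t₁
  · obtain ⟨t₁, ht₁, h0⟩ := hex
    have hp := M.deriv_pos hf hc hRc ht₁ h0
    refine ⟨t₁ + R / deriv r t₁, fun t ht => ?_⟩
    rcases le_total t t₁ with h | h
    · have : 0 < R / deriv r t₁ := div_pos (M.delta_mem.1.trans M.delta_mem.2) hp
      linarith
    · have hmono := monotoneOn_of_hasDerivAt_nonneg (M.convex.inter (convex_Ici t₁))
        (fun s hs => (M.hasDerivAt s hs.1).sub ((hasDerivAt_id s).const_mul (deriv r t₁)))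
        fun s hs => by
          have := (M.strictMonoOn_deriv hf hc hRc).monotoneOn ht₁ hs.1 hs.2
          linarith
      have h1 := hmono ⟨ht₁, self_mem_Ici⟩ ⟨ht, h⟩ h
      simp only [id, Pi.sub_apply] at h1
      have h2 := (M.mem t ht).2
      have h3 := (M.mem t₁ ht₁).1
      have h4 : t - t₁ ≤ R / deriv r t₁ := by
        rw [le_div_iff₀ hp]; nlinarith
      linarith
  · push Not at hex
    exact ⟨0, hex⟩

include hf hc hRc in
theorem bddBelow : BddBelow J := by
  obtain ⟨B, hB⟩ := M.comp_neg.bddAbove hf hc hRc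
  refine ⟨-B, fun t ht => ?_⟩
  have := hB (show -t ∈ Neg.neg ⁻¹' J by simpa using ht)
  linarith

include hf hc hRc in
theorem eq_Ioo : J = Ioo (sInf J) (sSup J) :=
  exists_eq_Ioo M.isOpen M.ordConnected ⟨0, M.zero_mem⟩ (M.bddAbove hf hc hRc)
    (M.bddBelow hf hc hRc)

/-- The angular momentum `f(r)² ν`. -/
theorem angularMomentum_sq (ht : t ∈ J) :
    (f (r t) ^ 2 * ν t) ^ 2 = f (r t) ^ 2 * (1 - deriv r t ^ 2) := by
  have := M.energy t ht
  rw [show 1 - deriv r t ^ 2 = f (r t) ^ 2 * ν t ^ 2 by linarith]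
  ring

include hf hc hRc in
-- For t ≥ 0 one has ṙ ≥ 0, so the logarithmic derivative −2 q ṙ of the squared angular momentum is
-- bounded by that of exp(±2cr). Exponents in r rather than in t make the bounds collapse as r → 0,
-- whatever the time taken.
theorem angularMomentum_bounds_of_nonneg (ht : t ∈ J) (h0 : 0 ≤ t) :
    f δ * Real.exp (-(c * (r t - δ))) ≤ f (r t) ^ 2 * ν t ∧
      f (r t) ^ 2 * ν t ≤ f δ * Real.exp (c * (r t - δ)) := by
  choose! q hq h using fun t (ht : t ∈ J) => M.hasDerivAt_mass hf ht
  have hconv := M.convex.inter (convex_Ici (0 : ℝ))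
  have hexp : ∀ k : ℝ, ∀ t ∈ J ∩ Ici 0, HasDerivAt (fun t => Real.exp (k * (r t - δ)))
      (Real.exp (k * (r t - δ)) * (k * deriv r t)) t := fun k t ht => by
    simpa using (((M.hasDerivAt t ht.1).sub_const δ).const_mul k).exp
  have hr' : ∀ t ∈ J ∩ Ici 0, 0 ≤ deriv r t := fun t ht => by
    rcases (show (0 : ℝ) ≤ t from ht.2).eq_or_lt with h | h
    · rw [← h, M.deriv_zero]
    · exact (M.deriv_pos hf hc hRc ht.1 h).le
  have hmono := monotoneOn_of_hasDerivAt_nonneg hconv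
    (fun t ht => (h t ht.1).mul (hexp (2 * c) t ht)) (fun t ht => by
      have h1 := M.mass_nonneg ht.1
      have h2 := (abs_le.1 (hq t ht.1)).2
      have h4 : 0 ≤ Real.exp (2 * c * (r t - δ)) *
          ((f (r t) ^ 2 * (1 - deriv r t ^ 2)) * (2 * deriv r t * (c - q t))) :=
        mul_nonneg (Real.exp_pos _).le (mul_nonneg h1 (mul_nonneg (by linarith [hr' t ht])
          (by linarith)))
      nlinarith [h4])
  have hanti := antitoneOn_of_hasDerivAt_nonpos hconv
    (fun t ht => (h t ht.1).mul (hexp (-(2 * c)) t ht)) (fun t ht => by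
      have h1 := M.mass_nonneg ht.1
      have h2 := (abs_le.1 (hq t ht.1)).1
      have h4 : 0 ≤ Real.exp (-(2 * c) * (r t - δ)) *
          ((f (r t) ^ 2 * (1 - deriv r t ^ 2)) * (2 * deriv r t * (c + q t))) :=
        mul_nonneg (Real.exp_pos _).le (mul_nonneg h1 (mul_nonneg (by linarith [hr' t ht])
          (by linarith)))
      nlinarith [h4])
  have h1 := hmono ⟨M.zero_mem, self_mem_Ici⟩ ⟨ht, h0⟩ h0
  have h2 := hanti ⟨M.zero_mem, self_mem_Ici⟩ ⟨ht, h0⟩ h0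
  simp only [Pi.mul_apply] at h1 h2
  rw [M.mass_zero, M.start, sub_self, mul_zero, Real.exp_zero, mul_one] at h1 h2
  rw [← M.angularMomentum_sq ht] at h1 h2
  have hfd := hf.pos δ M.delta_mem
  have hL : 0 ≤ f (r t) ^ 2 * ν t := mul_nonneg (sq_nonneg _) (M.nonneg t)
  have he : ∀ k : ℝ, Real.exp (2 * k * (r t - δ)) = Real.exp (k * (r t - δ)) ^ 2 := fun k => by
    rw [← Real.exp_nat_mul]; congr 1; push_cast; ring
  rw [he, ← mul_pow] at h1
  rw [show -(2 * c) = 2 * -c by ring, he, ← mul_pow] at h2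
  have h3 := le_of_sq_le_sq h1 (by positivity)
  have h4 := le_of_sq_le_sq h2 hfd.le
  constructor
  · rw [Real.exp_neg, ← div_eq_mul_inv, div_le_iff₀ (Real.exp_pos _)]
    exact h3
  · have h5 := Real.exp_pos (c * (r t - δ))
    rw [neg_mul, Real.exp_neg, ← div_eq_mul_inv, div_le_iff₀ h5] at h4
    exact h4

include hf hc hRc in
theorem angularMomentum_bounds (ht : t ∈ J) :
    f δ * Real.exp (-(c * (r t - δ))) ≤ f (r t) ^ 2 * ν t ∧
      f (r t) ^ 2 * ν t ≤ f δ * Real.exp (c * (r t - δ)) := by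
  rcases le_total 0 t with h | h
  · exact M.angularMomentum_bounds_of_nonneg hf hc hRc ht h
  · have := M.comp_neg.angularMomentum_bounds_of_nonneg hf hc hRc (t := -t)
      (by simpa using ht) (by linarith)
    simpa using this

include hf hc in
-- Divide r̈ = (1 − ṙ²)(f'/f + q) by cos θ = √(1 − ṙ²) = f ν. The formula expresses ν dt by dθ
-- without any second-order data.
theorem hasDerivAt_angle (ht : t ∈ J) : ∃ q, |q| ≤ c ∧
    HasDerivAt (fun t => Real.arcsin (deriv r t)) (ν t * (deriv f (r t) + q * f (r t))) t := by
  obtain ⟨q, hq, h⟩ := M.acceleration t ht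
  refine ⟨q, hq, ?_⟩
  have h1 := M.deriv_sq_lt hf hc ht
  have hfr := hf.pos _ (M.mem t ht)
  have hν := M.speed_pos hf hc ht
  have hen := M.energy t ht
  have h2 : HasDerivAt Real.arcsin (1 / √(1 - deriv r t ^ 2)) (deriv r t) :=
    Real.hasDerivAt_arcsin (fun h => by rw [h] at h1; norm_num at h1)
      (fun h => by rw [h] at h1; norm_num at h1)
  refine (h2.comp t h).congr_deriv ?_
  have h3 : 1 - deriv r t ^ 2 = (f (r t) * ν t) ^ 2 := by rw [mul_pow]; linarith
  rw [h3, Real.sqrt_sq (by positivity)]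
  field_simp

theorem cos_angle (hf : IsWarpingFunction R f) (ht : t ∈ J) :
    Real.cos (Real.arcsin (deriv r t)) = f (r t) * ν t := by
  have hen := M.energy t ht
  have hfr := hf.pos _ (M.mem t ht)
  rw [Real.cos_arcsin, show 1 - deriv r t ^ 2 = (f (r t) * ν t) ^ 2 by rw [mul_pow]; linarith,
    Real.sqrt_sq (mul_nonneg hfr.le (M.nonneg t))]

end RadialMotion

end WarpedGeodesics

namespace WarpedGeodesics

/-! ### Maximal geodesics leave compact sets. -/

section MaximalGeodesics

variable {E : Type*} [NormedAddCommGroup E] [NormedSpace ℝ E] [FiniteDimensional ℝ E]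
  {H : Type*} [TopologicalSpace H] {I : ModelWithCorners ℝ E H} [I.Boundaryless]
  {M : Type*} [TopologicalSpace M] [T2Space M] [ChartedSpace H M] [IsManifold I ∞ M]
  {G : (x : M) → TangentSpace I x →L[ℝ] TangentSpace I x →L[ℝ] ℝ} {U : Set M} {γ : ℝ → M}
  {J : Set ℝ}

namespace IsMaximalGeodesicIn

theorem comp_neg (h : IsMaximalGeodesicIn I G U γ J) :
    IsMaximalGeodesicIn I G U (fun t => γ (-t)) (Neg.neg ⁻¹' J) where
  isOpen := h.isOpen.preimage continuous_neg
  ordConnected := ⟨fun _ ha _ hb _ hx => h.ordConnected.out hb ha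
    ⟨neg_le_neg hx.2, neg_le_neg hx.1⟩⟩
  mapsTo _ ht := h.mapsTo ht
  isGeodesicOn := h.isGeodesicOn.comp_neg
  maximal γ' J' hJ' hJc hU hγ' hsub heq := by
    have h1 := h.maximal (fun t => γ' (-t)) (Neg.neg ⁻¹' J') (hJ'.preimage continuous_neg)
      ⟨fun _ ha _ hb _ hx => hJc.out hb ha ⟨neg_le_neg hx.2, neg_le_neg hx.1⟩⟩
      (fun _ ht => hU ht) hγ'.comp_neg
      (fun t ht => hsub (by simpa using ht)) (fun t ht => by
        simpa using heq (show -t ∈ Neg.neg ⁻¹' J by simpa using ht))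
    rw [← h1]
    ext t; simp

/-- The energy is constant, so a geodesic staying in a compact subset of `U` up to time `B` could be
extended, against maximality. -/
theorem not_eventually_mem_isCompact (hG : RegularMetricOn I G U)
    (h : IsMaximalGeodesicIn I G U γ J) {A B : ℝ} (hAB : A < B) (hJ : J = Ioo A B) {K : Set M}
    (hK : IsCompact K) (hKU : K ⊆ U) : ∃ᶠ t in 𝓝[<] B, γ t ∉ K := by
  subst hJ
  intro hev
  simp only [not_not] at hev
  obtain ⟨t₀, ht₀⟩ : (Ioo A B).Nonempty := nonempty_Ioo.2 hAB
  obtain ⟨B', hB', β, hβ, hβU, hβγ⟩ := hG.exists_extension_of_isCompact hAB h.isGeodesicOn h.mapsTo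
    hK hKU hev fun t ht => (hG.energy_eq isOpen_Ioo isPreconnected_Ioo h.isGeodesicOn h.mapsTo
      ht ht₀).le
  have h1 := h.maximal β _ isOpen_Ioo ordConnected_Ioo hβU hβ (Ioo_subset_Ioo_right hB'.le) hβγ
  have h2 : B ∈ Ioo A B' := ⟨hAB, hB'⟩
  rw [h1] at h2
  exact lt_irrefl _ h2.2

end IsMaximalGeodesicIn

end MaximalGeodesics

section Family

variable {m : ℕ} {Y : Type*} [TopologicalSpace Y] [T2Space Y] [CompactSpace Y]
  [ChartedSpace (EuclideanSpace ℝ (Fin m)) Y]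
  [IsManifold (𝓡 m) ∞ Y] {R c : ℝ} {f : ℝ → ℝ} {h : ℝ → RiemMetric m Y}
  {γ : ℝ → ℝ → ℝ × Y} {J : ℝ → Set ℝ} {δ : ℝ}

theorem projSpeed_nonneg (h : ℝ → RiemMetric m Y) (γ : ℝ → ℝ × Y) (t : ℝ) : 0 ≤ projSpeed h γ t :=
  Real.sqrt_nonneg _

theorem IsGeodesicFamily.radialMotion (hf : IsWarpingFunction R f)
    (hg : IsGeneralizedWarpedProduct R f h) (hc : 0 ≤ c) (hbound : RadialVariationBound R c h)
    (hγ : IsGeodesicFamily R f h γ J) (hδ : δ ∈ Ioo 0 R) :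
    RadialMotion R c f δ (fun t => (γ δ t).1) (projSpeed h (γ δ)) (J δ) :=
  have hm := hγ.maximalGeodesic δ hδ
  { isOpen := hm.isOpen
    ordConnected := hm.ordConnected
    zero_mem := hγ.zero_mem δ hδ
    mem := fun _ ht => (hm.mapsTo ht).1
    hasDerivAt := fun _ ht => hasDerivAt_radial hm.isOpen hm.isGeodesicOn ht
    acceleration := fun _ ht => exists_hasDerivAt_radial_deriv hf hg hm.isOpen hm.isGeodesicOn
      hm.mapsTo hc hbound (hγ.unitSpeed δ hδ) ht
    energy := fun _ ht => unitSpeed_eq hm.isOpen hm.isGeodesicOn (hγ.unitSpeed δ hδ) ht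
    nonneg := projSpeed_nonneg h (γ δ)
    start := hγ.radius_zero δ hδ
    min := hγ.radius_min δ hδ }

/-- The set [δ, ρ] × Y is compact because `Y` is, and since the radius never falls below `δ` the
only way to leave it is at radii above `ρ`. -/
theorem exists_radius_gt_of_maximal (hf : IsWarpingFunction R f)
    (hg : IsGeneralizedWarpedProduct R f h) {γ : ℝ → ℝ × Y} {J : Set ℝ}
    (hm : IsMaximalGeodesicIn (𝓘(ℝ, ℝ).prod (𝓡 m)) (warpedMetric f h) (Ioo 0 R ×ˢ univ) γ J)
    (h0 : (0 : ℝ) ∈ J) (hb : BddAbove J) (hb' : BddBelow J)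
    (hδ : 0 < δ) (hmin : ∀ t ∈ J, δ ≤ (γ t).1) {ρ : ℝ} (hρ : ρ < R) :
    ∃ t ∈ J, 0 < t ∧ ρ < (γ t).1 := by
  have hJ := exists_eq_Ioo hm.isOpen hm.ordConnected ⟨0, h0⟩ hb hb'
  have h0' := h0
  rw [hJ] at h0'
  obtain ⟨t, ht, hlt⟩ := ((hm.not_eventually_mem_isCompact (regularMetricOn_warpedMetric hf hg)
    (h0'.1.trans h0'.2) hJ (isCompact_Icc.prod isCompact_univ)
    (K := Icc δ ρ ×ˢ univ) (prod_mono (fun x hx => ⟨hδ.trans_le hx.1, hx.2.trans_lt hρ⟩)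
      subset_rfl)).and_eventually (Ioo_mem_nhdsLT h0'.2)).exists
  have htJ : t ∈ J := by rw [hJ]; exact ⟨h0'.1.trans hlt.1, hlt.2⟩
  refine ⟨t, htJ, hlt.1, ?_⟩
  by_contra hcon
  exact ht ⟨⟨hmin t htJ, not_lt.1 hcon⟩, mem_univ _⟩

theorem IsGeodesicFamily.exists_radius_gt (hf : IsWarpingFunction R f)
    (hg : IsGeneralizedWarpedProduct R f h) (hc : 0 ≤ c) (hbound : RadialVariationBound R c h)
    (hRc : R * c < 1) (hγ : IsGeodesicFamily R f h γ J) (hδ : δ ∈ Ioo 0 R) {ρ : ℝ} (hρ : ρ < R) :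
    (∃ t ∈ J δ, 0 < t ∧ ρ < (γ δ t).1) ∧ ∃ t ∈ J δ, t < 0 ∧ ρ < (γ δ t).1 := by
  have M := hγ.radialMotion hf hg hc hbound hδ
  have hm := hγ.maximalGeodesic δ hδ
  constructor
  · exact exists_radius_gt_of_maximal hf hg hm M.zero_mem (M.bddAbove hf hc hRc)
      (M.bddBelow hf hc hRc) hδ.1 M.min hρ
  · obtain ⟨t, ht, ht0, hr⟩ := exists_radius_gt_of_maximal hf hg hm.comp_neg M.comp_neg.zero_mem
      (M.comp_neg.bddAbove hf hc hRc) (M.comp_neg.bddBelow hf hc hRc) hδ.1 M.comp_neg.min hρ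
    exact ⟨-t, ht, by linarith, hr⟩

end Family

end WarpedGeodesics

namespace WarpedGeodesics

/-! ### The inverse function F and its derivative near zero. -/

section InverseFunction

variable {R : ℝ} {f : ℝ → ℝ} (hR : 0 < R) (hf : IsWarpingFunction R f)
include hf

namespace IsWarpingFunction

theorem inverse_apply {r : ℝ} (hr : r ∈ Ico 0 R) : inverse R f (f r) = r :=
  hf.strictMonoOn.injOn.leftInvOn_invFunOn hr

theorem continuousOn_deriv : ContinuousOn (deriv f) (Ioo 0 R) :=
  (hf.contDiffOn.mono Ioo_subset_Ico_self).continuousOn_deriv_of_isOpen isOpen_Ioo le_rfl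

theorem hasDerivAt_inverse {r : ℝ} (hr : r ∈ Ioo 0 R) :
    HasDerivAt (inverse R f) (deriv f r)⁻¹ (f r) := by
  have h1 : HasStrictDerivAt f (deriv f r) r :=
    (hf.contDiffOn.contDiffAt (Ico_mem_nhds hr.1 hr.2)).hasStrictDerivAt (by simp)
  refine (h1.to_local_left_inverse (hf.deriv_pos hr).ne' ?_).hasDerivAt
  filter_upwards [Ico_mem_nhds hr.1 hr.2] with x hx using hf.inverse_apply hx

theorem deriv_inverse {r : ℝ} (hr : r ∈ Ioo 0 R) : deriv (inverse R f) (f r) = (deriv f r)⁻¹ :=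
  (hf.hasDerivAt_inverse hr).deriv

theorem exists_eq_of_lt {ε ρ : ℝ} (hρ : ρ ∈ Ioo 0 R) (h0 : 0 < ε) (h1 : ε < f ρ) :
    ∃ r ∈ Ioo 0 ρ, f r = ε := by
  have h2 := intermediate_value_Ioo hρ.1.le (f := f) (hf.contDiffOn.continuousOn.mono
    fun x hx => ⟨hx.1, hx.2.trans_lt hρ.2⟩)
  rw [hf.zero] at h2
  exact h2 ⟨h0, h1⟩

include hR in
theorem tendsto_zero : Tendsto f (𝓝[>] 0) (𝓝[>] 0) := by
  have h1 : ContinuousWithinAt f (Ioo 0 R) 0 :=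
    (hf.contDiffOn.continuousOn 0 ⟨le_rfl, hR⟩).mono Ioo_subset_Ico_self
  refine tendsto_nhdsWithin_iff.2 ⟨?_, ?_⟩
  · rw [ContinuousWithinAt, nhdsWithin_Ioo_eq_nhdsGT hR, hf.zero] at h1
    exact h1
  · filter_upwards [Ioo_mem_nhdsGT hR] with r hr using hf.pos r hr

include hR in
theorem tendsto_inverse : Tendsto (inverse R f) (𝓝[>] 0) (𝓝[>] 0) := by
  refine (nhdsGT_basis (0 : ℝ)).tendsto_right_iff.2 fun ρ hρ => ?_
  have hρ' : min ρ (R / 2) ∈ Ioo 0 R := ⟨lt_min hρ (by linarith), by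
    have := min_le_right ρ (R / 2); linarith⟩
  filter_upwards [Ioo_mem_nhdsGT (hf.pos _ hρ')] with ε hε
  obtain ⟨r, hr, rfl⟩ := hf.exists_eq_of_lt hρ' hε.1 hε.2
  rw [hf.inverse_apply ⟨hr.1.le, hr.2.trans hρ'.2⟩]
  exact ⟨hr.1, hr.2.trans_le (min_le_left _ _)⟩

include hR in
/-- Small positive numbers are values of `f`. -/
theorem eventually_exists_eq : ∀ᶠ ε in 𝓝[>] (0 : ℝ), inverse R f ε ∈ Ioo 0 R ∧
    f (inverse R f ε) = ε := by
  have hρ' : R / 2 ∈ Ioo 0 R := ⟨by linarith, by linarith⟩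
  filter_upwards [Ioo_mem_nhdsGT (hf.pos _ hρ')] with ε hε
  obtain ⟨r, hr, rfl⟩ := hf.exists_eq_of_lt hρ' hε.1 hε.2
  have hr' : r ∈ Ioo 0 R := ⟨hr.1, hr.2.trans hρ'.2⟩
  rw [hf.inverse_apply ⟨hr.1.le, hr'.2⟩]
  exact ⟨hr', rfl⟩

include hR in
theorem exists_forall_mem_Ioo : ∃ e > 0, ∀ ε ∈ Ioo 0 e, ∃ r ∈ Ioo 0 R, f r = ε := by
  obtain ⟨e, he, h⟩ := mem_nhdsGT_iff_exists_Ioo_subset.1 (hf.eventually_exists_eq hR)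
  exact ⟨e, he, fun ε hε => ⟨_, (h hε).1, (h hε).2⟩⟩

theorem le_of_apply_le {a b : ℝ} (ha : a ∈ Ioo 0 R) (hb : b ∈ Ioo 0 R) (h : f a ≤ f b) : a ≤ b :=
  (hf.strictMonoOn.le_iff_le (Ioo_subset_Ico_self ha) (Ioo_subset_Ico_self hb)).1 h

theorem derivRatio_eq {a b σ : ℝ} (ha : a ∈ Ioo 0 R) (hb : b ∈ Ioo 0 R) (h : f b = σ * f a) :
    derivRatio R f (f a) σ = deriv f a / deriv f b := by
  rw [derivRatio, ← h, hf.deriv_inverse ha, hf.deriv_inverse hb, inv_div_inv]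

theorem deriv_inverse_pos {ε : ℝ} (h : ∃ r ∈ Ioo 0 R, f r = ε) : 0 < deriv (inverse R f) ε := by
  obtain ⟨r, hr, rfl⟩ := h
  rw [hf.deriv_inverse hr]; exact inv_pos.2 (hf.deriv_pos hr)

theorem deriv_inverse_anti {ε ε' : ℝ} (h : ∃ r ∈ Ioo 0 R, f r = ε) (h' : ∃ r ∈ Ioo 0 R, f r = ε')
    (hle : ε ≤ ε') : deriv (inverse R f) ε' ≤ deriv (inverse R f) ε := by
  obtain ⟨r, hr, rfl⟩ := h
  obtain ⟨r', hr', rfl⟩ := h'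
  rw [hf.deriv_inverse hr, hf.deriv_inverse hr']
  exact inv_anti₀ (hf.deriv_pos hr) (hf.monotoneOn_deriv hr hr' (hf.le_of_apply_le hr hr' hle))

/-- At ε = f(r) the left side is f(r)/f'(r), which is at most r by convexity. This bound rules out
geometric growth of ε F'(ε) in `inv_le_frakF`. -/
theorem mul_deriv_inverse_le {ε : ℝ} (h : ∃ r ∈ Ioo 0 R, f r = ε) :
    ε * deriv (inverse R f) ε ≤ R := by
  obtain ⟨r, hr, rfl⟩ := h
  rw [hf.deriv_inverse hr, ← div_eq_mul_inv, div_le_iff₀ (hf.deriv_pos hr)]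
  exact (hf.le_mul_deriv hr).trans
    (mul_le_mul_of_nonneg_right hr.2.le (hf.deriv_pos hr).le)

theorem continuousAt_deriv_inverse {ε e : ℝ} (he : ∀ ε ∈ Ioo 0 e, ∃ r ∈ Ioo 0 R, f r = ε)
    (hε : ε ∈ Ioo 0 e) : ContinuousAt (deriv (inverse R f)) ε := by
  have h1 : ∀ ε' ∈ Ioo 0 e, inverse R f ε' ∈ Ioo 0 R ∧ f (inverse R f ε') = ε' := fun ε' hε' => by
    obtain ⟨r, hr, rfl⟩ := he ε' hε'
    rw [hf.inverse_apply (Ioo_subset_Ico_self hr)]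
    exact ⟨hr, rfl⟩
  have h2 : deriv (inverse R f) =ᶠ[𝓝 ε] fun ε' => (deriv f (inverse R f ε'))⁻¹ := by
    filter_upwards [isOpen_Ioo.mem_nhds hε] with ε' hε'
    conv_lhs => rw [← (h1 ε' hε').2]
    exact hf.deriv_inverse (h1 ε' hε').1
  refine ContinuousAt.congr ?_ h2.symm
  have h3 : ContinuousAt (inverse R f) ε := by
    conv_rhs => rw [← (h1 ε hε).2]
    exact (hf.hasDerivAt_inverse (h1 ε hε).1).continuousAt
  refine ContinuousAt.inv₀ ?_ (hf.deriv_pos (h1 ε hε).1).ne'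
  exact ContinuousAt.comp (g := deriv f)
    (hf.continuousOn_deriv.continuousAt (isOpen_Ioo.mem_nhds (h1 ε hε).1)) h3

include hR in
theorem tendsto_deriv : Tendsto (deriv f) (𝓝[>] 0) (𝓝 (derivWithin f (Ico 0 R) 0)) := by
  have h1 : ContinuousWithinAt (derivWithin f (Ico 0 R)) (Ioo 0 R) 0 :=
    (hf.contDiffOn.continuousOn_derivWithin (uniqueDiffOn_Ico 0 R) le_rfl 0 ⟨le_rfl, hR⟩).mono
      Ioo_subset_Ico_self
  rw [ContinuousWithinAt, nhdsWithin_Ioo_eq_nhdsGT hR] at h1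
  refine h1.congr' ?_
  filter_upwards [Ioo_mem_nhdsGT hR] with r hr
  exact derivWithin_of_mem_nhds (Ico_mem_nhds hr.1 hr.2)

end IsWarpingFunction

end InverseFunction

/-! ### Bounds for the limit function 𝔉. -/

section FrakF

variable {R : ℝ} {f : ℝ → ℝ} (hR : 0 < R) (hf : IsWarpingFunction R f)

theorem tendsto_const_mul_nhdsGT {σ : ℝ} (hσ : 0 < σ) :
    Tendsto (fun ε => σ * ε) (𝓝[>] 0) (𝓝[>] 0) := by
  refine tendsto_nhdsWithin_iff.2 ⟨?_, ?_⟩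
  · have : Tendsto (fun ε => σ * ε) (𝓝 0) (𝓝 (σ * 0)) := (continuous_const_mul σ).tendsto 0
    rw [mul_zero] at this
    exact this.mono_left nhdsWithin_le_nhds
  · filter_upwards [self_mem_nhdsWithin] with ε hε using mul_pos hσ hε

include hR hf

theorem eventually_derivRatio_pos {σ : ℝ} (hσ : 1 ≤ σ) :
    ∀ᶠ ε in 𝓝[>] 0, 0 < derivRatio R f ε σ ∧ derivRatio R f ε σ ≤ 1 := by
  obtain ⟨e, he, h⟩ := hf.exists_forall_mem_Ioo hR
  have h0 : (0 : ℝ) < σ := by linarith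
  filter_upwards [Ioo_mem_nhdsGT he, tendsto_const_mul_nhdsGT h0 (Ioo_mem_nhdsGT he)] with ε h1 h2
  have h3 := hf.deriv_inverse_pos (h _ h1)
  refine ⟨div_pos (hf.deriv_inverse_pos (h _ h2)) h3, (div_le_one h3).2 ?_⟩
  exact hf.deriv_inverse_anti (h _ h1) (h _ h2) (le_mul_of_one_le_left h1.1.le hσ)

variable (hF : FrakFExists R f)
include hF

theorem frakF_le_one {σ : ℝ} (hσ : 1 ≤ σ) : frakF R f σ ≤ 1 :=
  le_of_tendsto (hF σ hσ) ((eventually_derivRatio_pos hR hf hσ).mono fun _ h => h.2)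

theorem antitoneOn_frakF : AntitoneOn (frakF R f) (Ici 1) := by
  intro σ hσ τ hτ hle
  obtain ⟨e, he, h⟩ := hf.exists_forall_mem_Ioo hR
  have h0 : (0 : ℝ) < σ := lt_of_lt_of_le one_pos hσ
  have h0' : (0 : ℝ) < τ := lt_of_lt_of_le one_pos hτ
  refine le_of_tendsto_of_tendsto (hF τ hτ) (hF σ hσ) ?_
  filter_upwards [Ioo_mem_nhdsGT he, tendsto_const_mul_nhdsGT h0 (Ioo_mem_nhdsGT he),
    tendsto_const_mul_nhdsGT h0' (Ioo_mem_nhdsGT he)] with ε h1 h2 h3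
  exact div_le_div_of_nonneg_right (hf.deriv_inverse_anti (h _ h2) (h _ h3)
    (mul_le_mul_of_nonneg_right hle h1.1.le)) (hf.deriv_inverse_pos (h _ h1)).le

theorem frakF_one : frakF R f 1 = 1 := by
  refine tendsto_nhds_unique (hF 1 le_rfl) (tendsto_const_nhds.congr' ?_)
  obtain ⟨e, he, h⟩ := hf.exists_forall_mem_Ioo hR
  filter_upwards [Ioo_mem_nhdsGT he] with ε h1
  rw [derivRatio, one_mul, div_self (hf.deriv_inverse_pos (h _ h1)).ne']

omit hR hf hF in
theorem pow_mul_le_of_geometric {q : ℝ → ℝ} {σ k e : ℝ} (hσ : 1 ≤ σ) (hk : 0 ≤ k)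
    (h : ∀ ε, 0 < ε → ε < e → k * q ε ≤ q (σ⁻¹ * ε)) (n : ℕ) {ε : ℝ} (h0 : 0 < ε) (h1 : ε < e) :
    k ^ n * q ε ≤ q (σ⁻¹ ^ n * ε) := by
  have hs : 0 < σ⁻¹ := by positivity
  induction n with
  | zero => simp
  | succ n ih =>
    have h2 : σ⁻¹ ^ n ≤ 1 := pow_le_one₀ hs.le (inv_le_one_of_one_le₀ hσ)
    have h3 := h (σ⁻¹ ^ n * ε) (by positivity) (by nlinarith)
    calc k ^ (n + 1) * q ε = k * (k ^ n * q ε) := by ring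
      _ ≤ k * q (σ⁻¹ ^ n * ε) := mul_le_mul_of_nonneg_left ih hk
      _ ≤ _ := h3
      _ = _ := by congr 1; ring

/-- Otherwise F'(σε) < k F'(ε) with k σ < 1 for all small ε, so ε F'(ε) would be multiplied by at
least (kσ)⁻¹ > 1 each time ε is divided by σ, contradicting ε F'(ε) ≤ R. -/
theorem inv_le_frakF {σ : ℝ} (hσ : 1 ≤ σ) : σ⁻¹ ≤ frakF R f σ := by
  by_contra! hcon
  have h0 : (0 : ℝ) < σ := by linarith
  obtain ⟨e, he, h⟩ := hf.exists_forall_mem_Ioo hR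
  -- Any number strictly between 𝔉(σ) and 1/σ: above 𝔉(σ) so that the ratio is eventually below it,
  -- below 1/σ so that (kσ)⁻¹ > 1.
  obtain ⟨k, hk1, hk2⟩ := exists_between hcon
  have hk0 : 0 < k := lt_of_le_of_lt (ge_of_tendsto (hF σ hσ)
    ((eventually_derivRatio_pos hR hf hσ).mono fun _ h => h.1.le)) hk1
  have hev := (hF σ hσ).eventually (gt_mem_nhds hk1)
  obtain ⟨e', he', h'⟩ := mem_nhdsGT_iff_exists_Ioo_subset.1 hev
  have hkσ : 1 < (k * σ)⁻¹ := (one_lt_inv₀ (by positivity)).2 (by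
    rwa [lt_inv_comm₀ hk0 h0, lt_inv_comm₀ h0 hk0, ← one_div, lt_div_iff₀ h0] at hk2)
  have hstep : ∀ ε, 0 < ε → ε < min e e' → (k * σ)⁻¹ * (ε * deriv (inverse R f) ε) ≤
      (σ⁻¹ * ε) * deriv (inverse R f) (σ⁻¹ * ε) := by
    intro ε hε hlt
    have h1 : σ⁻¹ * ε ≤ ε := mul_le_of_le_one_left hε.le (inv_le_one_of_one_le₀ hσ)
    have h2 : σ⁻¹ * ε ∈ Ioo 0 (min e e') := ⟨by positivity, h1.trans_lt hlt⟩
    have h3 := h' ⟨h2.1, h2.2.trans_le (min_le_right _ _)⟩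
    have h4 := hf.deriv_inverse_pos (h (σ⁻¹ * ε) ⟨h2.1, h2.2.trans_le (min_le_left _ _)⟩)
    simp only [mem_ofPred_eq, derivRatio] at h3
    rw [mul_inv_cancel_left₀ h0.ne', div_lt_iff₀ h4] at h3
    rw [mul_inv, mul_comm k⁻¹, mul_assoc, mul_assoc]
    refine mul_le_mul_of_nonneg_left ?_ (by positivity)
    rw [mul_left_comm]
    refine mul_le_mul_of_nonneg_left ?_ hε.le
    rw [inv_mul_le_iff₀ hk0]
    exact h3.le
  have hem : 0 < min e e' := lt_min he he'
  set ε := min e e' / 2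
  have hε : 0 < ε := by positivity
  have hε' : ε < min e e' := half_lt_self hem
  have hq : 0 < ε * deriv (inverse R f) ε :=
    mul_pos hε (hf.deriv_inverse_pos (h ε ⟨hε, hε'.trans_le (min_le_left _ _)⟩))
  obtain ⟨n, hn⟩ := ((tendsto_pow_atTop_atTop_of_one_lt hkσ).eventually_gt_atTop
    (R / (ε * deriv (inverse R f) ε))).exists
  rw [div_lt_iff₀ hq] at hn
  have h5 := pow_mul_le_of_geometric (q := fun ε => ε * deriv (inverse R f) ε) hσ
    (by positivity) hstep n hε hε'
  have h6 : σ⁻¹ ^ n * ε ≤ ε :=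
    mul_le_of_le_one_left hε.le (pow_le_one₀ (by positivity) (inv_le_one_of_one_le₀ hσ))
  have h7 := hf.mul_deriv_inverse_le (h (σ⁻¹ ^ n * ε)
    ⟨by positivity, (h6.trans_lt hε').trans_le (min_le_left _ _)⟩)
  linarith

theorem frakF_pos {σ : ℝ} (hσ : 1 ≤ σ) : 0 < frakF R f σ :=
  lt_of_lt_of_le (by positivity) (inv_le_frakF hR hf hF hσ)

omit hF in
-- F' has the finite nonzero limit 1/f'(0) at zero, so the quotients tend to 1.
theorem frakF_eq_one_of_conical (h : 0 < derivWithin f (Ico 0 R) 0) {σ : ℝ} (hσ : 1 ≤ σ) :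
    frakF R f σ = 1 := by
  have h0 : (0 : ℝ) < σ := by linarith
  have h1 : Tendsto (deriv (inverse R f)) (𝓝[>] 0) (𝓝 (derivWithin f (Ico 0 R) 0)⁻¹) := by
    refine (((hf.tendsto_deriv hR).comp (hf.tendsto_inverse hR)).inv₀ h.ne').congr' ?_
    filter_upwards [hf.eventually_exists_eq hR] with ε hε
    simp only [Function.comp]
    rw [← hf.deriv_inverse hε.1, hε.2]
  have h2 := (h1.comp (tendsto_const_mul_nhdsGT h0)).div h1 (inv_pos.2 h).ne'
  rw [div_self (inv_pos.2 h).ne'] at h2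
  exact h2.limUnder_eq

end FrakF

end WarpedGeodesics

/-! ### The constant C_f: integrability and bounds. -/

namespace WarpedGeodesics

theorem one_le_one_div_cos {ϑ : ℝ} (h : ϑ ∈ Ioo (-(Real.pi / 2)) (Real.pi / 2)) :
    1 ≤ 1 / Real.cos ϑ :=
  (one_le_div (Real.cos_pos_of_mem_Ioo h)).2 (Real.cos_le_one ϑ)

theorem neg_pi_div_two_le : -(Real.pi / 2) ≤ Real.pi / 2 := by linarith [Real.pi_pos]

/-- Allows the right endpoint to be ignored. At ϑ = π/2 the expression `1 / cos ϑ` has the default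
value 0, where nothing is known about 𝔉. -/
theorem ae_restrict_uIoc_of_Ioo {p : ℝ → Prop} {a b : ℝ} (hab : a ≤ b)
    (h : ∀ x ∈ Ioo a b, p x) : ∀ᵐ x, x ∈ uIoc a b → p x := by
  rw [uIoc_of_le hab]
  filter_upwards [(show ({b} : Set ℝ)ᶜ ∈ ae volume from compl_mem_ae_iff.2 (measure_singleton b))]
    with x hx hx'
  exact h x ⟨hx'.1, lt_of_le_of_ne hx'.2 hx⟩

section AngularConst

variable {R : ℝ} {f : ℝ → ℝ} (hR : 0 < R) (hf : IsWarpingFunction R f) (hF : FrakFExists R f)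
include hR hf hF

/-- 𝔉 is antitone on [1, ∞), and truncating the argument at 1 extends it to an antitone, hence
measurable, function on the line. -/
theorem measurable_frakF_max : Measurable fun σ => frakF R f (max 1 σ) := by
  refine Antitone.measurable fun a b hab => ?_
  exact antitoneOn_frakF hR hf hF (le_max_left 1 a) (le_max_left 1 b) (max_le_max le_rfl hab)

theorem intervalIntegrable_frakF :
    IntervalIntegrable (fun ϑ => frakF R f (1 / Real.cos ϑ)) volume
      (-(Real.pi / 2)) (Real.pi / 2) := by
  have hm : Measurable fun ϑ => frakF R f (max 1 (1 / Real.cos ϑ)) :=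
    (measurable_frakF_max hR hf hF).comp (measurable_const.div Real.measurable_cos)
  have h1 : IntervalIntegrable (fun ϑ => frakF R f (max 1 (1 / Real.cos ϑ))) volume
      (-(Real.pi / 2)) (Real.pi / 2) := by
    refine (intervalIntegrable_const (c := (1 : ℝ))).mono_fun hm.aestronglyMeasurable
      (Eventually.of_forall fun ϑ => ?_)
    have h2 := (frakF_pos hR hf hF (le_max_left 1 (1 / Real.cos ϑ))).le
    simp only [Real.norm_eq_abs, abs_one, abs_of_nonneg h2]
    exact frakF_le_one hR hf hF (le_max_left _ _)
  refine h1.congr_ae ?_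
  rw [Filter.EventuallyEq, ae_restrict_iff' measurableSet_uIoc]
  refine ae_restrict_uIoc_of_Ioo neg_pi_div_two_le fun ϑ hϑ => ?_
  rw [max_eq_right (one_le_one_div_cos hϑ)]

/-- By `inv_le_frakF` the integrand is at least cos ϑ, whose integral is 2. -/
theorem two_le_angularConst : 2 ≤ angularConst R f := by
  have h1 : ∫ ϑ in (-(Real.pi / 2))..(Real.pi / 2), Real.cos ϑ = 2 := by
    rw [integral_cos, Real.sin_neg, Real.sin_pi_div_two]; norm_num
  rw [← h1]
  refine intervalIntegral.integral_mono_on_of_le_Ioo neg_pi_div_two_le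
    (Real.continuous_cos.intervalIntegrable _ _) (intervalIntegrable_frakF hR hf hF) fun ϑ hϑ => ?_
  have := inv_le_frakF hR hf hF (one_le_one_div_cos hϑ)
  rwa [one_div, inv_inv, ← one_div] at this

theorem angularConst_le_pi : angularConst R f ≤ Real.pi := by
  have h1 : ∫ ϑ in (-(Real.pi / 2))..(Real.pi / 2), (1 : ℝ) = Real.pi := by simp
  refine le_of_le_of_eq ?_ h1
  exact intervalIntegral.integral_mono_on_of_le_Ioo neg_pi_div_two_le
    (intervalIntegrable_frakF hR hf hF) intervalIntegrable_const fun ϑ hϑ =>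
    frakF_le_one hR hf hF (one_le_one_div_cos hϑ)

omit hF in
theorem angularConst_eq_pi_of_conical (h : 0 < derivWithin f (Ico 0 R) 0) :
    angularConst R f = Real.pi := by
  have h1 : ∫ ϑ in (-(Real.pi / 2))..(Real.pi / 2), (1 : ℝ) = Real.pi := by simp
  rw [← h1, angularConst]
  exact intervalIntegral.integral_congr_ae (ae_restrict_uIoc_of_Ioo neg_pi_div_two_le fun ϑ hϑ =>
    frakF_eq_one_of_conical hR hf h (one_le_one_div_cos hϑ))

end AngularConst

/-! ### Power functions. -/

section Powers

variable {R α : ℝ} (hR : 0 < R) (hα : 1 ≤ α)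

theorem isWarpingFunction_rpow (R : ℝ) (hα : 1 ≤ α) : IsWarpingFunction R fun x => x ^ α where
  contDiffOn := (Real.contDiff_rpow_const_of_le (by simpa using hα)).contDiffOn
  pos r hr := Real.rpow_pos_of_pos hr.1 α
  zero := Real.zero_rpow (by linarith)
  convexOn := (convexOn_rpow hα).subset (fun _ hx => hx.1) (convex_Ico 0 R)

include hR hα

/-- F' is a multiple of the power ε^{1/α − 1}, so the ratio does not depend on ε at all once ε and S
ε lie in the range of the function. This is why uniformity is immediate. -/
theorem derivRatio_rpow_eventuallyEq (S : ℝ) : ∀ᶠ ε in 𝓝[>] (0 : ℝ), ∀ σ ∈ Icc 1 S,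
    derivRatio R (fun x => x ^ α) ε σ = σ ^ (α⁻¹ - 1) := by
  have hf := isWarpingFunction_rpow R hα
  have hα0 : 0 < α := by linarith
  rcases lt_or_ge S 1 with hS | hS
  · exact Eventually.of_forall fun ε σ hσ => absurd (hσ.1.trans hσ.2) (not_le.2 hS)
  obtain ⟨e, he, h⟩ := hf.exists_forall_mem_Ioo hR
  filter_upwards [Ioo_mem_nhdsGT he,
    tendsto_const_mul_nhdsGT (lt_of_lt_of_le one_pos hS) (Ioo_mem_nhdsGT he)] with ε h1 h2 σ hσ
  have hσ0 : 0 < σ := by linarith [hσ.1]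
  obtain ⟨a, ha, rfl⟩ := h ε h1
  obtain ⟨b, hb, hb'⟩ := h (σ * a ^ α) ⟨mul_pos hσ0 h1.1,
    (mul_le_mul_of_nonneg_right hσ.2 h1.1.le).trans_lt h2.2⟩
  have hd : ∀ r ∈ Ioo 0 R, deriv (fun x : ℝ => x ^ α) r = α * r ^ (α - 1) := fun r hr =>
    Real.deriv_rpow_const r α
  have hba : b = σ ^ α⁻¹ * a := by
    have : b = (b ^ α) ^ α⁻¹ := by rw [← Real.rpow_mul hb.1.le, mul_inv_cancel₀ hα0.ne', Real.rpow_one]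
    rw [this, hb', Real.mul_rpow hσ0.le (Real.rpow_nonneg ha.1.le _), ← Real.rpow_mul ha.1.le,
      mul_inv_cancel₀ hα0.ne', Real.rpow_one]
  rw [hf.derivRatio_eq ha hb hb', hd a ha, hd b hb, hba,
    Real.mul_rpow (Real.rpow_nonneg hσ0.le _) ha.1.le, ← Real.rpow_mul hσ0.le]
  have h3 : 0 < a ^ (α - 1) := Real.rpow_pos_of_pos ha.1 _
  have h4 : 0 < σ ^ (α⁻¹ * (α - 1)) := Real.rpow_pos_of_pos hσ0 _
  rw [mul_div_mul_left _ _ hα0.ne', div_mul_cancel_right₀ h3.ne', ← Real.rpow_neg hσ0.le]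
  congr 1
  field_simp
  ring

theorem frakF_rpow {σ : ℝ} (hσ : 1 ≤ σ) : frakF R (fun x => x ^ α) σ = σ ^ (α⁻¹ - 1) := by
  refine Tendsto.limUnder_eq (tendsto_const_nhds.congr' ?_)
  filter_upwards [derivRatio_rpow_eventuallyEq hR hα σ] with ε h using (h σ ⟨hσ, le_rfl⟩).symm

theorem nonOscillation_rpow : NonOscillation R fun x => x ^ α := by
  refine ⟨fun σ hσ => ?_, fun K hK hKc => ?_⟩
  · rw [frakF_rpow hR hα hσ]
    refine tendsto_const_nhds.congr' ?_
    filter_upwards [derivRatio_rpow_eventuallyEq hR hα σ] with ε h using (h σ ⟨hσ, le_rfl⟩).symm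
  · obtain ⟨S, hS⟩ := hKc.bddAbove
    intro u hu
    filter_upwards [derivRatio_rpow_eventuallyEq hR hα S] with ε h σ hσ
    rw [h σ ⟨hK hσ, hS hσ⟩, frakF_rpow hR hα (hK hσ)]
    exact refl_mem_uniformity hu

omit hα in
-- The exponent α⁻¹ − 1 tends to −1, so the integrand tends to cos ϑ while being bounded by 1.
theorem tendsto_angularConst_rpow :
    Tendsto (fun α : ℝ => angularConst R fun x => x ^ α) atTop (𝓝 2) := by
  have h1 : ∫ ϑ in (-(Real.pi / 2))..(Real.pi / 2), Real.cos ϑ = 2 := by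
    rw [integral_cos, Real.sin_neg, Real.sin_pi_div_two]; norm_num
  rw [← h1]
  refine intervalIntegral.tendsto_integral_filter_of_dominated_convergence (fun _ => 1) ?_ ?_
    intervalIntegrable_const ?_
  · filter_upwards [eventually_ge_atTop 1] with α hα
    have := (intervalIntegrable_frakF hR (isWarpingFunction_rpow R hα)
      (nonOscillation_rpow hR hα).1).aestronglyMeasurable
    rwa [uIoc_of_le neg_pi_div_two_le]
  · filter_upwards [eventually_ge_atTop 1] with α hα
    refine ae_restrict_uIoc_of_Ioo neg_pi_div_two_le fun ϑ hϑ => ?_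
    have hF := (nonOscillation_rpow hR hα).1
    have hf := isWarpingFunction_rpow R hα
    rw [Real.norm_eq_abs, abs_of_pos (frakF_pos hR hf hF (one_le_one_div_cos hϑ))]
    exact frakF_le_one hR hf hF (one_le_one_div_cos hϑ)
  · refine ae_restrict_uIoc_of_Ioo neg_pi_div_two_le fun ϑ hϑ => ?_
    have h2 := one_le_one_div_cos hϑ
    have h3 : Tendsto (fun α : ℝ => (1 / Real.cos ϑ) ^ (α⁻¹ - 1)) atTop
        (𝓝 ((1 / Real.cos ϑ) ^ ((0 : ℝ) - 1))) :=
      ((Real.continuousAt_const_rpow (lt_of_lt_of_le one_pos h2).ne').tendsto).comp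
        ((tendsto_inv_atTop_zero (𝕜 := ℝ)).sub_const 1)
    rw [zero_sub, Real.rpow_neg_one, one_div, inv_inv] at h3
    refine h3.congr' ?_
    filter_upwards [eventually_ge_atTop 1] with α hα
    rw [← one_div, frakF_rpow hR hα h2]

end Powers

/-! ### Comparison of two warping functions. -/

section Comparison

variable {R₁ R₂ : ℝ} {f₁ f₂ : ℝ → ℝ} (hR₁ : 0 < R₁) (hR₂ : 0 < R₂)
  (hf₁ : IsWarpingFunction R₁ f₁) (hf₂ : IsWarpingFunction R₂ f₂)

theorem le_of_antitoneOn_of_tendsto {g : ℝ → ℝ} {e : ℝ} (hg : AntitoneOn g (Ioo 0 e))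
    (h0 : Tendsto g (𝓝[>] 0) (𝓝 0)) {ε : ℝ} (hε : ε ∈ Ioo 0 e) : g ε ≤ 0 := by
  refine ge_of_tendsto h0 ?_
  filter_upwards [Ioo_mem_nhdsGT hε.1] with s hs
  exact hg ⟨hs.1, hs.2.trans hε.2⟩ hε hs.2.le

include hR₁ hR₂ hf₁ hf₂

/-- If `f₁ = O(f₂)`, then `F₁' / F₂'` does not tend to zero. -/
theorem frequently_deriv_inverse_gt (hO : f₁ =O[𝓝[>] 0] f₂) :
    ∃ η > 0, ∃ᶠ ε in 𝓝[>] 0, η * deriv (inverse R₂ f₂) ε < deriv (inverse R₁ f₁) ε := by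
  obtain ⟨C, hC, hO⟩ := hO.exists_pos
  set D := max C 1 with hD
  have hD1 : 1 ≤ D := le_max_right _ _
  -- If F₁' ≤ F₂'/(2D) near zero, then F₁ ≤ F₂/(2D), as both functions tend to zero. The factor 2
  -- contradicts F₁ ≥ F₂/D at a suitable value, which is obtained below from f₁ = O(f₂).
  refine ⟨(2 * D)⁻¹, by positivity, fun hcon => ?_⟩
  simp only [not_lt] at hcon
  obtain ⟨e, he, hcon⟩ := mem_nhdsGT_iff_exists_Ioo_subset.1 hcon
  obtain ⟨e₁, he₁, h₁⟩ := hf₁.exists_forall_mem_Ioo hR₁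
  obtain ⟨e₂, he₂, h₂⟩ := hf₂.exists_forall_mem_Ioo hR₂
  have he' : 0 < min e (min e₁ e₂) := lt_min he (lt_min he₁ he₂)
  have hd : ∀ {R : ℝ} {f : ℝ → ℝ}, IsWarpingFunction R f → ∀ {ε}, (∃ r ∈ Ioo 0 R, f r = ε) →
      HasDerivAt (inverse R f) (deriv (inverse R f) ε) ε := by
    rintro R f hf _ ⟨r, hr, rfl⟩
    rw [hf.deriv_inverse hr]; exact hf.hasDerivAt_inverse hr
  have hle : ∀ ε ∈ Ioo 0 (min e (min e₁ e₂)),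
      inverse R₁ f₁ ε ≤ (2 * D)⁻¹ * inverse R₂ f₂ ε := by
    intro ε hε
    have hanti := antitoneOn_of_hasDerivAt_nonpos (convex_Ioo 0 (min e (min e₁ e₂)))
      (fun ε hε => (hd hf₁ (h₁ ε ⟨hε.1, hε.2.trans_le ((min_le_right _ _).trans
        (min_le_left _ _))⟩)).sub ((hd hf₂ (h₂ ε ⟨hε.1, hε.2.trans_le ((min_le_right _ _).trans
        (min_le_right _ _))⟩)).const_mul (2 * D)⁻¹)) (fun ε hε =>
        sub_nonpos.2 (hcon ⟨hε.1, hε.2.trans_le (min_le_left _ _)⟩))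
    have h0 := ((hf₁.tendsto_inverse hR₁).mono_right nhdsWithin_le_nhds).sub
      (((hf₂.tendsto_inverse hR₂).mono_right nhdsWithin_le_nhds).const_mul (2 * D)⁻¹)
    rw [mul_zero, sub_zero] at h0
    exact sub_nonpos.1 (le_of_antitoneOn_of_tendsto hanti h0 hε)
  have hD0 : 0 < D := by linarith
  have hD' := tendsto_const_mul_nhdsGT (inv_pos.2 hD0)
  obtain ⟨b, ⟨⟨hO, hb₂⟩, hb₁⟩, hfb⟩ := (((hD'.eventually hO.bound).and (Ioo_mem_nhdsGT hR₂)).and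
    (hD'.eventually (Ioo_mem_nhdsGT hR₁))).and
    ((hf₂.tendsto_zero hR₂).eventually (Ioo_mem_nhdsGT he')) |>.exists
  have ha₂ : D⁻¹ * b ∈ Ioo 0 R₂ := ⟨hb₁.1, lt_of_le_of_lt
    (mul_le_of_le_one_left hb₂.1.le (inv_le_one_of_one_le₀ hD1)) hb₂.2⟩
  -- As D ≥ 1, convexity and f₂(0) = 0 give f₂(b/D) ≤ f₂(b)/D; this absorbs the constant of the
  -- O-bound into the argument, so that f₁(b/D) ≤ f₂(b).
  have hconv := hf₂.convexOn.2 (show (0 : ℝ) ∈ Ico 0 R₂ from ⟨le_rfl, hR₂⟩)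
    (Ioo_subset_Ico_self hb₂) (sub_nonneg.2 (inv_le_one_of_one_le₀ hD1)) (inv_pos.2 hD0).le
    (sub_add_cancel 1 D⁻¹)
  simp only [smul_eq_mul, mul_zero, zero_add, hf₂.zero] at hconv
  have h3 : f₁ (D⁻¹ * b) ≤ f₂ b := by
    have h4 : ‖f₁ (D⁻¹ * b)‖ ≤ C * ‖f₂ (D⁻¹ * b)‖ := hO
    rw [Real.norm_eq_abs, Real.norm_eq_abs, abs_of_pos (hf₂.pos _ ha₂)] at h4
    calc f₁ (D⁻¹ * b) ≤ C * f₂ (D⁻¹ * b) := (le_abs_self _).trans h4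
      _ ≤ D * f₂ (D⁻¹ * b) := mul_le_mul_of_nonneg_right (le_max_left _ _) (hf₂.pos _ ha₂).le
      _ ≤ D * (D⁻¹ * f₂ b) := mul_le_mul_of_nonneg_left hconv hD0.le
      _ = f₂ b := mul_inv_cancel_left₀ hD0.ne' _
  -- Here a' = F₁(f₂(b)), which is at least b/D by the previous inequality and at most b/(2D) by
  -- `hle`.
  obtain ⟨a', ha', hfa⟩ := h₁ (f₂ b) ⟨hfb.1, hfb.2.trans_le ((min_le_right _ _).trans
    (min_le_left _ _))⟩
  have h5 := hle (f₂ b) hfb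
  rw [hf₂.inverse_apply (Ioo_subset_Ico_self hb₂), ← hfa,
    hf₁.inverse_apply (Ioo_subset_Ico_self ha')] at h5
  rw [← hfa] at h3
  have h6 := hf₁.le_of_apply_le hb₁ ha' h3
  have h7 : (2 * D)⁻¹ * b = (D⁻¹ * b) / 2 := by rw [mul_inv]; ring
  rw [h7] at h5
  linarith [hb₁.1]

/-- If 𝔉₁(σ) > 𝔉₂(σ), the quotient F₂'/F₁' grows by a factor k > 1 whenever ε is divided by σ, hence
tends to infinity at zero. This contradicts `frequently_deriv_inverse_gt`. -/
theorem frakF_le_of_isBigO (hF₁ : FrakFExists R₁ f₁) (hF₂ : FrakFExists R₂ f₂)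
    (hO : f₁ =O[𝓝[>] 0] f₂) {σ : ℝ} (hσ : 1 ≤ σ) : frakF R₁ f₁ σ ≤ frakF R₂ f₂ σ := by
  by_contra! hcon
  have hσ1 : 1 < σ := by
    refine lt_of_le_of_ne hσ fun h => ?_
    rw [← h, frakF_one hR₁ hf₁ hF₁, frakF_one hR₂ hf₂ hF₂] at hcon
    exact lt_irrefl _ hcon
  have h0 : (0 : ℝ) < σ := by linarith
  have hp := frakF_pos hR₂ hf₂ hF₂ hσ
  obtain ⟨k, hk1, hk2⟩ := exists_between ((one_lt_div hp).2 hcon)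
  obtain ⟨η, hη, hfreq⟩ := frequently_deriv_inverse_gt hR₁ hR₂ hf₁ hf₂ hO
  obtain ⟨e₁, he₁, h₁⟩ := hf₁.exists_forall_mem_Ioo hR₁
  obtain ⟨e₂, he₂, h₂⟩ := hf₂.exists_forall_mem_Ioo hR₂
  obtain ⟨e, he, h⟩ := mem_nhdsGT_iff_exists_Ioo_subset.1
    (((hF₁ σ hσ).div (hF₂ σ hσ) hp.ne').eventually (lt_mem_nhds hk2))
  obtain ⟨e', he', hlt⟩ := exists_between (lt_min he (lt_min he₁ he₂))
  have hlt₀ : e' < e := hlt.trans_le (min_le_left _ _)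
  have hlt₁ : e' < e₁ := hlt.trans_le ((min_le_right _ _).trans (min_le_left _ _))
  have hlt₂ : e' < e₂ := hlt.trans_le ((min_le_right _ _).trans (min_le_right _ _))
  have hp₁ : ∀ ε ∈ Ioc 0 e', 0 < deriv (inverse R₁ f₁) ε := fun ε hε =>
    hf₁.deriv_inverse_pos (h₁ ε ⟨hε.1, hε.2.trans_lt hlt₁⟩)
  have hp₂ : ∀ ε ∈ Ioc 0 e', 0 < deriv (inverse R₂ f₂) ε := fun ε hε =>
    hf₂.deriv_inverse_pos (h₂ ε ⟨hε.1, hε.2.trans_lt hlt₂⟩)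
  set q := fun ε => deriv (inverse R₂ f₂) ε / deriv (inverse R₁ f₁) ε with hq
  have hsm : ∀ {ε : ℝ}, 0 < ε → σ⁻¹ * ε ≤ ε := fun hε =>
    mul_le_of_le_one_left hε.le (inv_le_one_of_one_le₀ hσ)
  have hstep : ∀ ε, 0 < ε → ε < min e (min e₁ e₂) → k * q ε ≤ q (σ⁻¹ * ε) := by
    intro ε hε hεe
    have hm : σ⁻¹ * ε ∈ Ioo 0 (min e (min e₁ e₂)) := ⟨by positivity, (hsm hε).trans_lt hεe⟩
    have g1 := h ⟨hm.1, hm.2.trans_le (min_le_left _ _)⟩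
    have a1 := hf₁.deriv_inverse_pos (h₁ _ ⟨hm.1, hm.2.trans_le ((min_le_right _ _).trans
      (min_le_left _ _))⟩)
    have a2 := hf₂.deriv_inverse_pos (h₂ _ ⟨hm.1, hm.2.trans_le ((min_le_right _ _).trans
      (min_le_right _ _))⟩)
    have b1 := hf₁.deriv_inverse_pos (h₁ _ ⟨hε, hεe.trans_le ((min_le_right _ _).trans
      (min_le_left _ _))⟩)
    have b2 := hf₂.deriv_inverse_pos (h₂ _ ⟨hε, hεe.trans_le ((min_le_right _ _).trans
      (min_le_right _ _))⟩)
    simp only [mem_ofPred_eq, derivRatio, mul_inv_cancel_left₀ h0.ne', Pi.div_apply] at g1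
    have g2 : deriv (inverse R₁ f₁) ε / deriv (inverse R₁ f₁) (σ⁻¹ * ε) /
        (deriv (inverse R₂ f₂) ε / deriv (inverse R₂ f₂) (σ⁻¹ * ε)) = q (σ⁻¹ * ε) / q ε := by
      simp only [hq]; field_simp
    rw [g2, lt_div_iff₀ (div_pos b2 b1)] at g1
    exact g1.le
  have hes : σ⁻¹ * e' ∈ Ioc 0 e' := ⟨by positivity, hsm he'⟩
  -- A lower bound for `q` on the whole interval [e'/σ, e'], by monotonicity of F₁' and F₂' alone.
  -- It gives the geometric growth a common starting value.
  set q₀ := deriv (inverse R₂ f₂) e' / deriv (inverse R₁ f₁) (σ⁻¹ * e') with hq₀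
  have hq₀pos : 0 < q₀ := div_pos (hp₂ e' ⟨he', le_rfl⟩) (hp₁ _ hes)
  obtain ⟨N, hN⟩ := ((tendsto_pow_atTop_atTop_of_one_lt hk1).eventually_gt_atTop
    (η⁻¹ / q₀)).exists
  have hδ : 0 < e' / σ ^ (N + 1) := by positivity
  obtain ⟨ε, hε, hεs⟩ := (hfreq.and_eventually (Ioo_mem_nhdsGT hδ)).exists
  have hεσ : σ ^ (N + 1) < e' / ε := by
    rw [lt_div_iff₀ hεs.1, mul_comm]; exact (lt_div_iff₀ (by positivity)).1 hεs.2
  -- Choose n with σⁿ ε ≤ e' < σⁿ⁺¹ ε, so that σⁿ ε lies in the interval where `q₀` is a lower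
  -- bound; ε was taken so small that n ≥ N.
  obtain ⟨n, hn1, hn2⟩ := exists_nat_pow_near ((one_le_pow₀ hσ).trans hεσ.le) hσ1
  have hNn : N ≤ n := by
    have := (pow_lt_pow_iff_right₀ hσ1).1 (hεσ.trans hn2)
    omega
  rw [le_div_iff₀ hεs.1] at hn1
  rw [div_lt_iff₀ hεs.1] at hn2
  have hε' : 0 < σ ^ n * ε := mul_pos (by positivity) hεs.1
  have g1 := pow_mul_le_of_geometric (q := q) hσ (by linarith) hstep n hε' (hn1.trans_lt hlt)
  rw [← mul_assoc, ← mul_pow, inv_mul_cancel₀ h0.ne', one_pow, one_mul] at g1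
  have hεm : ε ∈ Ioc 0 e' := ⟨hεs.1, le_trans (le_mul_of_one_le_left hεs.1.le
    (one_le_pow₀ hσ)) hn1⟩
  have g2 : q₀ ≤ q (σ ^ n * ε) := by
    refine div_le_div₀ (hp₂ _ ⟨hε', hn1⟩).le ?_ (hp₁ _ ⟨hε', hn1⟩) ?_
    · exact hf₂.deriv_inverse_anti (h₂ _ ⟨hε', hn1.trans_lt hlt₂⟩) (h₂ _ ⟨he', hlt₂⟩) hn1
    · refine hf₁.deriv_inverse_anti (h₁ _ ⟨hes.1, hes.2.trans_lt hlt₁⟩)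
        (h₁ _ ⟨hε', hn1.trans_lt hlt₁⟩) ?_
      rw [inv_mul_le_iff₀ h0, ← mul_assoc, ← pow_succ']
      exact hn2.le
  have g3 : η⁻¹ < q ε := by
    rw [div_lt_iff₀ hq₀pos] at hN
    calc η⁻¹ < k ^ N * q₀ := hN
      _ ≤ k ^ n * q (σ ^ n * ε) := mul_le_mul (pow_le_pow_right₀ hk1.le hNn) g2 hq₀pos.le
        (by positivity)
      _ ≤ _ := g1
  rw [inv_lt_iff_one_lt_mul₀ hη] at g3
  have g4 : η * deriv (inverse R₂ f₂) ε / deriv (inverse R₁ f₁) ε < 1 :=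
    (div_lt_one (hp₁ ε hεm)).2 hε
  rw [mul_div_assoc] at g4
  exact lt_irrefl _ (g3.trans (by simpa only [hq, mul_comm] using g4))

theorem angularConst_le_of_isBigO (hF₁ : FrakFExists R₁ f₁) (hF₂ : FrakFExists R₂ f₂)
    (hO : f₁ =O[𝓝[>] 0] f₂) : angularConst R₁ f₁ ≤ angularConst R₂ f₂ :=
  intervalIntegral.integral_mono_on_of_le_Ioo neg_pi_div_two_le
    (intervalIntegrable_frakF hR₁ hf₁ hF₁) (intervalIntegrable_frakF hR₂ hf₂ hF₂) fun _ hϑ =>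
    frakF_le_of_isBigO hR₁ hR₂ hf₁ hf₂ hF₁ hF₂ hO (one_le_one_div_cos hϑ)

end Comparison

end WarpedGeodesics

/-! ### The angle as a parameter. -/

namespace WarpedGeodesics

/-- The angle between a unit speed geodesic with radial component `r` and the level sets of the
radius. -/
def angle (r : ℝ → ℝ) (t : ℝ) : ℝ := Real.arcsin (deriv r t)

theorem measurable_angle (r : ℝ → ℝ) : Measurable (angle r) :=
  Real.measurable_arcsin.comp (measurable_deriv r)

namespace RadialMotion

variable {R c δ : ℝ} {f r ν : ℝ → ℝ} {J : Set ℝ} {t : ℝ}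
  (hf : IsWarpingFunction R f) (hc : 0 ≤ c) (hRc : R * c < 1)
  (M : RadialMotion R c f δ r ν J)
include M

theorem abs_deriv_le (ht : t ∈ J) : deriv r t ∈ Icc (-1) 1 :=
  abs_le.1 (abs_le_one_iff_mul_self_le_one.2 (by nlinarith [M.deriv_sq_le ht]))

include hf hc in
theorem angle_mem (ht : t ∈ J) : angle r t ∈ Ioo (-(Real.pi / 2)) (Real.pi / 2) := by
  have h := M.deriv_sq_lt hf hc ht
  exact ⟨Real.neg_pi_div_two_lt_arcsin.2 (by nlinarith), Real.arcsin_lt_pi_div_two.2 (by nlinarith)⟩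

include hf hc hRc in
theorem strictMonoOn_angle : StrictMonoOn (angle r) J := fun _ hs _ ht hst =>
  Real.strictMonoOn_arcsin (M.abs_deriv_le hs) (M.abs_deriv_le ht)
    (M.strictMonoOn_deriv hf hc hRc hs ht hst)

theorem angle_zero : angle r 0 = 0 := by rw [angle, M.deriv_zero, Real.arcsin_zero]

theorem continuousOn_deriv : ContinuousOn (deriv r) J := fun t ht =>
  have ⟨_, _, h⟩ := M.acceleration t ht
  h.continuousAt.continuousWithinAt

theorem continuousOn_angle : ContinuousOn (angle r) J :=
  Real.continuous_arcsin.comp_continuousOn M.continuousOn_deriv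

theorem continuousOn_radius : ContinuousOn r J := fun t ht =>
  (M.hasDerivAt t ht).continuousAt.continuousWithinAt

include hf in
theorem continuousOn_speed : ContinuousOn ν J := by
  have h1 : ContinuousOn (fun t => Real.cos (angle r t) / f (r t)) J := by
    refine (Real.continuous_cos.comp_continuousOn M.continuousOn_angle).div ?_
      fun t ht => (hf.pos _ (M.mem t ht)).ne'
    exact hf.contDiffOn.continuousOn.comp M.continuousOn_radius
      fun t ht => Ioo_subset_Ico_self (M.mem t ht)
  refine h1.congr fun t ht => ?_
  change ν t = Real.cos (Real.arcsin (deriv r t)) / f (r t)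
  rw [M.cos_angle hf ht, mul_div_cancel_left₀ _ (hf.pos _ (M.mem t ht)).ne']

theorem measurableSet_image_angle : MeasurableSet (angle r '' J) :=
  (M.ordConnected.isPreconnected.image _ M.continuousOn_angle).ordConnected.measurableSet

include hf hc hRc in
/-- Integrals of the angular speed, computed with the angle as parameter. -/
theorem exists_density : IntegrableOn ν J ∧ ∃ g : ℝ → ℝ, IntegrableOn g (angle r '' J) ∧
    (∀ S, MeasurableSet S → ∫ t in J ∩ angle r ⁻¹' S, ν t = ∫ ϑ in S ∩ angle r '' J, g ϑ) ∧
    ∀ t ∈ J, ∃ q, |q| ≤ c ∧ g (angle r t) = (deriv f (r t) + q * f (r t))⁻¹ := by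
  choose! q hq hd using fun t (ht : t ∈ J) => M.hasDerivAt_angle hf hc ht
  have hinj := (M.strictMonoOn_angle hf hc hRc).injOn
  set w := fun t => ν t * (deriv f (r t) + q t * f (r t)) with hw
  replace hd : ∀ t ∈ J, HasDerivAt (angle r) (w t) t := hd
  have hJm := M.isOpen.measurableSet
  -- For fixed δ the ratio θ̇/ν is bounded below by a positive constant, because r ≥ δ and f' is
  -- monotone. Integrability of ν thus reduces to that of θ̇.
  have hfac : ∀ t ∈ J, deriv f δ * (1 - c * R) ≤ deriv f (r t) + q t * f (r t) := fun t ht => by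
    have h1 := factor_pos hf hc hRc (M.mem t ht) (hq t ht)
    refine le_trans ?_ h1.1
    have h2 := hf.monotoneOn_deriv M.delta_mem (M.mem t ht) (M.min t ht)
    have h3 := (M.mem t ht).2.le
    have h4 := hf.deriv_pos M.delta_mem
    have h5 : c * r t ≤ c * R := mul_le_mul_of_nonneg_left h3 hc
    exact mul_le_mul h2 (by linarith) (by nlinarith) (h4.le.trans h2)
  have hpos : 0 < deriv f δ * (1 - c * R) :=
    mul_pos (hf.deriv_pos M.delta_mem) (by nlinarith)
  have hwpos : ∀ t ∈ J, 0 < w t := fun t ht =>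
    mul_pos (M.speed_pos hf hc ht) (hpos.trans_le (hfac t ht))
  have himg : angle r '' J ⊆ Ioo (-(Real.pi / 2)) (Real.pi / 2) := by
    rintro _ ⟨t, ht, rfl⟩; exact M.angle_mem hf hc ht
  -- The integral of θ̇ is the length of the interval of angles, which is at most π.
  have hwint : IntegrableOn w J := by
    have h1 : IntegrableOn (fun _ => (1 : ℝ)) (angle r '' J) :=
      (integrableOn_const (by simp [Real.volume_Ioo])).mono_set himg
    rw [integrableOn_image_iff_integrableOn_abs_deriv_smul hJm
      (fun t ht => (hd t ht).hasDerivWithinAt) hinj] at h1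
    refine h1.congr_fun (fun t ht => ?_) hJm
    simp only [smul_eq_mul, mul_one]
    exact abs_of_pos (hwpos t ht)
  have hνint : IntegrableOn ν J := by
    refine (hwint.const_mul (deriv f δ * (1 - c * R))⁻¹).mono'
      ((M.continuousOn_speed hf).aestronglyMeasurable hJm) ?_
    refine (ae_restrict_iff' hJm).2 (Eventually.of_forall fun t ht => ?_)
    rw [Real.norm_eq_abs, abs_of_nonneg (M.nonneg t), le_inv_mul_iff₀ hpos, mul_comm]
    exact mul_le_mul_of_nonneg_left (hfac t ht) (M.nonneg t)
  refine ⟨hνint, fun ϑ => (deriv f (r (Function.invFunOn (angle r) J ϑ)) +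
    q (Function.invFunOn (angle r) J ϑ) * f (r (Function.invFunOn (angle r) J ϑ)))⁻¹, ?_, ?_, ?_⟩
  · rw [integrableOn_image_iff_integrableOn_abs_deriv_smul hJm
      (fun t ht => (hd t ht).hasDerivWithinAt) hinj]
    refine hνint.congr_fun (fun t ht => ?_) hJm
    have h1 := hinj.leftInvOn_invFunOn ht
    have h2 := hpos.trans_le (hfac t ht)
    simp only [smul_eq_mul, h1]
    rw [abs_of_pos (hwpos t ht), mul_inv_cancel_right₀ h2.ne']
  · intro S hS
    have hJS : MeasurableSet (J ∩ angle r ⁻¹' S) :=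
      hJm.inter (measurable_angle r hS)
    rw [inter_comm S, ← image_inter_preimage, integral_image_eq_integral_abs_deriv_smul hJS
      (fun t ht => (hd t ht.1).hasDerivWithinAt) (hinj.mono inter_subset_left)]
    refine setIntegral_congr_fun hJS fun t ht => ?_
    have h1 := hinj.leftInvOn_invFunOn ht.1
    have h2 := hpos.trans_le (hfac t ht.1)
    simp only [smul_eq_mul, h1]
    rw [abs_of_pos (hwpos t ht.1), mul_inv_cancel_right₀ h2.ne']
  · intro t ht
    refine ⟨q t, hq t ht, ?_⟩
    simp only
    rw [hinj.leftInvOn_invFunOn ht]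

include hf hc hRc in
-- f(r) cos θ = f(r)² ν is the angular momentum: this is Clairaut's relation with its error.
theorem radius_mul_cos_bounds (ht : t ∈ J) :
    f δ * Real.exp (-(c * r t)) ≤ f (r t) * Real.cos (angle r t) ∧
      f (r t) * Real.cos (angle r t) ≤ f δ * Real.exp (c * r t) := by
  have h1 := M.angularMomentum_bounds hf hc hRc ht
  rw [angle, M.cos_angle hf ht, ← mul_assoc, ← sq]
  have h2 := (hf.pos δ M.delta_mem).le
  have h3 : c * (r t - δ) ≤ c * r t := mul_le_mul_of_nonneg_left (by linarith [M.delta_mem.1]) hc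
  exact ⟨(mul_le_mul_of_nonneg_left (Real.exp_le_exp.2 (neg_le_neg h3)) h2).trans h1.1,
    h1.2.trans (mul_le_mul_of_nonneg_left (Real.exp_le_exp.2 h3) h2)⟩

include hf hc hRc in
/-- If the geodesic leaves to radii where its angle has to be large, all smaller angles occur. -/
theorem mem_image_angle {ρ ϑ : ℝ} (hρ : ρ ∈ Ioo 0 R) (hϑ : ϑ ∈ Ioo (-(Real.pi / 2)) (Real.pi / 2))
    (hex : (∃ t ∈ J, 0 < t ∧ ρ < r t) ∧ ∃ t ∈ J, t < 0 ∧ ρ < r t)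
    (hlt : f δ * Real.exp (c * R) < f ρ * Real.cos ϑ) : ϑ ∈ angle r '' J := by
  -- Beyond radius ρ, a cosine as large as cos ϑ would give an angular momentum of at least f(ρ) cos
  -- ϑ, more than Clairaut's relation permits.
  have hcos : ∀ t ∈ J, ρ < r t → Real.cos (angle r t) < Real.cos ϑ := fun t ht hr => by
    have h1 := (M.radius_mul_cos_bounds hf hc hRc ht).2
    have h2 : f δ * Real.exp (c * r t) ≤ f δ * Real.exp (c * R) :=
      mul_le_mul_of_nonneg_left (Real.exp_le_exp.2
        (mul_le_mul_of_nonneg_left (M.mem t ht).2.le hc)) (hf.pos δ M.delta_mem).le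
    have h3 := hf.strictMonoOn (Ioo_subset_Ico_self hρ) (Ioo_subset_Ico_self (M.mem t ht)) hr
    have h4 := hf.pos _ hρ
    have h5 := hf.pos _ (M.mem t ht)
    have h6 := Real.cos_pos_of_mem_Ioo hϑ
    by_contra! hcon
    have : f ρ * Real.cos ϑ ≤ f (r t) * Real.cos (angle r t) :=
      mul_le_mul h3.le hcon h6.le h5.le
    linarith
  have hcos' : ∀ {x y : ℝ}, 0 ≤ x → x ≤ Real.pi → 0 ≤ y → y ≤ Real.pi → Real.cos y < Real.cos x →
      x < y := fun h1 h2 h3 h4 h => by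
    by_contra! hcon
    exact absurd h (not_lt.2 (Real.cos_le_cos_of_nonneg_of_le_pi h3 h2 hcon))
  have hpi := Real.pi_pos
  obtain ⟨⟨t₁, ht₁, h01, hr₁⟩, t₂, ht₂, h02, hr₂⟩ := hex
  have hmono := M.strictMonoOn_angle hf hc hRc
  have ha₁ : 0 < angle r t₁ := M.angle_zero ▸ hmono M.zero_mem ht₁ h01
  have ha₂ : angle r t₂ < 0 := M.angle_zero ▸ hmono ht₂ M.zero_mem h02
  have hm₁ := M.angle_mem hf hc ht₁
  have hm₂ := M.angle_mem hf hc ht₂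
  have hab : |ϑ| ≤ Real.pi / 2 := abs_le.2 ⟨hϑ.1.le, hϑ.2.le⟩
  have hlt₁ : |ϑ| < angle r t₁ := hcos' (abs_nonneg _) (by linarith) ha₁.le (by linarith [hm₁.2])
    (by rw [Real.cos_abs]; exact hcos t₁ ht₁ hr₁)
  have hlt₂ : |ϑ| < -angle r t₂ := hcos' (abs_nonneg _) (by linarith) (by linarith)
    (by linarith [hm₂.1]) (by rw [Real.cos_abs, Real.cos_neg]; exact hcos t₂ ht₂ hr₂)
  have hoc := (M.ordConnected.isPreconnected.image _ M.continuousOn_angle).ordConnected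
  exact hoc.out (mem_image_of_mem _ ht₂) (mem_image_of_mem _ ht₁)
    ⟨by linarith [neg_abs_le ϑ], by linarith [le_abs_self ϑ]⟩

end RadialMotion

/-! ### Consequences of uniform convergence to 𝔉. -/

section NonOscillation

variable {R : ℝ} {f : ℝ → ℝ} (hR : 0 < R) (hf : IsWarpingFunction R f)
  (hosc : NonOscillation R f)
include hR hf hosc

theorem eventually_continuousOn_derivRatio (S : ℝ) :
    ∀ᶠ ε in 𝓝[>] (0 : ℝ), ContinuousOn (derivRatio R f ε) (Icc 1 S) := by
  obtain ⟨e, he, h⟩ := hf.exists_forall_mem_Ioo hR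
  have hS : (0 : ℝ) < max S 1 := lt_of_lt_of_le one_pos (le_max_right _ _)
  filter_upwards [Ioo_mem_nhdsGT he, tendsto_const_mul_nhdsGT hS (Ioo_mem_nhdsGT he)]
    with ε h1 h2
  intro σ hσ
  have h3 : σ * ε ∈ Ioo 0 e := ⟨mul_pos (by linarith [hσ.1]) h1.1,
    (mul_le_mul_of_nonneg_right (hσ.2.trans (le_max_left _ _)) h1.1.le).trans_lt h2.2⟩
  exact ((ContinuousAt.comp (g := deriv (inverse R f)) (f := fun σ => σ * ε) (hf.continuousAt_deriv_inverse h h3)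
    (continuous_mul_const ε).continuousAt).div_const _).continuousWithinAt

theorem continuousOn_frakF (S : ℝ) : ContinuousOn (frakF R f) (Icc 1 S) :=
  (hosc.2 _ Icc_subset_Ici_self isCompact_Icc).continuousOn
    (eventually_continuousOn_derivRatio hR hf hosc S).frequently

/-- Locally uniform convergence to a continuous limit permits σ to vary with ε. This is needed
because Clairaut's relation yields f(r)/f(δ) = 1/cos ϑ only in the limit. -/
theorem tendsto_derivRatio {ι : Type*} {l : Filter ι} {ε σ : ι → ℝ} {σ₀ : ℝ}
    (hε : Tendsto ε l (𝓝[>] 0)) (hσ : Tendsto σ l (𝓝 σ₀)) (h1 : ∀ᶠ i in l, 1 ≤ σ i) (h0 : 1 ≤ σ₀) :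
    Tendsto (fun i => derivRatio R f (ε i) (σ i)) l (𝓝 (frakF R f σ₀)) := by
  have hm : ∀ᶠ i in l, σ i ∈ Icc 1 (σ₀ + 1) := by
    filter_upwards [h1, hσ.eventually (ge_mem_nhds (lt_add_one σ₀))] with i hi hi'
    exact ⟨hi, hi'⟩
  have hu := hosc.2 (Icc 1 (σ₀ + 1)) Icc_subset_Ici_self isCompact_Icc
  have hc := (continuousOn_frakF hR hf hosc (σ₀ + 1)) σ₀ ⟨h0, (lt_add_one σ₀).le⟩
  have hσ' : Tendsto (fun i => frakF R f (σ i)) l (𝓝 (frakF R f σ₀)) :=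
    hc.tendsto.comp (tendsto_nhdsWithin_iff.2 ⟨hσ, hm⟩)
  rw [Metric.tendsto_nhds] at hσ' ⊢
  intro η hη
  rw [Metric.tendstoUniformlyOn_iff] at hu
  filter_upwards [hσ' (η / 2) (half_pos hη), hε.eventually (hu (η / 2) (half_pos hη)), hm]
    with i h2 h3 h4
  have h5 := h3 _ h4
  rw [dist_comm] at h5
  linarith [dist_triangle (derivRatio R f (ε i) (σ i)) (frakF R f (σ i)) (frakF R f σ₀)]

end NonOscillation

end WarpedGeodesics

namespace WarpedGeodesics

/-! ### Asymptotics of the angular length, by dominated convergence in the angle. -/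

section Asymptotics

variable {R c : ℝ} {f : ℝ → ℝ} {r ν : ℝ → ℝ → ℝ} {J : ℝ → Set ℝ}
  (hR : 0 < R) (hf : IsWarpingFunction R f) (hc : 0 ≤ c) (hRc : R * c < 1)
  (hM : ∀ δ ∈ Ioo 0 R, RadialMotion R c f δ (r δ) (ν δ) (J δ))
include hR hf hc hRc hM

/-- If cos θ ≥ κ then f(r) ≤ f(δ) e^{cR}/κ, which tends to zero with δ. -/
theorem eventually_radius_lt {κ ρ : ℝ} (hκ : 0 < κ) (hρ : 0 < ρ) :
    ∀ᶠ δ in 𝓝[>] 0, ∀ t ∈ J δ, κ ≤ Real.cos (angle (r δ) t) → r δ t < ρ := by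
  have hρ' : min ρ (R / 2) ∈ Ioo 0 R := ⟨lt_min hρ (by linarith), by
    have := min_le_right ρ (R / 2); linarith⟩
  have h1 : Tendsto (fun δ => f δ * Real.exp (c * R)) (𝓝[>] 0) (𝓝 (0 * Real.exp (c * R))) :=
    ((hf.tendsto_zero hR).mono_right nhdsWithin_le_nhds).mul_const _
  rw [zero_mul] at h1
  filter_upwards [h1.eventually (gt_mem_nhds (mul_pos (hf.pos _ hρ') hκ)), Ioo_mem_nhdsGT hR]
    with δ h2 hδ t ht hcos
  have M := hM δ hδ
  have h3 := (M.radius_mul_cos_bounds hf hc hRc ht).2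
  have h4 : f δ * Real.exp (c * r δ t) ≤ f δ * Real.exp (c * R) :=
    mul_le_mul_of_nonneg_left (Real.exp_le_exp.2
      (mul_le_mul_of_nonneg_left (M.mem t ht).2.le hc)) (hf.pos δ hδ).le
  have h5 := mul_le_mul_of_nonneg_left hcos (hf.pos _ (M.mem t ht)).le
  have h6 : f (r δ t) < f (min ρ (R / 2)) := lt_of_mul_lt_mul_right (by linarith) hκ.le
  exact ((hf.strictMonoOn.lt_iff_lt (Ioo_subset_Ico_self (M.mem t ht))
    (Ioo_subset_Ico_self hρ')).1 h6).trans_le (min_le_left _ _)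

variable (hexit : ∀ δ ∈ Ioo 0 R, ∀ ρ < R,
  (∃ t ∈ J δ, 0 < t ∧ ρ < r δ t) ∧ ∃ t ∈ J δ, t < 0 ∧ ρ < r δ t)
include hexit

theorem eventually_mem_image_angle {ϑ : ℝ} (hϑ : ϑ ∈ Ioo (-(Real.pi / 2)) (Real.pi / 2)) :
    ∀ᶠ δ in 𝓝[>] 0, ϑ ∈ angle (r δ) '' J δ := by
  have hρ : R / 2 ∈ Ioo 0 R := ⟨by linarith, by linarith⟩
  have h1 : Tendsto (fun δ => f δ * Real.exp (c * R)) (𝓝[>] 0) (𝓝 (0 * Real.exp (c * R))) :=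
    ((hf.tendsto_zero hR).mono_right nhdsWithin_le_nhds).mul_const _
  rw [zero_mul] at h1
  filter_upwards [h1.eventually (gt_mem_nhds (mul_pos (hf.pos _ hρ)
    (Real.cos_pos_of_mem_Ioo hϑ))), Ioo_mem_nhdsGT hR] with δ h2 hδ
  exact (hM δ hδ).mem_image_angle hf hc hRc hρ hϑ (hexit δ hδ _ hρ.2) h2

/-- Asymptotics of the part of the length of the angular component on which the angle lies in a
given set. -/
theorem tendsto_integral_angle (hosc : NonOscillation R f) {S : Set ℝ} (hS : MeasurableSet S) :
    Tendsto (fun δ => deriv f δ * ∫ t in J δ ∩ angle (r δ) ⁻¹' S, ν δ t) (𝓝[>] 0)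
      (𝓝 (∫ ϑ in S ∩ Ioo (-(Real.pi / 2)) (Real.pi / 2), frakF R f (1 / Real.cos ϑ))) := by
  choose! hν g hg hgS q hq hgq using fun δ (hδ : δ ∈ Ioo 0 R) =>
    (hM δ hδ).exists_density hf hc hRc
  have hsub : ∀ δ ∈ Ioo 0 R, angle (r δ) '' J δ ⊆ Ioo (-(Real.pi / 2)) (Real.pi / 2) := by
    rintro δ hδ _ ⟨t, ht, rfl⟩; exact (hM δ hδ).angle_mem hf hc ht
  -- The integrand in the angle, extended by zero from the angles that occur to all angles, so that
  -- the domain of integration does not depend on δ.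
  set Φ : ℝ → ℝ → ℝ := fun δ => (angle (r δ) '' J δ).indicator fun ϑ => deriv f δ * g δ ϑ with hΦ
  have hcR : 0 < 1 - c * R := by nlinarith
  have hev : ∀ᶠ δ in 𝓝[>] (0 : ℝ), δ ∈ Ioo 0 R := Ioo_mem_nhdsGT hR
  have hfac : ∀ δ ∈ Ioo 0 R, ∀ t ∈ J δ, (1 + c * r δ t)⁻¹ * (deriv f δ / deriv f (r δ t)) ≤
      deriv f δ * g δ (angle (r δ) t) ∧ deriv f δ * g δ (angle (r δ) t) ≤
        (1 - c * r δ t)⁻¹ * (deriv f δ / deriv f (r δ t)) := by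
    intro δ hδ t ht
    have M := hM δ hδ
    have h1 := RadialMotion.factor_pos hf hc hRc (M.mem t ht) (hq δ hδ t ht)
    have h2 := hf.deriv_pos (M.mem t ht)
    have h3 := hf.deriv_pos hδ
    rw [hgq δ hδ t ht, div_eq_mul_inv, mul_left_comm, ← mul_inv, mul_left_comm, ← mul_inv,
      mul_comm (1 + _), mul_comm (1 - _)]
    exact ⟨mul_le_mul_of_nonneg_left (inv_anti₀ (h1.2.2.trans_le h1.1) h1.2.1) h3.le,
      mul_le_mul_of_nonneg_left (inv_anti₀ h1.2.2 h1.1) h3.le⟩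
  have hΦint : ∀ δ ∈ Ioo 0 R, deriv f δ * ∫ t in J δ ∩ angle (r δ) ⁻¹' S, ν δ t =
      ∫ ϑ in S ∩ Ioo (-(Real.pi / 2)) (Real.pi / 2), Φ δ ϑ := by
    intro δ hδ
    rw [hgS δ hδ S hS, hΦ, setIntegral_indicator (hM δ hδ).measurableSet_image_angle, inter_assoc,
      inter_eq_right.2 (hsub δ hδ), integral_const_mul]
  refine Tendsto.congr' (hev.mono fun δ hδ => (hΦint δ hδ).symm) ?_
  -- The dominating constant: f'(δ)/f'(r) ≤ 1 since r ≥ δ, and the remaining factor is at most 1/(1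
  -- − c r) ≤ 1/(1 − c R).
  refine tendsto_integral_filter_of_dominated_convergence (fun _ => (1 - c * R)⁻¹) ?_ ?_ ?_ ?_
  · filter_upwards [hev] with δ hδ
    refine AEStronglyMeasurable.mono_measure ?_ Measure.restrict_le_self
    rw [hΦ, aestronglyMeasurable_indicator_iff (hM δ hδ).measurableSet_image_angle]
    exact ((hg δ hδ).const_mul _).aestronglyMeasurable
  · filter_upwards [hev] with δ hδ
    refine Eventually.of_forall fun ϑ => ?_
    have hb : (0 : ℝ) ≤ (1 - c * R)⁻¹ := (inv_pos.2 hcR).le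
    by_cases hϑ : ϑ ∈ angle (r δ) '' J δ
    · obtain ⟨t, ht, rfl⟩ := hϑ
      simp only [hΦ, indicator_of_mem (mem_image_of_mem _ ht)]
      have M := hM δ hδ
      have h1 := hfac δ hδ t ht
      have h2 := hf.deriv_pos (M.mem t ht)
      have h3 := hf.deriv_pos hδ
      have h5 : 1 - c * R ≤ 1 - c * r δ t := by
        have := mul_le_mul_of_nonneg_left (M.mem t ht).2.le hc; linarith
      have h4 : 0 ≤ (1 + c * r δ t)⁻¹ := inv_nonneg.2 (by
        have := mul_nonneg hc (M.mem t ht).1.le; linarith)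
      rw [Real.norm_eq_abs, abs_of_nonneg ((mul_nonneg h4 (div_pos h3 h2).le).trans h1.1)]
      refine h1.2.trans ((mul_le_of_le_one_right (inv_nonneg.2 (hcR.le.trans h5)) ?_).trans
        (inv_anti₀ hcR h5))
      exact (div_le_one h2).2 (hf.monotoneOn_deriv hδ (M.mem t ht) (M.min t ht))
    · simp only [hΦ, indicator_of_notMem hϑ, norm_zero, hb]
  · exact (integrableOn_const (by simp [Real.volume_Ioo])).mono_set inter_subset_right
  · refine (ae_restrict_iff' (hS.inter measurableSet_Ioo)).2 (Eventually.of_forall fun ϑ hϑ => ?_)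
    replace hϑ := hϑ.2
    have hcos := Real.cos_pos_of_mem_Ioo hϑ
    set t := fun δ => Function.invFunOn (angle (r δ)) (J δ) ϑ with ht
    have htmem : ∀ᶠ δ in 𝓝[>] 0, δ ∈ Ioo 0 R ∧ t δ ∈ J δ ∧ angle (r δ) (t δ) = ϑ := by
      filter_upwards [hev, eventually_mem_image_angle hR hf hc hRc hM hexit hϑ] with δ hδ hδ'
      exact ⟨hδ, Function.invFunOn_mem hδ', Function.invFunOn_eq hδ'⟩
    have hr : Tendsto (fun δ => r δ (t δ)) (𝓝[>] 0) (𝓝[>] 0) := by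
      refine (nhdsGT_basis (0 : ℝ)).tendsto_right_iff.2 fun ρ hρ => ?_
      filter_upwards [htmem, eventually_radius_lt hR hf hc hRc hM hcos hρ] with δ h1 h2
      exact ⟨((hM δ h1.1).mem _ h1.2.1).1, h2 _ h1.2.1 (by rw [h1.2.2])⟩
    have hr0 := hr.mono_right nhdsWithin_le_nhds
    have hexp : ∀ k : ℝ, Tendsto (fun δ => Real.exp (k * r δ (t δ)) / Real.cos ϑ) (𝓝[>] 0)
        (𝓝 (1 / Real.cos ϑ)) := fun k => by
      have h1 := (Real.continuous_exp.tendsto _).comp (hr0.const_mul k)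
      rw [mul_zero, Real.exp_zero] at h1
      exact h1.div_const _
    -- Clairaut's relation at the fixed angle ϑ squeezes f(r)/f(δ) between e^{−cr}/cos ϑ and
    -- e^{cr}/cos ϑ, and r → 0.
    have hσ : Tendsto (fun δ => f (r δ (t δ)) / f δ) (𝓝[>] 0) (𝓝 (1 / Real.cos ϑ)) := by
      refine tendsto_of_tendsto_of_tendsto_of_le_of_le' (hexp (-c)) (hexp c) ?_ ?_
      · filter_upwards [htmem] with δ h1
        have h2 := ((hM δ h1.1).radius_mul_cos_bounds hf hc hRc h1.2.1).1
        rw [h1.2.2] at h2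
        rw [div_le_div_iff₀ hcos (hf.pos δ h1.1), neg_mul, mul_comm]
        exact h2
      · filter_upwards [htmem] with δ h1
        have h2 := ((hM δ h1.1).radius_mul_cos_bounds hf hc hRc h1.2.1).2
        rw [h1.2.2] at h2
        rw [div_le_div_iff₀ (hf.pos δ h1.1) hcos, mul_comm (Real.exp _)]
        exact h2
    -- With ε = f(δ) and σ = f(r)/f(δ) ≥ 1, the quotient f'(δ)/f'(r) is F'(σε)/F'(ε).
    have hratio : Tendsto (fun δ => deriv f δ / deriv f (r δ (t δ))) (𝓝[>] 0)
        (𝓝 (frakF R f (1 / Real.cos ϑ))) := by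
      refine (tendsto_derivRatio hR hf hosc (hf.tendsto_zero hR) hσ ?_
        (one_le_one_div_cos hϑ)).congr' ?_
      · filter_upwards [htmem] with δ h1
        exact (one_le_div (hf.pos δ h1.1)).2 (hf.strictMonoOn.monotoneOn
          (Ioo_subset_Ico_self h1.1) (Ioo_subset_Ico_self ((hM δ h1.1).mem _ h1.2.1))
          ((hM δ h1.1).min _ h1.2.1))
      · filter_upwards [htmem] with δ h1
        exact hf.derivRatio_eq h1.1 ((hM δ h1.1).mem _ h1.2.1)
          (div_mul_cancel₀ _ (hf.pos δ h1.1).ne').symm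
    have hlin : ∀ k : ℝ, Tendsto (fun δ => (1 + k * r δ (t δ))⁻¹ *
        (deriv f δ / deriv f (r δ (t δ)))) (𝓝[>] 0) (𝓝 (frakF R f (1 / Real.cos ϑ))) := fun k => by
      have h1 := ((hr0.const_mul k).const_add 1).inv₀ (by simp)
      rw [mul_zero, add_zero, inv_one] at h1
      simpa using h1.mul hratio
    refine tendsto_of_tendsto_of_tendsto_of_le_of_le' (hlin c) (hlin (-c)) ?_ ?_
    · filter_upwards [htmem] with δ h1
      have h2 : Φ δ ϑ = deriv f δ * g δ (angle (r δ) (t δ)) := by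
        rw [hΦ, h1.2.2]; exact indicator_of_mem (show ϑ ∈ angle (r δ) '' J δ from ⟨t δ, h1.2⟩) _
      rw [h2]; exact (hfac δ h1.1 _ h1.2.1).1
    · filter_upwards [htmem] with δ h1
      have h2 : Φ δ ϑ = deriv f δ * g δ (angle (r δ) (t δ)) := by
        rw [hΦ, h1.2.2]; exact indicator_of_mem (show ϑ ∈ angle (r δ) '' J δ from ⟨t δ, h1.2⟩) _
      rw [h2, neg_mul, ← sub_eq_add_neg]; exact (hfac δ h1.1 _ h1.2.1).2

end Asymptotics

end WarpedGeodesics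

/-! ### The rescaled time. -/

namespace WarpedGeodesics

namespace RadialMotion

variable {R c δ : ℝ} {f r ν : ℝ → ℝ} {J : Set ℝ} {s t : ℝ}
  (hf : IsWarpingFunction R f) (hc : 0 ≤ c) (hRc : R * c < 1)
  (M : RadialMotion R c f δ r ν J)
include M hf hc hRc

theorem integrableOn_speed : IntegrableOn ν J := (M.exists_density hf hc hRc).1

theorem integrableOn_closure : IntegrableOn ν (Icc (sInf J) (sSup J)) := by
  rw [integrableOn_Icc_iff_integrableOn_Ioo, ← M.eq_Ioo hf hc hRc]
  exact M.integrableOn_speed hf hc hRc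

theorem zero_mem_Icc : (0 : ℝ) ∈ Ioo (sInf J) (sSup J) := M.eq_Ioo hf hc hRc ▸ M.zero_mem

theorem intervalIntegrable_speed (hs : s ∈ Icc (sInf J) (sSup J)) (ht : t ∈ Icc (sInf J) (sSup J)) :
    IntervalIntegrable ν volume s t :=
  ((M.integrableOn_closure hf hc hRc).mono_set (ordConnected_Icc.uIcc_subset hs ht)).intervalIntegrable

theorem strictMonoOn_time : StrictMonoOn (fun t => ∫ u in (0 : ℝ)..t, ν u) (Icc (sInf J) (sSup J)) := by
  intro s hs t ht hst
  have h0 := Ioo_subset_Icc_self (M.zero_mem_Icc hf hc hRc)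
  have h1 : 0 < ∫ u in s..t, ν u :=
    intervalIntegral.intervalIntegral_pos_of_pos_on (M.intervalIntegrable_speed hf hc hRc hs ht)
      (fun u hu => M.speed_pos hf hc (by
        rw [M.eq_Ioo hf hc hRc]; exact ⟨hs.1.trans_lt hu.1, hu.2.trans_le ht.2⟩)) hst
  have h2 := intervalIntegral.integral_add_adjacent_intervals
    (M.intervalIntegrable_speed hf hc hRc h0 hs) (M.intervalIntegrable_speed hf hc hRc hs ht)
  simp only
  linarith

theorem hasDerivAt_time (ht : t ∈ J) : HasDerivAt (fun t => ∫ u in (0 : ℝ)..t, ν u) (ν t) t := by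
  have hJ := M.eq_Ioo hf hc hRc
  have hcont := (M.continuousOn_speed hf).continuousAt (M.isOpen.mem_nhds ht)
  refine intervalIntegral.integral_hasDerivAt_right (M.intervalIntegrable_speed hf hc hRc
    (Ioo_subset_Icc_self (M.zero_mem_Icc hf hc hRc)) (Ioo_subset_Icc_self (hJ ▸ ht))) ?_ hcont
  exact (M.continuousOn_speed hf).stronglyMeasurableAtFilter M.isOpen t ht

theorem image_time : (fun t => ∫ u in (0 : ℝ)..t, ν u) '' J =
    Ioo (∫ u in (0 : ℝ)..sInf J, ν u) (∫ u in (0 : ℝ)..sSup J, ν u) := by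
  have h0 := M.zero_mem_Icc hf hc hRc
  have hle : sInf J ≤ sSup J := (h0.1.trans h0.2).le
  have hmono := M.strictMonoOn_time hf hc hRc
  have hcont : ContinuousOn (fun t => ∫ u in (0 : ℝ)..t, ν u) (Icc (sInf J) (sSup J)) := by
    rw [← uIcc_of_le hle]
    refine intervalIntegral.continuousOn_primitive_interval' (b₁ := sInf J) (b₂ := sSup J) ?_ ?_
    · exact M.intervalIntegrable_speed hf hc hRc (left_mem_Icc.2 hle) (right_mem_Icc.2 hle)
    · rw [uIcc_of_le hle]; exact Ioo_subset_Icc_self h0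
  apply Subset.antisymm
  · rintro _ ⟨t, ht, rfl⟩
    rw [M.eq_Ioo hf hc hRc] at ht
    exact ⟨hmono (left_mem_Icc.2 hle) (Ioo_subset_Icc_self ht) ht.1,
      hmono (Ioo_subset_Icc_self ht) (right_mem_Icc.2 hle) ht.2⟩
  · have := intermediate_value_Ioo hle hcont
    rwa [← M.eq_Ioo hf hc hRc] at this

/-- The angle increases strictly and vanishes at time 0, so its sign is that of the time. Integrals
over half-lines of angles thereby become endpoints of the rescaled interval. -/
theorem inter_angle_pos : J ∩ angle r ⁻¹' Ioi 0 = Ioo 0 (sSup J) := by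
  have hJ := M.eq_Ioo hf hc hRc
  have h0 := M.zero_mem_Icc hf hc hRc
  have hmono := M.strictMonoOn_angle hf hc hRc
  ext t
  constructor
  · rintro ⟨ht, hθ⟩
    rw [mem_preimage, mem_Ioi, ← M.angle_zero] at hθ
    exact ⟨(hmono.lt_iff_lt M.zero_mem ht).1 hθ, (hJ ▸ ht : t ∈ Ioo (sInf J) (sSup J)).2⟩
  · intro ht
    have htJ : t ∈ J := by rw [hJ]; exact ⟨h0.1.trans ht.1, ht.2⟩
    refine ⟨htJ, ?_⟩
    rw [mem_preimage, mem_Ioi, ← M.angle_zero]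
    exact hmono M.zero_mem htJ ht.1

theorem inter_angle_neg : J ∩ angle r ⁻¹' Iio 0 = Ioo (sInf J) 0 := by
  have hJ := M.eq_Ioo hf hc hRc
  have h0 := M.zero_mem_Icc hf hc hRc
  have hmono := M.strictMonoOn_angle hf hc hRc
  ext t
  constructor
  · rintro ⟨ht, hθ⟩
    rw [mem_preimage, mem_Iio, ← M.angle_zero] at hθ
    exact ⟨(hJ ▸ ht : t ∈ Ioo (sInf J) (sSup J)).1, (hmono.lt_iff_lt ht M.zero_mem).1 hθ⟩
  · intro ht
    have htJ : t ∈ J := by rw [hJ]; exact ⟨ht.1, ht.2.trans h0.2⟩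
    refine ⟨htJ, ?_⟩
    rw [mem_preimage, mem_Iio, ← M.angle_zero]
    exact hmono htJ M.zero_mem ht.2

/-- Within rescaled time less than what is spent at angles of absolute value at most `x`, the
angle does not exceed `x`. -/
theorem abs_angle_le {x T : ℝ} (h₁ : T < ∫ t in J ∩ angle r ⁻¹' Ioo 0 x, ν t)
    (h₂ : T < ∫ t in J ∩ angle r ⁻¹' Ioo (-x) 0, ν t) (ht : t ∈ J)
    (hT : |∫ u in (0 : ℝ)..t, ν u| ≤ T) : |angle r t| ≤ x := by
  have hJ := M.eq_Ioo hf hc hRc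
  have hmono := M.strictMonoOn_angle hf hc hRc
  have hν := M.integrableOn_speed hf hc hRc
  have hae : ∀ s : Set ℝ, 0 ≤ᵐ[volume.restrict s] ν := fun s => Eventually.of_forall M.nonneg
  by_contra! hx
  rcases le_total 0 t with h0 | h0
  · rcases lt_abs.1 hx with h | h
    · have h3 : J ∩ angle r ⁻¹' Ioo 0 x ⊆ Ioc 0 t := by
        rintro s ⟨hs, hsθ⟩
        refine ⟨(hmono.lt_iff_lt M.zero_mem hs).1 (by rw [M.angle_zero]; exact hsθ.1), ?_⟩
        exact (hmono.lt_iff_lt hs ht).1 (hsθ.2.trans h) |>.le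
      have h4 := setIntegral_mono_set (hν.mono_set fun s hs => M.ordConnected.out M.zero_mem ht
        (Ioc_subset_Icc_self hs)) (hae _) h3.eventuallyLE
      rw [intervalIntegral.integral_of_le h0] at hT
      linarith [le_abs_self (∫ u in Ioc 0 t, ν u)]
    · have h3 := hmono.monotoneOn M.zero_mem ht h0
      rw [M.angle_zero] at h3
      -- Here `x < 0`, so no angles lie in (0, x) and `h₁` forces `T < 0`, which is absurd.
      have hT0 : (J ∩ angle r ⁻¹' Ioo 0 x) = ∅ := by
        ext s; simp only [mem_inter_iff, mem_preimage, mem_Ioo, mem_empty_iff_false, iff_false]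
        rintro ⟨_, h5, h6⟩; linarith
      rw [hT0, setIntegral_empty] at h₁
      linarith [abs_nonneg (∫ u in (0 : ℝ)..t, ν u)]
  · rcases lt_abs.1 hx with h | h
    · have h3 := hmono.monotoneOn ht M.zero_mem h0
      rw [M.angle_zero] at h3
      have hT0 : (J ∩ angle r ⁻¹' Ioo 0 x) = ∅ := by
        ext s; simp only [mem_inter_iff, mem_preimage, mem_Ioo, mem_empty_iff_false, iff_false]
        rintro ⟨_, h5, h6⟩; linarith
      rw [hT0, setIntegral_empty] at h₁
      linarith [abs_nonneg (∫ u in (0 : ℝ)..t, ν u)]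
    · have h3 : J ∩ angle r ⁻¹' Ioo (-x) 0 ⊆ Ioc t 0 := by
        rintro s ⟨hs, hsθ⟩
        refine ⟨(hmono.lt_iff_lt ht hs).1 (by linarith [hsθ.1]), ?_⟩
        exact ((hmono.lt_iff_lt hs M.zero_mem).1 (by rw [M.angle_zero]; exact hsθ.2)).le
      have h4 := setIntegral_mono_set (hν.mono_set fun s hs => M.ordConnected.out ht M.zero_mem
        (Ioc_subset_Icc_self hs)) (hae _) h3.eventuallyLE
      rw [intervalIntegral.integral_of_ge h0, abs_neg] at hT
      linarith [le_abs_self (∫ u in Ioc t 0, ν u)]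

end RadialMotion

/-! ### Limits of the length and of the rescaled time interval. -/

section Limits

variable {R c : ℝ} {f : ℝ → ℝ} {r ν : ℝ → ℝ → ℝ} {J : ℝ → Set ℝ}
  (hR : 0 < R) (hf : IsWarpingFunction R f) (hc : 0 ≤ c) (hRc : R * c < 1)
  (hosc : NonOscillation R f)

include hR hf hosc in
theorem integral_frakF_pos {a b : ℝ} (hab : a < b) (ha : -(Real.pi / 2) ≤ a) (hb : b ≤ Real.pi / 2) :
    0 < ∫ ϑ in Ioo a b, frakF R f (1 / Real.cos ϑ) := by
  have hi : IntervalIntegrable (fun ϑ => frakF R f (1 / Real.cos ϑ)) volume a b :=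
    (intervalIntegrable_frakF hR hf hosc.1).mono_set (by
      rw [uIcc_of_le hab.le, uIcc_of_le neg_pi_div_two_le]; exact Icc_subset_Icc ha hb)
  rw [← integral_Ioc_eq_integral_Ioo, ← intervalIntegral.integral_of_le hab.le]
  exact intervalIntegral.intervalIntegral_pos_of_pos_on hi (fun ϑ hϑ =>
    frakF_pos hR hf hosc.1 (one_le_one_div_cos ⟨ha.trans_lt hϑ.1, hϑ.2.trans_le hb⟩)) hab

include hR hf in
theorem integral_frakF_of_conical (h : 0 < derivWithin f (Ico 0 R) 0) {a b : ℝ} (hab : a ≤ b)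
    (ha : -(Real.pi / 2) ≤ a) (hb : b ≤ Real.pi / 2) :
    ∫ ϑ in Ioo a b, frakF R f (1 / Real.cos ϑ) = b - a := by
  rw [setIntegral_congr_fun measurableSet_Ioo (g := fun _ => (1 : ℝ)) fun ϑ hϑ =>
    frakF_eq_one_of_conical hR hf h (one_le_one_div_cos ⟨ha.trans_lt hϑ.1, hϑ.2.trans_le hb⟩)]
  simp [hab]

variable (hM : ∀ δ ∈ Ioo 0 R, RadialMotion R c f δ (r δ) (ν δ) (J δ))
  (hexit : ∀ δ ∈ Ioo 0 R, ∀ ρ < R,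
    (∃ t ∈ J δ, 0 < t ∧ ρ < r δ t) ∧ ∃ t ∈ J δ, t < 0 ∧ ρ < r δ t)
include hR hf hc hRc hM hexit hosc

theorem tendsto_length : Tendsto (fun δ => (∫ t in J δ, ν δ t) / (angularConst R f / deriv f δ))
    (𝓝[>] 0) (𝓝 1) := by
  have h := tendsto_integral_angle hR hf hc hRc hM hexit hosc MeasurableSet.univ
  simp only [preimage_univ, inter_univ, univ_inter] at h
  have h2 : 0 < angularConst R f := by linarith [two_le_angularConst hR hf hosc.1]
  rw [← integral_Ioc_eq_integral_Ioo, ← intervalIntegral.integral_of_le neg_pi_div_two_le] at h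
  change Tendsto _ _ (𝓝 (angularConst R f)) at h
  have h3 := h.div_const (angularConst R f)
  rw [div_self h2.ne'] at h3
  refine h3.congr fun δ => ?_
  rw [div_div_eq_mul_div, mul_comm]

theorem tendsto_integral_of_conical (h1 : derivWithin f (Ico 0 R) 0 = 1) {a b : ℝ} (hab : a ≤ b)
    (ha : -(Real.pi / 2) ≤ a) (hb : b ≤ Real.pi / 2) {S : Set ℝ} (hS : MeasurableSet S)
    (hSab : S ∩ Ioo (-(Real.pi / 2)) (Real.pi / 2) = Ioo a b) :
    Tendsto (fun δ => ∫ t in J δ ∩ angle (r δ) ⁻¹' S, ν δ t) (𝓝[>] 0) (𝓝 (b - a)) := by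
  have h := tendsto_integral_angle hR hf hc hRc hM hexit hosc hS
  rw [hSab, integral_frakF_of_conical hR hf (by rw [h1]; norm_num) hab ha hb] at h
  have hd := hf.tendsto_deriv hR
  rw [h1] at hd
  have h2 := h.div hd one_ne_zero
  rw [div_one] at h2
  refine h2.congr' ?_
  filter_upwards [Ioo_mem_nhdsGT hR] with δ hδ
  exact mul_div_cancel_left₀ _ (hf.deriv_pos hδ).ne'

/-- The integral of 𝔉 over a nondegenerate interval is positive, while the normalising factor f'(δ)
tends to 0. -/
theorem tendsto_integral_of_cuspidal (h0 : derivWithin f (Ico 0 R) 0 = 0) {a b : ℝ} (hab : a < b)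
    (ha : -(Real.pi / 2) ≤ a) (hb : b ≤ Real.pi / 2) {S : Set ℝ} (hS : MeasurableSet S)
    (hSab : S ∩ Ioo (-(Real.pi / 2)) (Real.pi / 2) = Ioo a b) :
    Tendsto (fun δ => ∫ t in J δ ∩ angle (r δ) ⁻¹' S, ν δ t) (𝓝[>] 0) atTop := by
  have h := tendsto_integral_angle hR hf hc hRc hM hexit hosc hS
  rw [hSab] at h
  have hd := hf.tendsto_deriv hR
  rw [h0] at hd
  have hev : ∀ᶠ δ in 𝓝[>] 0, 0 < deriv f δ := by
    filter_upwards [Ioo_mem_nhdsGT hR] with δ hδ using hf.deriv_pos hδ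
  have hinv : Tendsto (fun δ => (deriv f δ)⁻¹) (𝓝[>] 0) atTop :=
    tendsto_inv_nhdsGT_zero.comp (tendsto_nhdsWithin_iff.2 ⟨hd, hev⟩)
  refine (h.pos_mul_atTop (integral_frakF_pos hR hf hosc hab ha hb) hinv).congr' ?_
  filter_upwards [hev] with δ hδ
  rw [mul_comm, inv_mul_cancel_left₀ hδ.ne']

/-- Rescaled time `T` does not suffice to get past the angles ±x, so cos θ ≥ cos x > 0 during that
time, and `eventually_radius_lt` applies. -/
theorem eventually_radius_lt_of_time {x T ρ : ℝ} (hx : x ∈ Ioo 0 (Real.pi / 2)) (hρ : 0 < ρ)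
    (h₁ : ∀ᶠ δ in 𝓝[>] 0, T < ∫ t in J δ ∩ angle (r δ) ⁻¹' Ioo 0 x, ν δ t)
    (h₂ : ∀ᶠ δ in 𝓝[>] 0, T < ∫ t in J δ ∩ angle (r δ) ⁻¹' Ioo (-x) 0, ν δ t) :
    ∀ᶠ δ in 𝓝[>] 0, ∀ t ∈ J δ, |∫ u in (0 : ℝ)..t, ν δ u| ≤ T → r δ t < ρ := by
  have hcos : 0 < Real.cos x := Real.cos_pos_of_mem_Ioo ⟨by linarith [hx.1, Real.pi_pos], hx.2⟩
  filter_upwards [h₁, h₂, eventually_radius_lt hR hf hc hRc hM hcos hρ, Ioo_mem_nhdsGT hR]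
    with δ h3 h4 h5 hδ t ht hT
  refine h5 t ht ?_
  rw [← Real.cos_abs (angle (r δ) t)]
  exact Real.cos_le_cos_of_nonneg_of_le_pi (abs_nonneg _) (by linarith [hx.2, Real.pi_pos])
    ((hM δ hδ).abs_angle_le hf hc hRc h3 h4 ht hT)

theorem eventually_radius_lt_of_conical (h1 : derivWithin f (Ico 0 R) 0 = 1) {T ρ : ℝ}
    (hT : T < Real.pi / 2) (hρ : 0 < ρ) :
    ∀ᶠ δ in 𝓝[>] 0, ∀ t ∈ J δ, |∫ u in (0 : ℝ)..t, ν δ u| ≤ T → r δ t < ρ := by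
  -- The rescaled time spent at angles in (0, x) tends to x, so x has to exceed T, and also be
  -- positive in case T is not.
  obtain ⟨x, hx1, hx2⟩ := exists_between (max_lt hT (by linarith [Real.pi_pos] : (0 : ℝ) < Real.pi / 2))
  have hx0 : 0 < x := (le_max_right _ _).trans_lt hx1
  have hTx : T < x := (le_max_left _ _).trans_lt hx1
  refine eventually_radius_lt_of_time hR hf hc hRc hosc hM hexit ⟨hx0, hx2⟩ hρ ?_ ?_
  · refine (tendsto_integral_of_conical hR hf hc hRc hosc hM hexit h1 (a := 0) (b := x) hx0.le
      (by linarith) hx2.le measurableSet_Ioo ?_).eventually (lt_mem_nhds (by linarith))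
    exact inter_eq_left.2 (Ioo_subset_Ioo (by linarith) hx2.le)
  · refine (tendsto_integral_of_conical hR hf hc hRc hosc hM hexit h1 (a := -x) (b := 0) (by linarith)
      (by linarith) (by linarith) measurableSet_Ioo ?_).eventually (lt_mem_nhds (by linarith))
    exact inter_eq_left.2 (Ioo_subset_Ioo (by linarith) (by linarith))

theorem eventually_radius_lt_of_cuspidal (h0 : derivWithin f (Ico 0 R) 0 = 0) {ρ : ℝ} (T : ℝ)
    (hρ : 0 < ρ) :
    ∀ᶠ δ in 𝓝[>] 0, ∀ t ∈ J δ, |∫ u in (0 : ℝ)..t, ν δ u| ≤ T → r δ t < ρ := by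
  obtain ⟨x, hx0, hx2⟩ := exists_between (by linarith [Real.pi_pos] : (0 : ℝ) < Real.pi / 2)
  refine eventually_radius_lt_of_time hR hf hc hRc hosc hM hexit ⟨hx0, hx2⟩ hρ ?_ ?_
  · refine (tendsto_integral_of_cuspidal hR hf hc hRc hosc hM hexit h0 (a := 0) (b := x) hx0
      (by linarith) hx2.le measurableSet_Ioo ?_).eventually_gt_atTop T
    exact inter_eq_left.2 (Ioo_subset_Ioo (by linarith) hx2.le)
  · refine (tendsto_integral_of_cuspidal hR hf hc hRc hosc hM hexit h0 (a := -x) (b := 0) (by linarith)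
      (by linarith) (by linarith) measurableSet_Ioo ?_).eventually_gt_atTop T
    exact inter_eq_left.2 (Ioo_subset_Ioo (by linarith) (by linarith))

theorem endpointsTendsto_of_tendsto {la lb : Filter ℝ}
    (ha : Tendsto (fun δ => -∫ t in J δ ∩ angle (r δ) ⁻¹' Iio 0, ν δ t) (𝓝[>] 0) la)
    (hb : Tendsto (fun δ => ∫ t in J δ ∩ angle (r δ) ⁻¹' Ioi 0, ν δ t) (𝓝[>] 0) lb) :
    EndpointsTendsto R (fun δ => (fun t => ∫ u in (0 : ℝ)..t, ν δ u) '' J δ) la lb := by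
  refine ⟨_, _, fun δ hδ => (hM δ hδ).image_time hf hc hRc, ?_, ?_⟩
  · refine ha.congr' ?_
    filter_upwards [Ioo_mem_nhdsGT hR] with δ hδ
    rw [(hM δ hδ).inter_angle_neg hf hc hRc, ← integral_Ioc_eq_integral_Ioo,
      intervalIntegral.integral_of_ge ((hM δ hδ).zero_mem_Icc hf hc hRc).1.le]
  · refine hb.congr' ?_
    filter_upwards [Ioo_mem_nhdsGT hR] with δ hδ
    rw [(hM δ hδ).inter_angle_pos hf hc hRc, ← integral_Ioc_eq_integral_Ioo,
      intervalIntegral.integral_of_le ((hM δ hδ).zero_mem_Icc hf hc hRc).2.le]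

theorem endpointsTendsto_of_conical (h1 : derivWithin f (Ico 0 R) 0 = 1) :
    EndpointsTendsto R (fun δ => (fun t => ∫ u in (0 : ℝ)..t, ν δ u) '' J δ)
      (𝓝 (-(Real.pi / 2))) (𝓝 (Real.pi / 2)) := by
  have hpi := Real.pi_pos
  refine endpointsTendsto_of_tendsto hR hf hc hRc hosc hM hexit ?_ ?_
  · refine Tendsto.neg ?_
    have := tendsto_integral_of_conical hR hf hc hRc hosc hM hexit h1 (a := -(Real.pi / 2)) (b := 0)
      (by linarith) le_rfl (by linarith) measurableSet_Iio (by
        ext x; simp only [mem_inter_iff, mem_Iio, mem_Ioo]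
        exact ⟨fun h => ⟨h.2.1, h.1⟩, fun h => ⟨h.2, h.1, by linarith [h.2]⟩⟩)
    rwa [zero_sub, neg_neg] at this
  · have := tendsto_integral_of_conical hR hf hc hRc hosc hM hexit h1 (a := 0) (b := Real.pi / 2)
      (by linarith) (by linarith) le_rfl measurableSet_Ioi (by
        ext x; simp only [mem_inter_iff, mem_Ioi, mem_Ioo]
        exact ⟨fun h => ⟨h.1, h.2.2⟩, fun h => ⟨h.1, by linarith [h.1], h.2⟩⟩)
    rwa [sub_zero] at this

theorem endpointsTendsto_of_cuspidal (h0 : derivWithin f (Ico 0 R) 0 = 0) :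
    EndpointsTendsto R (fun δ => (fun t => ∫ u in (0 : ℝ)..t, ν δ u) '' J δ) atBot atTop := by
  have hpi := Real.pi_pos
  refine endpointsTendsto_of_tendsto hR hf hc hRc hosc hM hexit ?_ ?_
  · refine tendsto_neg_atTop_atBot.comp ?_
    exact tendsto_integral_of_cuspidal hR hf hc hRc hosc hM hexit h0 (a := -(Real.pi / 2)) (b := 0)
      (by linarith) le_rfl (by linarith) measurableSet_Iio (by
        ext x; simp only [mem_inter_iff, mem_Iio, mem_Ioo]
        exact ⟨fun h => ⟨h.2.1, h.1⟩, fun h => ⟨h.2, h.1, by linarith [h.2]⟩⟩)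
  · exact tendsto_integral_of_cuspidal hR hf hc hRc hosc hM hexit h0 (a := 0) (b := Real.pi / 2)
      (by linarith) (by linarith) le_rfl measurableSet_Ioi (by
        ext x; simp only [mem_inter_iff, mem_Ioi, mem_Ioo]
        exact ⟨fun h => ⟨h.1, h.2.2⟩, fun h => ⟨h.1, by linarith [h.1], h.2⟩⟩)

end Limits

end WarpedGeodesics

namespace WarpedGeodesics

/-! ### Approximate solutions of an autonomous differential equation. -/

section Gronwall

variable {E : Type*} [NormedAddCommGroup E] [NormedSpace ℝ E]

theorem dist_le_of_approx_solution_of_le {X : E → E} {Q : Set E} {K : NNReal}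
    (hX : LipschitzOnWith K X Q) {Z Z' W : ℝ → E} {a b ε : ℝ} (hε : 0 ≤ ε)
    (hZ : ∀ s ∈ Icc a b, HasDerivAt Z (Z' s) s ∧ Z s ∈ Q ∧ ‖Z' s - X (Z s)‖ ≤ ε)
    (hW : ∀ s ∈ Icc a b, HasDerivAt W (X (W s)) s ∧ W s ∈ Q) (hab : a ≤ b) :
    dist (Z b) (W b) ≤ (dist (Z a) (W a) + ε) * Real.exp ((K + 1) * (b - a)) := by
  -- Enlarging the constant avoids the separate formula for the Gronwall bound at Lipschitz constant
  -- 0, and makes ε/(K + 1) ≤ ε.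
  have hX' : LipschitzOnWith (K + 1) X Q := hX.weaken (by simp)
  have h := dist_le_of_approx_trajectories_ODE_of_mem (v := fun _ => X) (s := fun _ => Q) (εf := ε)
    (εg := 0) (fun t _ => hX') (fun t ht => (hZ t ht).1.continuousAt.continuousWithinAt)
    (fun t ht => (hZ t (Ico_subset_Icc_self ht)).1.hasDerivWithinAt)
    (fun t ht => by rw [dist_eq_norm]; exact (hZ t (Ico_subset_Icc_self ht)).2.2)
    (fun t ht => (hZ t (Ico_subset_Icc_self ht)).2.1)
    (fun t ht => (hW t ht).1.continuousAt.continuousWithinAt)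
    (fun t ht => (hW t (Ico_subset_Icc_self ht)).1.hasDerivWithinAt)
    (fun t ht => (dist_self _).le) (fun t ht => (hW t (Ico_subset_Icc_self ht)).2) le_rfl
    b (right_mem_Icc.2 hab)
  have hK : (0 : ℝ) < ((K + 1 : NNReal) : ℝ) := by positivity
  have hK1 : (1 : ℝ) ≤ ((K + 1 : NNReal) : ℝ) := by simp
  rw [gronwallBound_of_K_ne_0 hK.ne', add_zero] at h
  refine h.trans ?_
  have hexp := Real.exp_pos ((((K + 1 : NNReal) : ℝ)) * (b - a))
  rw [add_mul]
  push_cast at *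
  refine add_le_add le_rfl ?_
  calc ε / (K + 1) * (Real.exp ((K + 1) * (b - a)) - 1)
      ≤ ε / (K + 1) * Real.exp ((K + 1) * (b - a)) :=
        mul_le_mul_of_nonneg_left (by linarith) (by positivity)
    _ ≤ ε * Real.exp ((K + 1) * (b - a)) :=
        mul_le_mul_of_nonneg_right (div_le_self hε hK1) hexp.le

/-- Gronwall's inequality for an approximate and an exact solution of an autonomous differential
equation, in both time directions. -/
theorem dist_le_of_approx_solution {X : E → E} {Q : Set E} {K : NNReal}
    (hX : LipschitzOnWith K X Q) {Z Z' W : ℝ → E} {D : Set ℝ} (hD : D.OrdConnected) {ε : ℝ}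
    (hε : 0 ≤ ε) (hZ : ∀ s ∈ D, HasDerivAt Z (Z' s) s ∧ Z s ∈ Q ∧ ‖Z' s - X (Z s)‖ ≤ ε)
    (hW : ∀ s ∈ D, HasDerivAt W (X (W s)) s ∧ W s ∈ Q) {s₁ s : ℝ} (hs₁ : s₁ ∈ D) (hs : s ∈ D) :
    dist (Z s) (W s) ≤ (dist (Z s₁) (W s₁) + ε) * Real.exp ((K + 1) * |s - s₁|) := by
  rcases le_total s₁ s with h | h
  · rw [abs_of_nonneg (sub_nonneg.2 h)]
    exact dist_le_of_approx_solution_of_le hX hε (fun u hu => hZ u (hD.out hs₁ hs hu))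
      (fun u hu => hW u (hD.out hs₁ hs hu)) h
  · have hmem : ∀ u ∈ Icc (-s₁) (-s), -u ∈ D := fun u hu =>
      hD.out hs hs₁ ⟨by linarith [hu.2], by linarith [hu.1]⟩
    -- Backwards in time both curves follow the field −X, which has the same Lipschitz constant.
    have h1 := dist_le_of_approx_solution_of_le (X := fun z => -X z) (Q := Q) (K := K)
      (Z := fun u => Z (-u)) (Z' := fun u => -Z' (-u)) (W := fun u => W (-u)) (a := -s₁) (b := -s)
      hX.neg hε (fun u hu => ?_) (fun u hu => ?_) (neg_le_neg h)
    · simp only [neg_neg] at h1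
      rw [abs_of_nonpos (sub_nonpos.2 h)]
      convert h1 using 4
      ring
    · obtain ⟨h2, h3, h4⟩ := hZ _ (hmem u hu)
      refine ⟨?_, h3, ?_⟩
      · exact (h2.scomp u (hasDerivAt_neg u)).congr_deriv (by simp)
      · rw [← neg_sub', norm_neg]; exact h4
    · obtain ⟨h2, h3⟩ := hW _ (hmem u hu)
      exact ⟨(h2.scomp u (hasDerivAt_neg u)).congr_deriv (by simp), h3⟩

end Gronwall

/-! ### Curves that stay in a chart, and velocities in the tangent bundle. -/

section Confinement

variable {E : Type*} [NormedAddCommGroup E] [NormedSpace ℝ E] [FiniteDimensional ℝ E]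
  {H : Type*} [TopologicalSpace H] {I : ModelWithCorners ℝ E H} [I.Boundaryless]
  {M : Type*} [TopologicalSpace M] [T2Space M] [ChartedSpace H M] [IsManifold I ∞ M] {y₀ : M} {ζ : ℝ → M}

/-- A curve that moves with bounded speed as long as it is in a ball in a chart, does not leave the
ball too early. -/
theorem mem_ball_of_norm_deriv_le {D : Set ℝ} (hD : D.OrdConnected) (hDo : IsOpen D)
    {s₁ ρ C : ℝ} {x : E} (hs₁ : s₁ ∈ D) (hζ : ∀ s ∈ D, ContinuousAt ζ s)
    (hball : Metric.closedBall x ρ ⊆ (extChartAt I y₀).target)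
    (h₁ : ζ s₁ ∈ (extChartAt I y₀).source)
    (hd : ∀ s ∈ D, ζ s ∈ (extChartAt I y₀).source → chartCurve I y₀ ζ s ∈ Metric.closedBall x ρ →
      HasDerivAt (chartCurve I y₀ ζ) (deriv (chartCurve I y₀ ζ) s) s ∧
        ‖deriv (chartCurve I y₀ ζ) s‖ ≤ C)
    (hlt : ∀ s ∈ D, dist (chartCurve I y₀ ζ s₁) x + C * |s - s₁| < ρ) :
    ∀ s ∈ D, ζ s ∈ (extChartAt I y₀).source ∧ chartCurve I y₀ ζ s ∈ Metric.ball x ρ := by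
  have : ProperSpace E := FiniteDimensional.proper ℝ E
  set O := {s | s ∈ D ∧ ζ s ∈ (extChartAt I y₀).source ∧ chartCurve I y₀ ζ s ∈ Metric.ball x ρ}
    with hO
  have hOopen : ∀ s ∈ O, O ∈ 𝓝 s := by
    rintro s ⟨hs, hsrc, hb⟩
    have hc : ContinuousAt (chartCurve I y₀ ζ) s :=
      ContinuousAt.comp (g := extChartAt I y₀) (continuousAt_extChartAt' hsrc) (hζ s hs)
    filter_upwards [hDo.mem_nhds hs, eventually_mem_source (hζ s hs) hsrc,
      hc.eventually (Metric.isOpen_ball.mem_nhds hb)] with u h1 h2 h3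
    exact ⟨h1, h2, h3⟩
  have hs₁O : s₁ ∈ O := ⟨hs₁, h₁, by simpa using hlt s₁ hs₁⟩
  -- Coordinates say nothing about a limit point that might lie outside the chart. The closed ball
  -- has compact, hence closed, image in the Hausdorff manifold, which keeps limit points inside.
  have hK : IsClosed ((extChartAt I y₀).symm '' Metric.closedBall x ρ) :=
    ((isCompact_closedBall x ρ).image_of_continuousOn
      ((continuousOn_extChartAt_symm y₀).mono hball)).isClosed
  -- The condition is imposed on the whole interval from `s₁`, because the mean value inequality
  -- needs the speed bound all along it.
  set u := {s | uIcc s₁ s ⊆ O} with hu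
  suffices h : D ⊆ u from fun s hs => (h hs right_mem_uIcc).2
  refine hD.isPreconnected.subset_of_closure_inter_subset ?_ ⟨s₁, hs₁, ?_⟩ ?_
  · refine isOpen_iff_mem_nhds.2 fun s hs => ?_
    obtain ⟨η, hη, hball'⟩ := Metric.mem_nhds_iff.1 (hOopen s (hs right_mem_uIcc))
    filter_upwards [Metric.ball_mem_nhds s hη] with s' hs'
    refine uIcc_subset_uIcc_union_uIcc.trans (union_subset hs (Subset.trans ?_ hball'))
    exact ((convex_ball s η).ordConnected).uIcc_subset (Metric.mem_ball_self hη) hs'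
  · simpa [hu] using hs₁O
  · rintro s ⟨hcl, hs⟩
    have hlow : ∀ v ∈ uIcc s₁ s, v ≠ s → v ∈ O := by
      intro v hv hvs
      obtain ⟨s', hs'u, hs'⟩ := Metric.mem_closure_iff.1 hcl |v - s| (abs_pos.2 (sub_ne_zero.2 hvs))
      refine hs'u ?_
      rw [Real.dist_eq] at hs'
      rw [mem_uIcc] at hv ⊢
      rcases hv with ⟨h1, h2⟩ | ⟨h1, h2⟩
      · rw [abs_of_nonpos (by linarith : v - s ≤ 0)] at hs'
        exact Or.inl ⟨h1, by linarith [le_abs_self (s - s')]⟩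
      · rw [abs_of_nonneg (by linarith : 0 ≤ v - s)] at hs'
        exact Or.inr ⟨by linarith [neg_abs_le (s - s')], h2⟩
    rcases eq_or_ne s s₁ with rfl | hne
    · simpa [hu] using hs₁O
    have hsK : ζ s ∈ (extChartAt I y₀).symm '' Metric.closedBall x ρ := by
      have hfreq : ∃ᶠ v in 𝓝 s, ζ v ∈ (extChartAt I y₀).symm '' Metric.closedBall x ρ := by
        have hcl' : s ∈ closure (uIoo s₁ s) := by
          rw [uIoo, closure_Ioo (by simpa using hne.symm)]
          exact right_mem_uIcc
        refine (mem_closure_iff_frequently.1 hcl').mono fun v hv => ?_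
        have hvO := hlow v (Ioo_subset_Icc_self hv) (by
          rintro rfl
          rcases le_total s₁ v with h | h
          · exact absurd hv.2 (by simp [h])
          · exact absurd hv.1 (by simp [h]))
        exact ⟨_, Metric.ball_subset_closedBall hvO.2.2, (extChartAt I y₀).left_inv hvO.2.1⟩
      exact hK.mem_of_frequently_of_tendsto hfreq (hζ s hs)
    obtain ⟨e, he, hes⟩ := hsK
    have hsrc : ζ s ∈ (extChartAt I y₀).source := hes ▸ (extChartAt I y₀).map_target (hball he)
    have hsb : chartCurve I y₀ ζ s ∈ Metric.closedBall x ρ := by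
      rw [chartCurve, ← hes, (extChartAt I y₀).right_inv (hball he)]; exact he
    have hall : ∀ v ∈ uIcc s₁ s, HasDerivAt (chartCurve I y₀ ζ) (deriv (chartCurve I y₀ ζ) v) v ∧
        ‖deriv (chartCurve I y₀ ζ) v‖ ≤ C := by
      intro v hv
      rcases eq_or_ne v s with rfl | hvs
      · exact hd v hs hsrc hsb
      · have hvO := hlow v hv hvs
        exact hd v hvO.1 hvO.2.1 (Metric.ball_subset_closedBall hvO.2.2)
    -- The displacement is at most C |s − s₁|, so by `hlt` the curve is still in the open ball at
    -- time `s`.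
    have hmv := (convex_uIcc s₁ s).norm_image_sub_le_of_norm_hasDerivWithin_le
      (fun v hv => (hall v hv).1.hasDerivWithinAt) (fun v hv => (hall v hv).2)
      left_mem_uIcc right_mem_uIcc
    have hsO : s ∈ O := by
      refine ⟨hs, hsrc, ?_⟩
      rw [Metric.mem_ball]
      rw [← dist_eq_norm, Real.norm_eq_abs] at hmv
      linarith [dist_triangle (chartCurve I y₀ ζ s) (chartCurve I y₀ ζ s₁) x, hlt s hs]
    intro v hv
    rcases eq_or_ne v s with rfl | hvs
    · exact hsO
    · exact hlow v hv hvs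

end Confinement

section Velocity

variable {E : Type*} [NormedAddCommGroup E] [NormedSpace ℝ E]
  {H : Type*} [TopologicalSpace H] {I : ModelWithCorners ℝ E H} [I.Boundaryless]
  {M : Type*} [TopologicalSpace M] [ChartedSpace H M] [IsManifold I ∞ M] {x₀ : M}
  {γ : ℝ → M} {t : ℝ}

/-- Expresses convergence in the tangent bundle through derivatives of coordinates. -/
theorem trivializationAt_velocity [IsManifold I 1 M] (hγ : MDifferentiableAt 𝓘(ℝ, ℝ) I γ t)
    (hx : γ t ∈ (extChartAt I x₀).source) :
    (trivializationAt E (TangentSpace I) x₀ (⟨γ t, velocity I γ t⟩ : TangentBundle I M)).2 =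
      deriv (chartCurve I x₀ γ) t := by
  have hu : chartCurve I x₀ γ t ∈ (extChartAt I x₀).target := (extChartAt I x₀).map_source hx
  have hb : (extChartAt I x₀).symm (chartCurve I x₀ γ t) ∈
      (trivializationAt E (TangentSpace I) x₀).baseSet := by
    rw [TangentBundle.trivializationAt_baseSet, ← extChartAt_source I]
    exact (extChartAt I x₀).map_target hu
  have h1 : (⟨γ t, velocity I γ t⟩ : TangentBundle I M) =
      ⟨(extChartAt I x₀).symm (chartCurve I x₀ γ t),
        (trivializationAt E (TangentSpace I) x₀).symm
          ((extChartAt I x₀).symm (chartCurve I x₀ γ t)) (deriv (chartCurve I x₀ γ) t)⟩ := by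
    refine tangentBundle_mk_eq ((extChartAt I x₀).left_inv hx).symm ?_
    rw [← Trivialization.symmL_apply (R := ℝ) _ hb, symmL_trivializationAt_eq_chartDeriv hu]
    exact (chartDeriv_deriv_chartCurve hγ hx).symm
  rw [h1, Trivialization.apply_mk_symm _ hb]

end Velocity

end WarpedGeodesics

namespace WarpedGeodesics

/-! ### The angular component in rescaled time. -/

section Reparametrisation

variable {m : ℕ} {Y : Type*} [TopologicalSpace Y] [ChartedSpace (EuclideanSpace ℝ (Fin m)) Y]
  [IsManifold (𝓡 m) ∞ Y] {R c δ : ℝ} {f : ℝ → ℝ} {h : ℝ → RiemMetric m Y}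
  {γ : ℝ → ℝ × Y} {J : Set ℝ} {s t : ℝ} {y₀ : Y}

/-- The time at which the rescaled time has a given value. -/
def reparamTime (h : ℝ → RiemMetric m Y) (γ : ℝ → ℝ × Y) (J : Set ℝ) (s : ℝ) : ℝ :=
  Function.invFunOn (projTime h γ) J s

/-- The radius as a function of the rescaled time. -/
def reparamRadius (h : ℝ → RiemMetric m Y) (γ : ℝ → ℝ × Y) (J : Set ℝ) (s : ℝ) : ℝ :=
  (γ (reparamTime h γ J s)).1

/-- The angular momentum divided by its initial value, as a function of the rescaled time. -/
def reparamFactor (f : ℝ → ℝ) (h : ℝ → RiemMetric m Y) (γ : ℝ → ℝ × Y) (J : Set ℝ) (s : ℝ) : ℝ :=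
  f (reparamRadius h γ J s) ^ 2 * projSpeed h γ (reparamTime h γ J s) / f (γ 0).1

/-- Position and normalised momentum of the reparametrised angular component. -/
def reparamState (f : ℝ → ℝ) (h : ℝ → RiemMetric m Y) (γ : ℝ → ℝ × Y) (J : Set ℝ) (y₀ : Y)
    (s : ℝ) : EuclideanSpace ℝ (Fin m) × (EuclideanSpace ℝ (Fin m) →L[ℝ] ℝ) :=
  (chartCurve (𝓡 m) y₀ (projReparam h γ J) s, reparamFactor f h γ J s •
    famForm h y₀ (reparamRadius h γ J s, chartCurve (𝓡 m) y₀ (projReparam h γ J) s)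
      (deriv (chartCurve (𝓡 m) y₀ (projReparam h γ J)) s))

variable (hf : IsWarpingFunction R f) (hg : IsGeneralizedWarpedProduct R f h) (hc : 0 ≤ c)
  (hRc : R * c < 1) (M : RadialMotion R c f δ (fun t => (γ t).1) (projSpeed h γ) J)
  (hγ : IsGeodesicOn (𝓘(ℝ, ℝ).prod (𝓡 m)) (warpedMetric f h) γ J)
include hf hc hRc M

theorem reparamTime_mem (hs : s ∈ projTime h γ '' J) : reparamTime h γ J s ∈ J :=
  Function.invFunOn_mem hs

theorem strictMonoOn_projTime : StrictMonoOn (projTime h γ) J :=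
  (M.strictMonoOn_time hf hc hRc).mono fun t ht => by
    rw [M.eq_Ioo hf hc hRc] at ht; exact Ioo_subset_Icc_self ht

theorem reparamTime_projTime (ht : t ∈ J) : reparamTime h γ J (projTime h γ t) = t :=
  (strictMonoOn_projTime hf hc hRc M).injOn.leftInvOn_invFunOn ht

theorem isOpen_image_projTime : IsOpen (projTime h γ '' J) := by
  have := M.image_time hf hc hRc
  change projTime h γ '' J = _ at this
  rw [this]; exact isOpen_Ioo

theorem hasDerivAt_reparamTime (hs : s ∈ projTime h γ '' J) :
    HasDerivAt (reparamTime h γ J) (projSpeed h γ (reparamTime h γ J s))⁻¹ s := by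
  obtain ⟨t, ht, rfl⟩ := hs
  rw [reparamTime_projTime hf hc hRc M ht]
  have h1 : HasStrictDerivAt (projTime h γ) (projSpeed h γ t) t :=
    hasStrictDerivAt_of_hasDerivAt_of_continuousAt
      (Filter.Eventually.mono (M.isOpen.mem_nhds ht) fun u hu => M.hasDerivAt_time hf hc hRc hu)
      ((M.continuousOn_speed hf).continuousAt (M.isOpen.mem_nhds ht))
  refine (h1.to_local_left_inverse (M.speed_pos hf hc ht).ne' ?_).hasDerivAt
  filter_upwards [M.isOpen.mem_nhds ht] with u hu using reparamTime_projTime hf hc hRc M hu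

/-- The bounds on the angular momentum after division by its initial value f(δ); they force the
factor to 1 as the radius tends to 0. -/
theorem reparamFactor_bounds (hs : s ∈ projTime h γ '' J) :
    Real.exp (-(c * reparamRadius h γ J s)) ≤ reparamFactor f h γ J s ∧
      reparamFactor f h γ J s ≤ Real.exp (c * reparamRadius h γ J s) := by
  have ht := reparamTime_mem hf hc hRc M hs
  have h1 := M.angularMomentum_bounds hf hc hRc ht
  have h2 := hf.pos δ M.delta_mem
  have h3 : c * (reparamRadius h γ J s - δ) ≤ c * reparamRadius h γ J s :=
    mul_le_mul_of_nonneg_left (by linarith [M.delta_mem.1]) hc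
  have h4 : (γ 0).1 = δ := M.start
  rw [reparamFactor, h4, le_div_iff₀ h2, div_le_iff₀ h2, mul_comm _ (f δ), mul_comm _ (f δ)]
  exact ⟨(mul_le_mul_of_nonneg_left (Real.exp_le_exp.2 (neg_le_neg h3)) h2.le).trans h1.1,
    h1.2.trans (mul_le_mul_of_nonneg_left (Real.exp_le_exp.2 h3) h2.le)⟩

theorem reparamRadius_mem (hs : s ∈ projTime h γ '' J) : reparamRadius h γ J s ∈ Ioo 0 R :=
  M.mem _ (reparamTime_mem hf hc hRc M hs)

include hγ

theorem mdifferentiableAt_projReparam (hs : s ∈ projTime h γ '' J) :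
    MDifferentiableAt 𝓘(ℝ, ℝ) (𝓡 m) (projReparam h γ J) s :=
  (mdifferentiableAt_angular M.isOpen hγ (reparamTime_mem hf hc hRc M hs)).comp
    (f := reparamTime h γ J) s (hasDerivAt_reparamTime hf hc hRc M hs).differentiableAt.mdifferentiableAt

theorem hasDerivAt_chartCurve_projReparam (hs : s ∈ projTime h γ '' J)
    (hy : projReparam h γ J s ∈ (extChartAt (𝓡 m) y₀).source) :
    HasDerivAt (chartCurve (𝓡 m) y₀ (projReparam h γ J))
      ((projSpeed h γ (reparamTime h γ J s))⁻¹ •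
        deriv (angCurve m y₀ γ) (reparamTime h γ J s)) s :=
  (hasDerivAt_angCurve M.isOpen hγ (reparamTime_mem hf hc hRc M hs) hy).scomp s
    (hasDerivAt_reparamTime hf hc hRc M hs)

theorem famForm_deriv_projReparam (hs : s ∈ projTime h γ '' J)
    (hy : projReparam h γ J s ∈ (extChartAt (𝓡 m) y₀).source) :
    famForm h y₀ (reparamRadius h γ J s, chartCurve (𝓡 m) y₀ (projReparam h γ J) s)
      (deriv (chartCurve (𝓡 m) y₀ (projReparam h γ J)) s)
      (deriv (chartCurve (𝓡 m) y₀ (projReparam h γ J)) s) = 1 := by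
  have ht := reparamTime_mem hf hc hRc M hs
  rw [(hasDerivAt_chartCurve_projReparam hf hc hRc M hγ hs hy).deriv]
  have h1 := famForm_deriv_angCurve (h := h) M.isOpen hγ ht hy
  simp only [map_smul, _root_.smul_apply, smul_eq_mul]
  have h2 : famForm h y₀ (reparamRadius h γ J s, chartCurve (𝓡 m) y₀ (projReparam h γ J) s)
      (deriv (angCurve m y₀ γ) (reparamTime h γ J s)) (deriv (angCurve m y₀ γ) (reparamTime h γ J s))
      = projSpeed h γ (reparamTime h γ J s) ^ 2 := h1
  have h3 := (M.speed_pos hf hc ht).ne'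
  rw [h2]
  field_simp

include hg in
-- With dξ/ds = ξ'/ν, the normalised momentum (f² ν / f(δ)) h(dξ/ds, ·) equals f² h(ξ', ·)/f(δ), a
-- constant multiple of the original momentum. So the angular equation need only be divided by ν,
-- and the factor f² ν / f(δ) itself is never differentiated.
theorem hasDerivAt_reparamState (hs : s ∈ projTime h γ '' J)
    (hy : projReparam h γ J s ∈ (extChartAt (𝓡 m) y₀).source) :
    HasDerivAt (reparamState f h γ J y₀) (deriv (chartCurve (𝓡 m) y₀ (projReparam h γ J)) s,
      (1 / 2 * reparamFactor f h γ J s) • sqCovector (fderiv ℝ (fun u =>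
        famForm h y₀ (reparamRadius h γ J s, u)) (chartCurve (𝓡 m) y₀ (projReparam h γ J) s))
        (deriv (chartCurve (𝓡 m) y₀ (projReparam h γ J)) s)) s := by
  have ht := reparamTime_mem hf hc hRc M hs
  have h1 := hasDerivAt_chartCurve_projReparam hf hc hRc M hγ hs hy
  have hU : MapsTo γ J (Ioo 0 R ×ˢ univ) := fun t ht => ⟨M.mem t ht, mem_univ _⟩
  have h2 := (hasDerivAt_angular_momentum (y₀ := y₀) hf hg M.isOpen hγ hU ht hy).scomp s
    (hasDerivAt_reparamTime hf hc hRc M hs)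
  have hd : HasDerivAt (chartCurve (𝓡 m) y₀ (projReparam h γ J))
      (deriv (chartCurve (𝓡 m) y₀ (projReparam h γ J)) s) s := by rw [h1.deriv]; exact h1
  refine HasDerivAt.prodMk hd ?_
  have hev : (fun s => reparamFactor f h γ J s •
      famForm h y₀ (reparamRadius h γ J s, chartCurve (𝓡 m) y₀ (projReparam h γ J) s)
      (deriv (chartCurve (𝓡 m) y₀ (projReparam h γ J)) s)) =ᶠ[𝓝 s] fun s => (f (γ 0).1)⁻¹ •
        (((fun s => f (γ s).1 ^ 2 • famForm h y₀ ((γ s).1, angCurve m y₀ γ s)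
          (deriv (angCurve m y₀ γ) s)) ∘ reparamTime h γ J) s) := by
    filter_upwards [(isOpen_image_projTime hf hc hRc M).mem_nhds hs, eventually_mem_source
      (mdifferentiableAt_projReparam hf hc hRc M hγ hs).continuousAt hy] with u hu hyu
    have hν := (M.speed_pos hf hc (reparamTime_mem hf hc hRc M hu)).ne'
    rw [(hasDerivAt_chartCurve_projReparam hf hc hRc M hγ hu hyu).deriv, map_smul, smul_smul,
      Function.comp, smul_smul]
    congr 1
    rw [reparamFactor, div_eq_mul_inv, mul_right_comm, mul_inv_cancel_right₀ hν, mul_comm]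
    rfl
  refine ((h2.const_smul (f (γ 0).1)⁻¹).congr_of_eventuallyEq hev).congr_deriv ?_
  rw [h1.deriv]
  ext w
  have hν := (M.speed_pos hf hc ht).ne'
  have hν' : projSpeed h γ (reparamTime h γ J s) ≠ 0 := hν
  simp only [_root_.smul_apply, sqCovector_apply, map_smul, smul_eq_mul, reparamFactor]
  change _ = 1 / 2 * (f (γ (reparamTime h γ J s)).1 ^ 2 * _ / _) * (_ * (_ * fderiv ℝ (fun u => famForm h y₀ ((γ (reparamTime h γ J s)).1, u))
    (angCurve m y₀ γ (reparamTime h γ J s)) w _ _))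
  field_simp

end Reparametrisation

end WarpedGeodesics

namespace WarpedGeodesics

/-! ### The error compared with the geodesic field of the limit metric. -/

section PartialDerivative

variable {E G : Type*} [NormedAddCommGroup E] [NormedSpace ℝ E] [NormedAddCommGroup G]
  [NormedSpace ℝ G]

/-- At r = 0 the map has only a one-sided derivative in r. Its restriction to vertical directions is
the partial derivative in u, and inherits continuity up to r = 0. -/
theorem continuousOn_fderiv_snd {A : ℝ × E → G} {R : ℝ} {U : Set E} (hU : IsOpen U)
    (hA : ContDiffOn ℝ 1 A (Ico 0 R ×ˢ U)) :
    ContinuousOn (fun q : ℝ × E => fderiv ℝ (fun u => A (q.1, u)) q.2) (Ico 0 R ×ˢ U) := by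
  have hun : UniqueDiffOn ℝ (Ico 0 R ×ˢ U) := (uniqueDiffOn_Ico 0 R).prod hU.uniqueDiffOn
  have h1 := hA.continuousOn_fderivWithin hun le_rfl
  have h2 : ContinuousOn (fun q => (fderivWithin ℝ A (Ico 0 R ×ˢ U) q).comp
      (ContinuousLinearMap.inr ℝ ℝ E)) (Ico 0 R ×ˢ U) := h1.clm_comp continuousOn_const
  refine h2.congr fun q hq => ?_
  have h3 : HasFDerivWithinAt A (fderivWithin ℝ A (Ico 0 R ×ˢ U) q) (Ico 0 R ×ˢ U) (q.1, q.2) :=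
    ((hA.differentiableOn (by simp)) q hq).hasFDerivWithinAt
  have h4 : HasFDerivWithinAt (fun u : E => (q.1, u)) (ContinuousLinearMap.inr ℝ ℝ E) U q.2 :=
    (hasFDerivAt_prodMk_right q.1 q.2).hasFDerivWithinAt
  have h5 := HasFDerivWithinAt.comp q.2 h3 h4 fun u hu => ⟨hq.1, hu⟩
  exact (h5.hasFDerivAt (hU.mem_nhds hq.2)).fderiv

/-- The tube lemma: `F` vanishes on the compact slice over `p`, so it is uniformly small over points
of `A` near `p`. -/
theorem exists_forall_norm_le_of_continuousOn {P K : Type*} [TopologicalSpace P]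
    [TopologicalSpace K] {A : Set P} {B : Set K} (hB : IsCompact B) {F : P × K → G}
    (hF : ContinuousOn F (A ×ˢ B)) {p : P} (hp : p ∈ A) (h0 : ∀ k ∈ B, F (p, k) = 0) {ε : ℝ}
    (hε : 0 < ε) : ∀ᶠ q in 𝓝 p, ∀ k ∈ B, q ∈ A → ‖F (q, k)‖ ≤ ε := by
  have h := hB.eventually_forall_of_forall_eventually (x₀ := p)
    (P := fun q k => (q, k) ∈ A ×ˢ B → ‖F (q, k)‖ ≤ ε) fun k hk => by
      have h1 := (hF (p, k) ⟨hp, hk⟩).norm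
      rw [ContinuousWithinAt, h0 k hk, norm_zero] at h1
      exact eventually_nhdsWithin_iff.1 (h1.eventually (ge_mem_nhds hε))
  filter_upwards [h] with q hq k hk hqA using hq k hk ⟨hqA, hk⟩

theorem exists_lipschitzOnWith_of_contDiffAt {X : E → G} {Q : Set E} (hQ : IsCompact Q)
    (hQc : Convex ℝ Q) (hX : ∀ z ∈ Q, ContDiffAt ℝ 1 X z) : ∃ K, LipschitzOnWith K X Q := by
  have hcont : ContinuousOn (fderiv ℝ X) Q := fun z hz =>
    ((hX z hz).fderiv_right (m := 0) (by norm_num)).continuousAt.continuousWithinAt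
  obtain ⟨C, hC⟩ := hQ.exists_bound_of_continuousOn hcont
  exact ⟨C.toNNReal, hQc.lipschitzOnWith_of_nnnorm_fderiv_le
    (fun z hz => (hX z hz).differentiableAt (by simp))
    fun z hz => by rw [← NNReal.coe_le_coe]; exact (hC z hz).trans (Real.le_coe_toNNReal C)⟩

end PartialDerivative

section FieldError

variable {E : Type*} [NormedAddCommGroup E] [NormedSpace ℝ E]

/-- The difference between the derivative of the state of a reparametrised angular component
and the geodesic vector field of the limit metric, for a family `A` of metrics in coordinates. -/
def fieldError (A : ℝ × E → E →L[ℝ] E →L[ℝ] ℝ) (q : (ℝ × ℝ) × (E × E)) : E × (E →L[ℝ] ℝ) :=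
  (q.2.2, (1 / 2 * q.1.1) • sqCovector (fderiv ℝ (fun u => A (q.1.2, u)) q.2.1) q.2.2) -
    hamField (fun u => A (0, u)) (q.2.1, q.1.1 • A (q.1.2, q.2.1) q.2.2)

/-- With factor 1 and radius 0 the momentum is exactly the one associated with `v` by the limit
metric, so both fields coincide. Continuity then makes the error small near these values. -/
theorem fieldError_eq_zero [FiniteDimensional ℝ E] {A : ℝ × E → E →L[ℝ] E →L[ℝ] ℝ} {ξ v : E}
    (hξ : ∀ v, v ≠ 0 → 0 < A (0, ξ) v v) : fieldError A ((1, 0), (ξ, v)) = 0 := by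
  have h1 : (A (0, ξ)).inverse (A (0, ξ) v) = v := inverse_apply_of_pos hξ v
  simp only [fieldError, hamField, one_smul, mul_one]
  rw [h1, sub_self]

theorem continuous_sqCovector :
    Continuous fun p : (E →L[ℝ] E →L[ℝ] E →L[ℝ] ℝ) × E => sqCovector p.1 p.2 :=
  continuous_iff_continuousAt.2 fun _ =>
    (ContDiffAt.sqCovector (n := 0) contDiffAt_fst contDiffAt_snd).continuousAt

theorem continuousOn_fieldError {A : ℝ × E → E →L[ℝ] E →L[ℝ] ℝ} {R : ℝ} {U : Set E}
    (hU : IsOpen U) (hA : ContDiffOn ℝ 1 A (Ico 0 R ×ˢ U))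
    (hX : ∀ z : E × (E →L[ℝ] ℝ), z.1 ∈ U → ContinuousAt (hamField fun u => A (0, u)) z) :
    ContinuousOn (fieldError A) ((univ ×ˢ Ico 0 R) ×ˢ (U ×ˢ univ)) := by
  set S : Set ((ℝ × ℝ) × (E × E)) := (univ ×ˢ Ico 0 R) ×ˢ (U ×ˢ univ) with hS
  have hv : ContinuousOn (fun q : (ℝ × ℝ) × (E × E) => q.2.2) S :=
    (continuous_snd.comp continuous_snd).continuousOn
  have hl : ContinuousOn (fun q : (ℝ × ℝ) × (E × E) => q.1.1) S :=
    (continuous_fst.comp continuous_fst).continuousOn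
  have hξ : ContinuousOn (fun q : (ℝ × ℝ) × (E × E) => q.2.1) S :=
    (continuous_fst.comp continuous_snd).continuousOn
  have hpt : ContinuousOn (fun q : (ℝ × ℝ) × (E × E) => (q.1.2, q.2.1)) S :=
    ((continuous_snd.comp continuous_fst).prodMk (continuous_fst.comp continuous_snd)).continuousOn
  have hmaps : MapsTo (fun q : (ℝ × ℝ) × (E × E) => (q.1.2, q.2.1)) S (Ico 0 R ×ˢ U) :=
    fun q hq => ⟨hq.1.2, hq.2.1⟩
  have h1 : ContinuousOn (fun q : (ℝ × ℝ) × (E × E) => fderiv ℝ (fun u => A (q.1.2, u)) q.2.1) S :=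
    (continuousOn_fderiv_snd hU hA).comp hpt hmaps
  have h2 : ContinuousOn (fun q : (ℝ × ℝ) × (E × E) => A (q.1.2, q.2.1)) S :=
    hA.continuousOn.comp hpt hmaps
  have h3 : ContinuousOn (fun q : (ℝ × ℝ) × (E × E) => (1 / 2 * q.1.1) •
      sqCovector (fderiv ℝ (fun u => A (q.1.2, u)) q.2.1) q.2.2) S := by
    have h6 : ContinuousOn (fun q : (ℝ × ℝ) × (E × E) =>
        (fderiv ℝ (fun u => A (q.1.2, u)) q.2.1, q.2.2)) S := h1.prodMk hv
    have h7 := continuous_sqCovector.comp_continuousOn h6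
    have h8 : ContinuousOn (fun q : (ℝ × ℝ) × (E × E) => 1 / 2 * q.1.1) S :=
      continuousOn_const.mul hl
    exact h8.smul h7
  have h4 : ContinuousOn (fun q : (ℝ × ℝ) × (E × E) => (q.2.1, q.1.1 • A (q.1.2, q.2.1) q.2.2)) S :=
    hξ.prodMk (hl.smul (h2.clm_apply hv))
  have h5 : ContinuousOn (fun q : (ℝ × ℝ) × (E × E) => hamField (fun u => A (0, u))
      (q.2.1, q.1.1 • A (q.1.2, q.2.1) q.2.2)) S := fun q hq =>
    ContinuousAt.comp_continuousWithinAt (g := hamField fun u => A (0, u)) (hX _ hq.2.1) (h4 q hq)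
  exact (hv.prodMk h3).sub h5

end FieldError

section Field

variable {m : ℕ} {Y : Type*} [TopologicalSpace Y] [ChartedSpace (EuclideanSpace ℝ (Fin m)) Y]
  [IsManifold (𝓡 m) ∞ Y] {R : ℝ} {f : ℝ → ℝ} {h : ℝ → RiemMetric m Y} {y₀ : Y}
  {B : Set (EuclideanSpace ℝ (Fin m))}
  (hg : IsGeneralizedWarpedProduct R f h) (hR : 0 < R)
  (hB : IsCompact B) (hBt : B ⊆ (extChartAt (𝓡 m) y₀).target)

theorem contDiffAt_hamField_famForm (h : ℝ → RiemMetric m Y)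
    {w : EuclideanSpace ℝ (Fin m) × (EuclideanSpace ℝ (Fin m) →L[ℝ] ℝ)}
    (hw : w.1 ∈ (extChartAt (𝓡 m) y₀).target) :
    ContDiffAt ℝ 1 (hamField fun u => famForm h y₀ (0, u)) w :=
  (regularMetricOn_riemMetric (h 0)).contDiffAt_hamField (x₀ := y₀) ⟨hw, mem_univ _⟩

include hg hR hB hBt

theorem exists_fieldError_le (C : ℝ) {ε : ℝ} (hε : 0 < ε) : ∃ η > 0, ∀ l r ξ v, |l - 1| < η →
    r ∈ Ico 0 R → r < η → ξ ∈ B → ‖v‖ ≤ C → ‖fieldError (famForm h y₀) ((l, r), (ξ, v))‖ ≤ ε := by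
  have h1 := exists_forall_norm_le_of_continuousOn
    (B := B ×ˢ Metric.closedBall (0 : EuclideanSpace ℝ (Fin m)) C) (hB.prod (isCompact_closedBall 0 C))
    ((continuousOn_fieldError (isOpen_extChartAt_target y₀) (contDiffOn_famForm hg y₀)
      fun z hz => (contDiffAt_hamField_famForm h hz).continuousAt).mono (prod_mono subset_rfl (prod_mono hBt (subset_univ _))))
    (p := ((1 : ℝ), (0 : ℝ))) ⟨mem_univ _, le_rfl, hR⟩ (fun k hk => fieldError_eq_zero (famForm_pos h (hBt hk.1))) hε
  obtain ⟨η, hη, h2⟩ := Metric.eventually_nhds_iff.1 h1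
  refine ⟨η, hη, fun l r ξ v hl hr hr' hξ hv => h2 (y := (l, r)) ?_ (ξ, v) ⟨hξ, by simpa using hv⟩
    ⟨mem_univ _, hr⟩⟩
  rw [Prod.dist_eq, max_lt_iff, Real.dist_eq, Real.dist_eq, sub_zero, abs_of_nonneg hr.1]
  exact ⟨hl, hr'⟩

/-- The forms are bounded, and bounded below, uniformly over the compact set [0, R/2] × B, so unit
vectors and their momenta are uniformly bounded in coordinates. -/
theorem exists_speed_bound : ∃ C > 0, ∀ r ∈ Icc 0 (R / 2), ∀ ξ ∈ B, ∀ v,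
    famForm h y₀ (r, ξ) v v = 1 → ‖v‖ ≤ C ∧ ‖famForm h y₀ (r, ξ) v‖ ≤ C := by
  have hsub : Icc 0 (R / 2) ×ˢ B ⊆ Ico 0 R ×ˢ (extChartAt (𝓡 m) y₀).target :=
    prod_mono (fun r hr => ⟨hr.1, by linarith [hr.2]⟩) hBt
  have hcont := (contDiffOn_famForm hg y₀).continuousOn.mono hsub
  have hK : IsCompact (Icc 0 (R / 2) ×ˢ B) := isCompact_Icc.prod hB
  obtain ⟨k, hk, hle⟩ := exists_pos_mul_sq_le_of_isCompact hK hcont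
    fun q hq v hv => famForm_pos h (hBt hq.2) v hv
  obtain ⟨A, hA⟩ := hK.exists_bound_of_continuousOn hcont
  have hkp : 0 < 1 / k := one_div_pos.2 hk
  refine ⟨(1 / k + 1) * (|A| + 1), by positivity, fun r hr ξ hξ v hv => ?_⟩
  have h1 := hle (r, ξ) ⟨hr, hξ⟩ v
  rw [hv] at h1
  have h2 : ‖v‖ ≤ 1 / k + 1 := by
    have h3 : ‖v‖ ^ 2 ≤ 1 / k := by rw [le_div_iff₀ hk, mul_comm]; exact h1
    nlinarith [norm_nonneg v]
  have h4 : ‖famForm h y₀ (r, ξ) v‖ ≤ (|A| + 1) * ‖v‖ :=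
    (ContinuousLinearMap.le_opNorm _ _).trans (mul_le_mul_of_nonneg_right
      ((hA _ ⟨hr, hξ⟩).trans ((le_abs_self A).trans (by linarith))) (norm_nonneg v))
  refine ⟨h2.trans (le_mul_of_one_le_right (by positivity) (by linarith [abs_nonneg A])), h4.trans ?_⟩
  rw [mul_comm]
  exact mul_le_mul_of_nonneg_right h2 (by positivity)

omit hg hR in
theorem exists_lipschitzOnWith_hamField (hBc : Convex ℝ B) (C : ℝ) :
    ∃ K, LipschitzOnWith K (hamField fun u => famForm h y₀ (0, u)) (B ×ˢ Metric.closedBall 0 C) := by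
  have : FiniteDimensional ℝ (EuclideanSpace ℝ (Fin m) →L[ℝ] ℝ) :=
    (LinearMap.toContinuousLinearMap (𝕜 := ℝ) (E := EuclideanSpace ℝ (Fin m))
      (F' := ℝ)).finiteDimensional
  have : ProperSpace (EuclideanSpace ℝ (Fin m) →L[ℝ] ℝ) := FiniteDimensional.proper ℝ _
  exact exists_lipschitzOnWith_of_contDiffAt (hB.prod (isCompact_closedBall 0 C))
    (hBc.prod (convex_closedBall 0 C)) fun z hz => contDiffAt_hamField_famForm h (hBt hz.1)

end Field

end WarpedGeodesics

/-! ### Convergence of velocities and of momenta. -/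

namespace WarpedGeodesics

theorem tendsto_clm_apply {E F : Type*} [NormedAddCommGroup E] [NormedSpace ℝ E]
    [NormedAddCommGroup F] [NormedSpace ℝ F] {ι : Type*} {l : Filter ι} {A : ι → E →L[ℝ] F}
    {A₀ : E →L[ℝ] F} {v : ι → E} {v₀ : E} (hA : Tendsto A l (𝓝 A₀)) (hv : Tendsto v l (𝓝 v₀)) :
    Tendsto (fun i => A i (v i)) l (𝓝 (A₀ v₀)) :=
  (isBoundedBilinearMap_apply (𝕜 := ℝ).continuous.tendsto (A₀, v₀)).comp (hA.prodMk_nhds hv)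

section TangentConvergence

variable {E : Type*} [NormedAddCommGroup E] [NormedSpace ℝ E]
  {H : Type*} [TopologicalSpace H] {I : ModelWithCorners ℝ E H} [I.Boundaryless]
  {M : Type*} [TopologicalSpace M] [ChartedSpace H M] [IsManifold I ∞ M] {x₀ : M}
  {ι : Type*} {l : Filter ι} {ζ : ι → ℝ → M} {z : ℝ → M} {s : ℝ}

/-- In a trivialization a tangent vector is its base point together with its coordinates, which for
a velocity are the derivatives of the coordinate curve. -/
theorem tendsto_tangent_iff [IsManifold I 1 M]
    (hζ : ∀ᶠ i in l, MDifferentiableAt 𝓘(ℝ, ℝ) I (ζ i) s)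
    (hz : MDifferentiableAt 𝓘(ℝ, ℝ) I z s) (hx : z s ∈ (extChartAt I x₀).source) :
    Tendsto (fun i => (⟨ζ i s, velocity I (ζ i) s⟩ : TangentBundle I M)) l
        (𝓝 ⟨z s, velocity I z s⟩) ↔
      Tendsto (fun i => ζ i s) l (𝓝 (z s)) ∧
        Tendsto (fun i => deriv (chartCurve I x₀ (ζ i)) s) l (𝓝 (deriv (chartCurve I x₀ z) s)) := by
  have hsrc : (⟨z s, velocity I z s⟩ : TangentBundle I M) ∈
      (trivializationAt E (TangentSpace I) x₀).source := by
    rw [Trivialization.mem_source, TangentBundle.trivializationAt_baseSet, ← extChartAt_source I]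
    exact hx
  rw [(trivializationAt E (TangentSpace I) x₀).tendsto_nhds_iff hsrc,
    trivializationAt_velocity hz hx]
  refine and_congr_right fun h => tendsto_congr' ?_
  have h' : Tendsto (fun i => ζ i s) l (𝓝 (z s)) := h
  filter_upwards [hζ, h'.eventually ((isOpen_extChartAt_source x₀).mem_nhds hx)] with i h1 h2
  exact trivializationAt_velocity h1 h2

theorem tendsto_of_tendsto_chart {ζ : ι → M} {y : M}
    (hζ : ∀ᶠ i in l, ζ i ∈ (extChartAt I x₀).source) (hy : y ∈ (extChartAt I x₀).source)
    (h : Tendsto (fun i => extChartAt I x₀ (ζ i)) l (𝓝 (extChartAt I x₀ y))) :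
    Tendsto ζ l (𝓝 y) := by
  have h1 := (continuousAt_extChartAt_symm'' ((extChartAt I x₀).map_source hy)).tendsto.comp h
  rw [(extChartAt I x₀).left_inv hy] at h1
  exact h1.congr' (hζ.mono fun i hi => (extChartAt I x₀).left_inv hi)

end TangentConvergence

section Family

variable {m : ℕ} {Y : Type*} [TopologicalSpace Y] [T2Space Y] [CompactSpace Y]
  [ChartedSpace (EuclideanSpace ℝ (Fin m)) Y]
  [IsManifold (𝓡 m) ∞ Y] {R c : ℝ} {f : ℝ → ℝ} {h : ℝ → RiemMetric m Y}
  {γ : ℝ → ℝ → ℝ × Y} {J : ℝ → Set ℝ} {s T : ℝ} {y₀ : Y} {z : ℝ → Y} {S : Set ℝ}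

/-- Up to rescaled time `T` the geodesics `γ δ` exist and stay close to the singularity. -/
def StaysClose (h : ℝ → RiemMetric m Y) (γ : ℝ → ℝ → ℝ × Y) (J : ℝ → Set ℝ) (T : ℝ) : Prop :=
  ∀ ρ > 0, ∀ᶠ δ in 𝓝[>] 0, ∀ s, |s| ≤ T →
    s ∈ projTime h (γ δ) '' J δ ∧ reparamRadius h (γ δ) (J δ) s < ρ

/-- Convergence of the reparametrised angular components and their velocities at time `s`. -/
def ConvergesAt (h : ℝ → RiemMetric m Y) (γ : ℝ → ℝ → ℝ × Y) (J : ℝ → Set ℝ) (z : ℝ → Y)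
    (s : ℝ) : Prop :=
  Tendsto (fun δ => (⟨projReparam h (γ δ) (J δ) s, velocity (𝓡 m) (projReparam h (γ δ) (J δ)) s⟩ :
    TangentBundle (𝓡 m) Y)) (𝓝[>] 0) (𝓝 ⟨z s, velocity (𝓡 m) z s⟩)

variable (hR : 0 < R) (hf : IsWarpingFunction R f) (hg : IsGeneralizedWarpedProduct R f h)
  (hc : 0 ≤ c) (hbound : RadialVariationBound R c h) (hRc : R * c < 1)
  (hγ : IsGeodesicFamily R f h γ J)
include hR hf hg hc hbound hRc hγ

theorem eventually_reparamFactor (hT : StaysClose h γ J T) {κ : ℝ} (hκ : 0 < κ) :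
    ∀ᶠ δ in 𝓝[>] 0, ∀ s, |s| ≤ T → |reparamFactor f h (γ δ) (J δ) s - 1| < κ := by
  have h1 : Tendsto (fun r : ℝ => Real.exp (c * r)) (𝓝 0) (𝓝 1) := by
    have : Continuous fun r : ℝ => Real.exp (c * r) := by fun_prop
    simpa using this.tendsto 0
  have h2 : Tendsto (fun r : ℝ => Real.exp (-(c * r))) (𝓝 0) (𝓝 1) := by
    have : Continuous fun r : ℝ => Real.exp (-(c * r)) := by fun_prop
    simpa using this.tendsto 0
  obtain ⟨η, hη, h3⟩ := Metric.eventually_nhds_iff.1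
    ((h1.eventually (gt_mem_nhds (by linarith : 1 < 1 + κ))).and
      (h2.eventually (lt_mem_nhds (by linarith : 1 - κ < 1))))
  filter_upwards [hT η hη, Ioo_mem_nhdsGT hR] with δ h4 hδ s hs
  have M := hγ.radialMotion hf hg hc hbound hδ
  have h5 := reparamFactor_bounds hf hc hRc M (h4 s hs).1
  have h6 := (reparamRadius_mem hf hc hRc M (h4 s hs).1).1
  have h7 := h3 (y := reparamRadius h (γ δ) (J δ) s)
    (by rw [Real.dist_eq, sub_zero, abs_of_pos h6]; exact (h4 s hs).2)
  rw [abs_lt]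
  constructor <;> linarith [h7.1, h7.2, h5.1, h5.2]

theorem eventually_mdifferentiableAt_projReparam (hT : StaysClose h γ J T) (hs : |s| ≤ T) :
    ∀ᶠ δ in 𝓝[>] 0, MDifferentiableAt 𝓘(ℝ, ℝ) (𝓡 m) (projReparam h (γ δ) (J δ)) s := by
  filter_upwards [hT 1 one_pos, Ioo_mem_nhdsGT hR] with δ h4 hδ
  exact mdifferentiableAt_projReparam hf hc hRc (hγ.radialMotion hf hg hc hbound hδ)
    (hγ.maximalGeodesic δ hδ).isGeodesicOn (h4 s hs).1

theorem tendsto_famForm_reparam (hT : StaysClose h γ J T) (hs : |s| ≤ T)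
    (hx : z s ∈ (extChartAt (𝓡 m) y₀).source)
    (hlim : Tendsto (fun δ => projReparam h (γ δ) (J δ) s) (𝓝[>] 0) (𝓝 (z s))) :
    Tendsto (fun δ => famForm h y₀ (reparamRadius h (γ δ) (J δ) s,
      chartCurve (𝓡 m) y₀ (projReparam h (γ δ) (J δ)) s)) (𝓝[>] 0)
      (𝓝 (famForm h y₀ (0, chartCurve (𝓡 m) y₀ z s))) := by
  have hchart : Tendsto (fun δ => chartCurve (𝓡 m) y₀ (projReparam h (γ δ) (J δ)) s) (𝓝[>] 0)
      (𝓝 (chartCurve (𝓡 m) y₀ z s)) := (continuousAt_extChartAt' hx).tendsto.comp hlim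
  have hmem : ∀ᶠ δ in 𝓝[>] 0, reparamRadius h (γ δ) (J δ) s ∈ Ioo 0 R := by
    filter_upwards [hT 1 one_pos, Ioo_mem_nhdsGT hR] with δ h4 hδ
    exact reparamRadius_mem hf hc hRc (hγ.radialMotion hf hg hc hbound hδ) (h4 s hs).1
  have hrad : Tendsto (fun δ => reparamRadius h (γ δ) (J δ) s) (𝓝[>] 0) (𝓝 0) := by
    rw [Metric.tendsto_nhds]
    intro ε hε
    filter_upwards [hT ε hε, hmem] with δ h4 h5
    rw [Real.dist_eq, sub_zero, abs_of_pos h5.1]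
    exact (h4 s hs).2
  have htgt : chartCurve (𝓡 m) y₀ z s ∈ (extChartAt (𝓡 m) y₀).target :=
    (extChartAt (𝓡 m) y₀).map_source hx
  have h1 := (contDiffOn_famForm hg y₀).continuousOn (0, chartCurve (𝓡 m) y₀ z s)
    ⟨⟨le_rfl, hR⟩, htgt⟩
  refine h1.tendsto.comp (tendsto_nhdsWithin_iff.2 ⟨hrad.prodMk_nhds hchart, ?_⟩)
  filter_upwards [hmem, hchart.eventually ((isOpen_extChartAt_target y₀).mem_nhds htgt)]
    with δ h2 h3
  exact ⟨Ioo_subset_Ico_self h2, h3⟩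

/-- Convergence of position and velocity is equivalent to convergence of position and
momentum. -/
theorem tendsto_reparamState (hT : StaysClose h γ J T) (hs : |s| ≤ T)
    (hz : MDifferentiableAt 𝓘(ℝ, ℝ) (𝓡 m) z s) (hx : z s ∈ (extChartAt (𝓡 m) y₀).source)
    (hconv : ConvergesAt h γ J z s) :
    Tendsto (fun δ => reparamState f h (γ δ) (J δ) y₀ s) (𝓝[>] 0)
      (𝓝 (chartState (𝓡 m) (h 0).inner y₀ z s)) := by
  have : IsManifold (𝓡 m) 1 Y := IsManifold.of_le (n := ∞) (by simp)
  obtain ⟨h1, h2⟩ := (tendsto_tangent_iff (eventually_mdifferentiableAt_projReparam hR hf hg hc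
    hbound hRc hγ hT hs) hz hx).1 hconv
  have hchart : Tendsto (fun δ => chartCurve (𝓡 m) y₀ (projReparam h (γ δ) (J δ)) s) (𝓝[>] 0)
      (𝓝 (chartCurve (𝓡 m) y₀ z s)) := (continuousAt_extChartAt' hx).tendsto.comp h1
  have hfac : Tendsto (fun δ => reparamFactor f h (γ δ) (J δ) s) (𝓝[>] 0) (𝓝 1) := by
    rw [Metric.tendsto_nhds]
    intro ε hε
    filter_upwards [eventually_reparamFactor hR hf hg hc hbound hRc hγ hT hε] with δ h3
    exact h3 s hs
  have hfam := tendsto_famForm_reparam hR hf hg hc hbound hRc hγ hT hs hx h1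
  have h3 := hfac.smul (tendsto_clm_apply hfam h2)
  rw [one_smul] at h3
  exact hchart.prodMk_nhds h3

/-- The velocity is recovered by dividing the momentum by the factor, which tends to 1, and
inverting the form h_r, which tends to the definite form h₀; inversion is continuous there. -/
theorem convergesAt_of_tendsto_reparamState (hT : StaysClose h γ J T) (hs : |s| ≤ T)
    (hz : MDifferentiableAt 𝓘(ℝ, ℝ) (𝓡 m) z s) (hx : z s ∈ (extChartAt (𝓡 m) y₀).source)
    (hsrc : ∀ᶠ δ in 𝓝[>] 0, projReparam h (γ δ) (J δ) s ∈ (extChartAt (𝓡 m) y₀).source)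
    (hst : Tendsto (fun δ => reparamState f h (γ δ) (J δ) y₀ s) (𝓝[>] 0)
      (𝓝 (chartState (𝓡 m) (h 0).inner y₀ z s))) : ConvergesAt h γ J z s := by
  have : IsManifold (𝓡 m) 1 Y := IsManifold.of_le (n := ∞) (by simp)
  have h1 : Tendsto (fun δ => projReparam h (γ δ) (J δ) s) (𝓝[>] 0) (𝓝 (z s)) :=
    tendsto_of_tendsto_chart hsrc hx ((continuous_fst.tendsto _).comp hst)
  refine (tendsto_tangent_iff (eventually_mdifferentiableAt_projReparam hR hf hg hc
    hbound hRc hγ hT hs) hz hx).2 ⟨h1, ?_⟩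
  have hfac : Tendsto (fun δ => reparamFactor f h (γ δ) (J δ) s) (𝓝[>] 0) (𝓝 1) := by
    rw [Metric.tendsto_nhds]
    intro ε hε
    filter_upwards [eventually_reparamFactor hR hf hg hc hbound hRc hγ hT hε] with δ h3
    exact h3 s hs
  have hfam := tendsto_famForm_reparam hR hf hg hc hbound hRc hγ hT hs hx h1
  have htgt : chartCurve (𝓡 m) y₀ z s ∈ (extChartAt (𝓡 m) y₀).target :=
    (extChartAt (𝓡 m) y₀).map_source hx
  have hpos := famForm_pos h (q := ((0 : ℝ), chartCurve (𝓡 m) y₀ z s)) htgt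
  have hinv := ((contDiffAt_inverse_of_pos hpos (n := 0)).continuousAt.tendsto.comp hfam)
  have hmom : Tendsto (fun δ => (reparamFactor f h (γ δ) (J δ) s)⁻¹ •
      (reparamState f h (γ δ) (J δ) y₀ s).2) (𝓝[>] 0)
      (𝓝 (momentum (𝓡 m) (h 0).inner y₀ z s)) := by
    have h4 := (hfac.inv₀ one_ne_zero).smul ((continuous_snd.tendsto _).comp hst)
    rw [inv_one, one_smul] at h4
    exact h4
  have h5 := tendsto_clm_apply hinv hmom
  have h6 : (famForm h y₀ (0, chartCurve (𝓡 m) y₀ z s)).inverse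
      (momentum (𝓡 m) (h 0).inner y₀ z s) = deriv (chartCurve (𝓡 m) y₀ z) s :=
    inverse_apply_of_pos hpos _
  rw [h6] at h5
  refine h5.congr' ?_
  filter_upwards [hsrc, hfac.eventually (lt_mem_nhds one_pos)] with δ h7 h8
  simp only [reparamState, Function.comp, inv_smul_smul₀ h8.ne']
  exact inverse_apply_of_pos (famForm_pos h ((extChartAt (𝓡 m) y₀).map_source h7)) _

end Family

end WarpedGeodesics

/-! ### Uniform convergence near one time and its propagation. -/

namespace WarpedGeodesics

section Family

variable {m : ℕ} {Y : Type*} [TopologicalSpace Y] [T2Space Y] [CompactSpace Y]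
  [ChartedSpace (EuclideanSpace ℝ (Fin m)) Y]
  [IsManifold (𝓡 m) ∞ Y] {R c : ℝ} {f : ℝ → ℝ} {h : ℝ → RiemMetric m Y}
  {γ : ℝ → ℝ → ℝ × Y} {J : ℝ → Set ℝ} {s s₀ T : ℝ} {y₀ : Y} {z : ℝ → Y} {S : Set ℝ}
  (hR : 0 < R) (hf : IsWarpingFunction R f) (hg : IsGeneralizedWarpedProduct R f h)
  (hc : 0 ≤ c) (hbound : RadialVariationBound R c h) (hRc : R * c < 1)
  (hγ : IsGeodesicFamily R f h γ J)
  (hS : IsOpen S) (hz : IsGeodesicOn (𝓡 m) (h 0).inner z S)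
  (hzu : HasUnitSpeedOn (𝓡 m) (h 0).inner z S) (hrad : ∀ s ∈ S, ∃ T > |s|, StaysClose h γ J T)

include hS hz hzu in
theorem famForm_deriv_limit (hs : s ∈ S) (hx : z s ∈ (extChartAt (𝓡 m) y₀).source) :
    famForm h y₀ (0, chartCurve (𝓡 m) y₀ z s) (deriv (chartCurve (𝓡 m) y₀ z) s)
      (deriv (chartCurve (𝓡 m) y₀ z) s) = 1 := by
  have h1 := coordForm_deriv_chartCurve (G := (h 0).inner)
    ((hz.1.contMDiffAt (hS.mem_nhds hs)).mdifferentiableAt (by simp)) hx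
  exact h1.trans (hzu s hs)

include hR hf hg hc hbound hRc hγ hS hz hzu hrad

/-- Near a time `s₀`, convergence of position and velocity at one time implies uniform convergence
in a chart. -/
theorem exists_uniform_convergence (hs₀ : s₀ ∈ S) : ∃ D, IsOpen D ∧ s₀ ∈ D ∧ D ⊆ S ∧
    (∃ T, StaysClose h γ J T ∧ ∀ s ∈ D, |s| ≤ T ∧ z s ∈ (extChartAt (𝓡 m) (z s₀)).source) ∧
    ∀ s₁ ∈ D, ConvergesAt h γ J z s₁ →
      (∀ᶠ δ in 𝓝[>] 0, ∀ s ∈ D,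
        projReparam h (γ δ) (J δ) s ∈ (extChartAt (𝓡 m) (z s₀)).source) ∧
      TendstoUniformlyOn (fun δ => reparamState f h (γ δ) (J δ) (z s₀))
        (chartState (𝓡 m) (h 0).inner (z s₀) z) (𝓝[>] 0) D := by
  set y₀ := z s₀ with hy₀
  set x := extChartAt (𝓡 m) y₀ y₀ with hxdef
  obtain ⟨ρ, hρ, hball⟩ := Metric.nhds_basis_closedBall.mem_iff.1
    ((isOpen_extChartAt_target (I := 𝓡 m) y₀).mem_nhds (mem_extChartAt_target y₀))
  rw [← hxdef] at hball
  have hB : IsCompact (Metric.closedBall x ρ) := isCompact_closedBall x ρ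
  obtain ⟨C, hC, hCb⟩ := exists_speed_bound hg hR hB hball
  -- The radius 2C leaves room for the approximate momenta: a factor of at most 2 times a momentum
  -- of norm at most C.
  obtain ⟨K, hK⟩ := exists_lipschitzOnWith_hamField (h := h) hB hball (convex_closedBall x ρ) (2 * C)
  obtain ⟨T, hTs, hT⟩ := hrad s₀ hs₀
  have hzc : ContinuousAt z s₀ := (hz.1.contMDiffAt (hS.mem_nhds hs₀)).continuousAt
  have hsrc₀ : z s₀ ∈ (extChartAt (𝓡 m) y₀).source := mem_extChartAt_source y₀
  have hcc : ContinuousAt (chartCurve (𝓡 m) y₀ z) s₀ :=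
    ContinuousAt.comp (g := extChartAt (𝓡 m) y₀) (continuousAt_extChartAt' hsrc₀) hzc
  have hloc : ∀ᶠ s in 𝓝 s₀, ((s ∈ S ∧ z s ∈ (extChartAt (𝓡 m) y₀).source) ∧
      chartCurve (𝓡 m) y₀ z s ∈ Metric.ball x (ρ / 2)) ∧ |s| < T :=
    (((hS.eventually_mem hs₀).and (eventually_mem_source hzc hsrc₀)).and
      (hcc.eventually (Metric.ball_mem_nhds x (half_pos hρ)))).and
      (continuous_abs.continuousAt.eventually (gt_mem_nhds hTs))
  obtain ⟨e, he, hloc⟩ := Metric.eventually_nhds_iff.1 hloc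
  -- Two times in the ball of radius e' differ by at most ρ/(4C), so at speed at most C the curve
  -- moves by at most ρ/4. As it starts within ρ/2 of the centre, it cannot leave the ball of radius
  -- ρ.
  set e' := min e (ρ / (8 * C)) with he'
  have he'0 : 0 < e' := lt_min he (by positivity)
  have hDloc : ∀ s ∈ Metric.ball s₀ e', ((s ∈ S ∧ z s ∈ (extChartAt (𝓡 m) y₀).source) ∧
      chartCurve (𝓡 m) y₀ z s ∈ Metric.ball x (ρ / 2)) ∧ |s| < T := fun s hs =>
    hloc ((Metric.mem_ball.1 hs).trans_le (min_le_left _ _))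
  have hD : (Metric.ball s₀ e').OrdConnected := (convex_ball s₀ e').ordConnected
  refine ⟨Metric.ball s₀ e', Metric.isOpen_ball, Metric.mem_ball_self he'0,
    fun s hs => (hDloc s hs).1.1.1, ⟨T, hT, fun s hs => ⟨(hDloc s hs).2.le, (hDloc s hs).1.1.2⟩⟩,
    fun s₁ hs₁ hconv => ?_⟩
  have hdist : ∀ s ∈ Metric.ball s₀ e', |s - s₁| ≤ ρ / (4 * C) := fun s hs => by
    have h1 := dist_triangle_right s s₁ s₀
    rw [Real.dist_eq] at h1
    have h2 := (Metric.mem_ball.1 hs).trans_le (min_le_right _ _)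
    have h3 := (Metric.mem_ball.1 hs₁).trans_le (min_le_right _ _)
    have h4 : ρ / (4 * C) = ρ / (8 * C) + ρ / (8 * C) := by field_simp; norm_num
    linarith
  have hz₁ : MDifferentiableAt 𝓘(ℝ, ℝ) (𝓡 m) z s₁ :=
    (hz.1.contMDiffAt (hS.mem_nhds (hDloc s₁ hs₁).1.1.1)).mdifferentiableAt (by simp)
  have hst₁ := tendsto_reparamState hR hf hg hc hbound hRc hγ hT (hDloc s₁ hs₁).2.le hz₁
    (hDloc s₁ hs₁).1.1.2 hconv
  have : IsManifold (𝓡 m) 1 Y := IsManifold.of_le (n := ∞) (by simp)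
  have hpos₁ := ((tendsto_tangent_iff (eventually_mdifferentiableAt_projReparam hR hf hg hc
    hbound hRc hγ hT (hDloc s₁ hs₁).2.le) hz₁ (hDloc s₁ hs₁).1.1.2).1 hconv).1
  have hconf : ∀ᶠ δ in 𝓝[>] 0, ∀ s ∈ Metric.ball s₀ e',
      projReparam h (γ δ) (J δ) s ∈ (extChartAt (𝓡 m) y₀).source ∧
        chartCurve (𝓡 m) y₀ (projReparam h (γ δ) (J δ)) s ∈ Metric.ball x ρ := by
    filter_upwards [hT (R / 2) (half_pos hR), Ioo_mem_nhdsGT hR,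
      hpos₁.eventually ((isOpen_extChartAt_source y₀).mem_nhds (hDloc s₁ hs₁).1.1.2),
      ((continuous_fst.tendsto _).comp hst₁).eventually
        (Metric.isOpen_ball.mem_nhds (hDloc s₁ hs₁).1.2)] with δ h1 hδ h2 h3
    have M := hγ.radialMotion hf hg hc hbound hδ
    have hgeo := (hγ.maximalGeodesic δ hδ).isGeodesicOn
    have hmem : ∀ s ∈ Metric.ball s₀ e', s ∈ projTime h (γ δ) '' J δ := fun s hs =>
      (h1 s (hDloc s hs).2.le).1
    refine mem_ball_of_norm_deriv_le hD Metric.isOpen_ball (C := C) hs₁ (fun s hs =>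
      (mdifferentiableAt_projReparam hf hc hRc M hgeo (hmem s hs)).continuousAt) hball h2
      (fun s hs hsrc hb => ?_) fun s hs => ?_
    · have h4 := hasDerivAt_chartCurve_projReparam hf hc hRc M hgeo (hmem s hs) hsrc
      refine ⟨by rw [h4.deriv]; exact h4, ?_⟩
      have h5 := reparamRadius_mem hf hc hRc M (hmem s hs)
      exact (hCb _ ⟨h5.1.le, (h1 s (hDloc s hs).2.le).2.le⟩ _ hb _
        (famForm_deriv_projReparam hf hc hRc M hgeo (hmem s hs) hsrc)).1
    · have h4 : C * |s - s₁| ≤ ρ / 4 := by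
        refine (mul_le_mul_of_nonneg_left (hdist s hs) hC.le).trans_eq ?_
        field_simp
      have h5 : dist (chartCurve (𝓡 m) y₀ (projReparam h (γ δ) (J δ)) s₁) x < ρ / 2 := h3
      linarith
  refine ⟨hconf.mono fun δ h1 s hs => (h1 s hs).1, ?_⟩
  rw [Metric.tendstoUniformlyOn_iff]
  intro ε hε
  -- The largest Gronwall factor between times in the ball. The distance at time `s₁` and the error
  -- of the field are each made at most ε/(2Λ).
  set Λ := Real.exp ((K + 1) * (ρ / (4 * C))) with hΛ
  have hΛ0 : 0 < Λ := Real.exp_pos _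
  have hε' : 0 < ε / (2 * Λ) := by positivity
  obtain ⟨η, hη, hηb⟩ := exists_fieldError_le hg hR hB hball C hε'
  filter_upwards [hconf, hT η hη, hT (R / 2) (half_pos hR), Ioo_mem_nhdsGT hR,
    eventually_reparamFactor hR hf hg hc hbound hRc hγ hT (lt_min hη one_pos),
    (Metric.tendsto_nhds.1 hst₁) _ hε'] with δ h1 h2 h3 hδ h4 h5 s hs
  have M := hγ.radialMotion hf hg hc hbound hδ
  have hgeo := (hγ.maximalGeodesic δ hδ).isGeodesicOn
  have hmem : ∀ s ∈ Metric.ball s₀ e', s ∈ projTime h (γ δ) '' J δ := fun s hs =>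
    (h2 s (hDloc s hs).2.le).1
  have key := dist_le_of_approx_solution hK hD hε'.le
    (Z := reparamState f h (γ δ) (J δ) y₀) (W := chartState (𝓡 m) (h 0).inner y₀ z)
    (Z' := fun s => (deriv (chartCurve (𝓡 m) y₀ (projReparam h (γ δ) (J δ))) s,
      (1 / 2 * reparamFactor f h (γ δ) (J δ) s) • sqCovector (fderiv ℝ (fun u =>
        famForm h y₀ (reparamRadius h (γ δ) (J δ) s, u))
          (chartCurve (𝓡 m) y₀ (projReparam h (γ δ) (J δ)) s))
        (deriv (chartCurve (𝓡 m) y₀ (projReparam h (γ δ) (J δ))) s)))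
    (fun s hs => ?_) (fun s hs => ?_) hs₁ hs
  · rw [dist_comm]
    refine key.trans_lt ?_
    have h6 : Real.exp ((K + 1) * |s - s₁|) ≤ Λ := Real.exp_le_exp.2
      (mul_le_mul_of_nonneg_left (hdist s hs) (by positivity))
    calc (dist (reparamState f h (γ δ) (J δ) y₀ s₁) (chartState (𝓡 m) (h 0).inner y₀ z s₁) +
          ε / (2 * Λ)) * Real.exp ((K + 1) * |s - s₁|)
        ≤ (dist (reparamState f h (γ δ) (J δ) y₀ s₁) (chartState (𝓡 m) (h 0).inner y₀ z s₁) +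
          ε / (2 * Λ)) * Λ := mul_le_mul_of_nonneg_left h6 (by positivity)
      _ < (ε / (2 * Λ) + ε / (2 * Λ)) * Λ :=
        mul_lt_mul_of_pos_right (add_lt_add_of_lt_of_le h5 le_rfl) hΛ0
      _ = ε := by field_simp; norm_num
  · have h6 := reparamRadius_mem hf hc hRc M (hmem s hs)
    have h7 := famForm_deriv_projReparam hf hc hRc M hgeo (hmem s hs) (h1 s hs).1
    have h8 := Metric.ball_subset_closedBall (h1 s hs).2
    have h9 := hCb _ ⟨h6.1.le, (h3 s (hDloc s hs).2.le).2.le⟩ _ h8 _ h7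
    have h10 := h4 s (hDloc s hs).2.le
    refine ⟨hasDerivAt_reparamState hf hg hc hRc M hgeo (hmem s hs) (h1 s hs).1, ⟨h8, ?_⟩, ?_⟩
    · rw [mem_closedBall_zero_iff, reparamState, norm_smul]
      have h11 : |reparamFactor f h (γ δ) (J δ) s| ≤ 2 := by
        have := abs_lt.1 (h10.trans_le (min_le_right _ _))
        rw [abs_le]; constructor <;> linarith
      exact mul_le_mul h11 h9.2 (norm_nonneg _) (by norm_num)
    · exact hηb _ _ _ _ (h10.trans_le (min_le_left _ _)) (Ioo_subset_Ico_self h6)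
        (h2 s (hDloc s hs).2.le).2 h8 h9.1
  · have h6 := famForm_deriv_limit hS hz hzu (hDloc s hs).1.1.1 (hDloc s hs).1.1.2
    have h8 : chartCurve (𝓡 m) y₀ z s ∈ Metric.closedBall x ρ :=
      Metric.ball_subset_closedBall (Metric.ball_subset_ball (by linarith) (hDloc s hs).1.2)
    have h9 := hCb _ ⟨le_rfl, by linarith⟩ _ h8 _ h6
    refine ⟨(regularMetricOn_riemMetric (h 0)).hasDerivAt_chartState hS hz (hDloc s hs).1.1.1
      (mem_univ _) (hDloc s hs).1.1.2, h8, ?_⟩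
    rw [mem_closedBall_zero_iff]
    exact (show ‖momentum (𝓡 m) (h 0).inner y₀ z s‖ ≤ C from h9.2).trans (by linarith)

/-- In the neighbourhood from `exists_uniform_convergence`, convergence at any one time implies
convergence at all others, not only at the centre; hence an equivalence. -/
theorem convergesAt_iff_of_near (hs₀ : s₀ ∈ S) :
    ∀ᶠ s in 𝓝 s₀, ConvergesAt h γ J z s₀ ↔ ConvergesAt h γ J z s := by
  obtain ⟨D, hDo, hs₀D, hDS, ⟨T, hT, hTD⟩, hD⟩ :=
    exists_uniform_convergence hR hf hg hc hbound hRc hγ hS hz hzu hrad hs₀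
  have key : ∀ s₁ ∈ D, ConvergesAt h γ J z s₁ → ∀ s ∈ D, ConvergesAt h γ J z s := by
    intro s₁ hs₁ hconv s hs
    obtain ⟨h1, h2⟩ := hD s₁ hs₁ hconv
    exact convergesAt_of_tendsto_reparamState hR hf hg hc hbound hRc hγ hT (hTD s hs).1
      ((hz.1.contMDiffAt (hS.mem_nhds (hDS hs))).mdifferentiableAt (by simp)) (hTD s hs).2
      (h1.mono fun δ h3 => h3 s hs) (h2.tendsto_at hs)
  filter_upwards [hDo.mem_nhds hs₀D] with s hs
  exact ⟨fun h1 => key s₀ hs₀D h1 s hs, fun h1 => key s hs h1 s₀ hs₀D⟩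

/-- Convergence at a time is a locally constant property on `S`, and `S` is connected. -/
theorem convergesAt_of_mem (hSc : IsPreconnected S) {s₁ : ℝ} (hs₁ : s₁ ∈ S)
    (hconv : ConvergesAt h γ J z s₁) (hs : s ∈ S) : ConvergesAt h γ J z s :=
  (hSc.induction₂ (fun a b => ConvergesAt h γ J z a ↔ ConvergesAt h γ J z b)
    (fun _ ha => (convergesAt_iff_of_near hR hf hg hc hbound hRc hγ hS hz hzu hrad ha).filter_mono
      nhdsWithin_le_nhds)
    (fun _ _ _ _ _ _ h1 h2 => h1.trans h2) (fun _ _ _ _ h1 => h1.symm) hs₁ hs).1 hconv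

theorem tendsto_projReparam_prod (hs₀ : s₀ ∈ S) (hconv : ConvergesAt h γ J z s₀) :
    Tendsto (fun p : ℝ × ℝ => projReparam h (γ p.1) (J p.1) p.2) (𝓝[>] 0 ×ˢ 𝓝 s₀) (𝓝 (z s₀)) := by
  obtain ⟨D, hDo, hs₀D, hDS, ⟨T, hT, hTD⟩, hD⟩ :=
    exists_uniform_convergence hR hf hg hc hbound hRc hγ hS hz hzu hrad hs₀
  obtain ⟨h1, h2⟩ := hD s₀ hs₀D hconv
  have hzc : ContinuousAt z s₀ := (hz.1.contMDiffAt (hS.mem_nhds hs₀)).continuousAt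
  have hsrc₀ : z s₀ ∈ (extChartAt (𝓡 m) (z s₀)).source := mem_extChartAt_source _
  have hcc : ContinuousAt (chartCurve (𝓡 m) (z s₀) z) s₀ :=
    ContinuousAt.comp (g := extChartAt (𝓡 m) (z s₀)) (continuousAt_extChartAt' hsrc₀) hzc
  have hev : ∀ᶠ p : ℝ × ℝ in 𝓝[>] 0 ×ˢ 𝓝 s₀, p.2 ∈ D :=
    tendsto_snd.eventually (hDo.mem_nhds hs₀D)
  refine tendsto_of_tendsto_chart (I := 𝓡 m) (x₀ := z s₀) ?_ hsrc₀ ?_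
  · filter_upwards [tendsto_fst.eventually h1, hev] with p h3 h4 using h3 _ h4
  · rw [Metric.tendsto_nhds]
    intro ε hε
    filter_upwards [hev, tendsto_fst.eventually ((Metric.tendstoUniformlyOn_iff.1 h2) (ε / 2)
      (half_pos hε)), tendsto_snd.eventually ((Metric.tendsto_nhds.1 hcc) (ε / 2) (half_pos hε))]
      with p h3 h4 h5
    have h6 : dist (chartCurve (𝓡 m) (z s₀) z p.2)
        (chartCurve (𝓡 m) (z s₀) (projReparam h (γ p.1) (J p.1)) p.2) < ε / 2 :=
      lt_of_le_of_lt (le_max_left _ _) (h4 p.2 h3)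
    rw [dist_comm] at h6
    exact (dist_triangle _ _ _).trans_lt (by
      have := add_lt_add h6 h5; rwa [add_halves] at this)

end Family

end WarpedGeodesics

namespace WarpedGeodesics

/-! ### Assembly: initial conditions, existence of the limit geodesic, uniform convergence. -/

section Limits

variable {m : ℕ} {Y : Type*} [TopologicalSpace Y] [T2Space Y] [CompactSpace Y]
  [ChartedSpace (EuclideanSpace ℝ (Fin m)) Y]
  [IsManifold (𝓡 m) ∞ Y] {R c : ℝ} {f : ℝ → ℝ} {h : ℝ → RiemMetric m Y}
  {γ : ℝ → ℝ → ℝ × Y} {J : ℝ → Set ℝ} {T : ℝ} {z : ℝ → Y} {S : Set ℝ}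
  {p₀ : TangentBundle (𝓡 m) Y}

theorem EndpointsTendsto.eventually_subset {s : ℝ → Set ℝ} {la lb : Filter ℝ} (hR : 0 < R)
    (hs : EndpointsTendsto R s la lb) (ha : ∀ᶠ a in la, a < -T) (hb : ∀ᶠ b in lb, T < b) :
    ∀ᶠ δ in 𝓝[>] 0, Icc (-T) T ⊆ s δ := by
  obtain ⟨a, b, h1, h2, h3⟩ := hs
  filter_upwards [h2.eventually ha, h3.eventually hb, Ioo_mem_nhdsGT hR] with δ h4 h5 hδ x hx
  rw [h1 δ hδ]
  exact ⟨h4.trans_le hx.1, hx.2.trans_lt h5⟩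

theorem staysClose_of_radius_lt
    (hsub : ∀ᶠ δ in 𝓝[>] 0, Icc (-T) T ⊆ projTime h (γ δ) '' J δ)
    (hrad : ∀ ρ > 0, ∀ᶠ δ in 𝓝[>] 0, ∀ t ∈ J δ, |projTime h (γ δ) t| ≤ T → (γ δ t).1 < ρ) :
    StaysClose h γ J T := by
  intro ρ hρ
  filter_upwards [hsub, hrad ρ hρ] with δ h1 h2 s hs
  have h3 := h1 (abs_le.1 hs)
  refine ⟨h3, h2 _ (Function.invFunOn_mem h3) ?_⟩
  rwa [reparamTime, Function.invFunOn_eq h3]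

/-- At the closest point ṙ = 0, so f(δ) ν = 1 and dt/ds = f(δ): the rescaled initial condition is
exactly the initial condition in rescaled time. -/
theorem velocity_projReparam_zero {δ : ℝ} {γ : ℝ → ℝ × Y} {J : Set ℝ}
    (hf : IsWarpingFunction R f) (hc : 0 ≤ c) (hRc : R * c < 1)
    (M : RadialMotion R c f δ (fun t => (γ t).1) (projSpeed h γ) J)
    (hγ : IsGeodesicOn (𝓘(ℝ, ℝ).prod (𝓡 m)) (warpedMetric f h) γ J) :
    (⟨projReparam h γ J 0, velocity (𝓡 m) (projReparam h γ J) 0⟩ : TangentBundle (𝓡 m) Y) =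
      rescaledInitial f γ δ := by
  have h0 : projTime h γ 0 = 0 := intervalIntegral.integral_same
  have hmem : (0 : ℝ) ∈ projTime h γ '' J := ⟨0, M.zero_mem, h0⟩
  have ht : reparamTime h γ J 0 = 0 := by
    have := reparamTime_projTime hf hc hRc M M.zero_mem
    rwa [h0] at this
  have hν : (projSpeed h γ 0)⁻¹ = f δ := by
    have h1 := M.energy 0 M.zero_mem
    rw [M.deriv_zero, M.start] at h1
    have h2 := hf.pos δ M.delta_mem
    have h3 := M.nonneg 0
    have h4 : (f δ * projSpeed h γ 0) ^ 2 = 1 ^ 2 := by linarith [mul_pow (f δ) (projSpeed h γ 0) 2]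
    have h5 := (sq_eq_sq₀ (mul_nonneg h2.le h3) zero_le_one).1 h4
    exact (eq_inv_of_mul_eq_one_left h5).symm
  have hd := hasDerivAt_reparamTime hf hc hRc M hmem
  rw [ht, hν] at hd
  have hy := mdifferentiableAt_angular M.isOpen hγ M.zero_mem
  rw [← ht] at hy
  have hcomp := hy.hasMFDerivAt.comp (f := reparamTime h γ J) 0 hd.hasFDerivAt.hasMFDerivAt
  have hvel : velocity (𝓡 m) (projReparam h γ J) 0 =
      mfderiv 𝓘(ℝ, ℝ) (𝓡 m) (fun s => (γ s).2) (reparamTime h γ J 0) (f δ) := by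
    have h1 : mfderiv 𝓘(ℝ, ℝ) (𝓡 m) (projReparam h γ J) 0 = _ := hcomp.mfderiv
    rw [velocity, h1]
    change mfderiv 𝓘(ℝ, ℝ) (𝓡 m) (fun s => (γ s).2) (reparamTime h γ J 0) ((1 : ℝ) • f δ) = _
    rw [one_smul]
  refine tangentBundle_mk_eq (congrArg (fun t => (γ t).2) ht) (hvel.trans ?_)
  have h2 : mfderiv 𝓘(ℝ, ℝ) (𝓡 m) (fun s => (γ s).2) (reparamTime h γ J 0) (f δ) =
      f δ • velocity (𝓡 m) (fun s => (γ s).2) (reparamTime h γ J 0) := by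
    have h3 := (mfderiv 𝓘(ℝ, ℝ) (𝓡 m) (fun s => (γ s).2) (reparamTime h γ J 0)).map_smul
      (f δ) (1 : ℝ)
    rw [velocity, ← h3]
    congr 1
    exact (mul_one (f δ)).symm
  exact h2.trans (by rw [ht])

/-- By completeness a geodesic exists for all times, and conservation of energy keeps its speed
equal to 1. -/
theorem exists_isUnitGeodesicFrom (k : RiemMetric m Y) (hp : k.inner p₀.1 p₀.2 p₀.2 = 1)
    (S : Set ℝ) : ∃ z : ℝ → Y, IsUnitGeodesicFrom k p₀ S z := by
  have hreg := regularMetricOn_riemMetric k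
  obtain ⟨z, hz, hz0⟩ := hreg.exists_geodesic_univ p₀
  subst hz0
  refine ⟨z, hz.mono (subset_univ _), fun t _ => ?_, rfl⟩
  exact (hreg.energy_eq isOpen_univ isPreconnected_univ hz (mapsTo_univ _ _) (mem_univ t)
    (mem_univ 0)).trans hp

end Limits

section Uniform

variable {m : ℕ} {Y : Type*} [UniformSpace Y] [T2Space Y] [CompactSpace Y]
  [ChartedSpace (EuclideanSpace ℝ (Fin m)) Y]
  [IsManifold (𝓡 m) ∞ Y] {R c : ℝ} {f : ℝ → ℝ} {h : ℝ → RiemMetric m Y}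
  {γ : ℝ → ℝ → ℝ × Y} {J : ℝ → Set ℝ} {S : Set ℝ} {p₀ : TangentBundle (𝓡 m) Y}

theorem reparamConverges_of_staysClose (hR : 0 < R) (hf : IsWarpingFunction R f)
    (hg : IsGeneralizedWarpedProduct R f h) (hc : 0 ≤ c) (hbound : RadialVariationBound R c h)
    (hRc : R * c < 1) (hγ : IsGeodesicFamily R f h γ J) (hp : (h 0).inner p₀.1 p₀.2 p₀.2 = 1)
    (hlim : Tendsto (fun δ => rescaledInitial f (γ δ) δ) (𝓝[>] 0) (𝓝 p₀)) (hS : IsOpen S)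
    (hSc : IsPreconnected S) (h0 : 0 ∈ S) (hrad : ∀ s ∈ S, ∃ T > |s|, StaysClose h γ J T) :
    ReparamConverges h γ J p₀ S := by
  refine ⟨exists_isUnitGeodesicFrom _ hp S, fun z hz K hKS hK => ?_⟩
  have hconv : ConvergesAt h γ J z 0 := by
    rw [ConvergesAt, hz.initial]
    refine hlim.congr' ?_
    filter_upwards [Ioo_mem_nhdsGT hR] with δ hδ
    exact (velocity_projReparam_zero hf hc hRc (hγ.radialMotion hf hg hc hbound hδ)
      (hγ.maximalGeodesic δ hδ).isGeodesicOn).symm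
  rw [← tendstoLocallyUniformlyOn_iff_tendstoUniformlyOn_of_compact hK]
  refine TendstoLocallyUniformlyOn.mono ?_ hKS
  rw [tendstoLocallyUniformlyOn_iff_filter]
  intro s hs
  -- `Y` carries only a uniform structure, so uniform closeness near `s` is deduced from both curves
  -- tending to `z s` jointly in δ and the time: a pair converging to a point of the diagonal enters
  -- every entourage.
  rw [tendstoUniformlyOnFilter_iff_tendsto, hS.nhdsWithin_eq hs]
  have h1 := tendsto_projReparam_prod hR hf hg hc hbound hRc hγ hS hz.isGeodesicOn hz.unitSpeed
    hrad hs (convergesAt_of_mem hR hf hg hc hbound hRc hγ hS hz.isGeodesicOn hz.unitSpeed hrad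
      hSc h0 hconv hs)
  have h2 : Tendsto (fun p : ℝ × ℝ => z p.2) (𝓝[>] 0 ×ˢ 𝓝 s) (𝓝 (z s)) :=
    (hz.isGeodesicOn.continuousAt hS hs).tendsto.comp tendsto_snd
  exact (h2.prodMk_nhds h1).mono_right (nhds_le_uniformity _)

variable (hR : 0 < R) (hf : IsWarpingFunction R f) (hg : IsGeneralizedWarpedProduct R f h)
  (hc : 0 ≤ c) (hbound : RadialVariationBound R c h) (hRc : R * c < 1)
  (hosc : NonOscillation R f) (hγ : IsGeodesicFamily R f h γ J)
include hR hf hg hc hbound hRc hosc hγ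

theorem IsGeodesicFamily.tendsto_projLength : Tendsto (fun δ => projLength h (γ δ) (J δ) /
    (angularConst R f / deriv f δ)) (𝓝[>] 0) (𝓝 1) :=
  tendsto_length hR hf hc hRc hosc (fun _ hδ => hγ.radialMotion hf hg hc hbound hδ)
    fun _ hδ _ hρ => hγ.exists_radius_gt hf hg hc hbound hRc hδ hρ

theorem IsGeodesicFamily.endpointsTendsto_of_conical (h1 : derivWithin f (Ico 0 R) 0 = 1) :
    EndpointsTendsto R (fun δ => projTime h (γ δ) '' J δ)
      (𝓝 (-(Real.pi / 2))) (𝓝 (Real.pi / 2)) :=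
  WarpedGeodesics.endpointsTendsto_of_conical hR hf hc hRc hosc
    (fun _ hδ => hγ.radialMotion hf hg hc hbound hδ)
    (fun _ hδ _ hρ => hγ.exists_radius_gt hf hg hc hbound hRc hδ hρ) h1

theorem IsGeodesicFamily.endpointsTendsto_of_cuspidal (h0 : derivWithin f (Ico 0 R) 0 = 0) :
    EndpointsTendsto R (fun δ => projTime h (γ δ) '' J δ) atBot atTop :=
  WarpedGeodesics.endpointsTendsto_of_cuspidal hR hf hc hRc hosc
    (fun _ hδ => hγ.radialMotion hf hg hc hbound hδ)
    (fun _ hδ _ hρ => hγ.exists_radius_gt hf hg hc hbound hRc hδ hρ) h0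

theorem IsGeodesicFamily.reparamConverges_of_conical (h1 : derivWithin f (Ico 0 R) 0 = 1)
    (hp : (h 0).inner p₀.1 p₀.2 p₀.2 = 1)
    (hlim : Tendsto (fun δ => rescaledInitial f (γ δ) δ) (𝓝[>] 0) (𝓝 p₀)) :
    ReparamConverges h γ J p₀ (Ioo (-(Real.pi / 2)) (Real.pi / 2)) := by
  refine reparamConverges_of_staysClose hR hf hg hc hbound hRc hγ hp hlim isOpen_Ioo
    isPreconnected_Ioo ⟨by linarith [Real.pi_pos], by linarith [Real.pi_pos]⟩ fun s hs => ?_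
  obtain ⟨T, hsT, hT⟩ := exists_between (abs_lt.2 hs)
  refine ⟨T, hsT, staysClose_of_radius_lt ?_ fun ρ hρ => ?_⟩
  · exact (hγ.endpointsTendsto_of_conical hR hf hg hc hbound hRc hosc h1).eventually_subset hR
      (gt_mem_nhds (neg_lt_neg hT)) (lt_mem_nhds hT)
  · exact eventually_radius_lt_of_conical hR hf hc hRc hosc
      (fun _ hδ => hγ.radialMotion hf hg hc hbound hδ)
      (fun _ hδ _ hρ => hγ.exists_radius_gt hf hg hc hbound hRc hδ hρ) h1 hT hρ

theorem IsGeodesicFamily.reparamConverges_of_cuspidal (h0 : derivWithin f (Ico 0 R) 0 = 0)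
    (hp : (h 0).inner p₀.1 p₀.2 p₀.2 = 1)
    (hlim : Tendsto (fun δ => rescaledInitial f (γ δ) δ) (𝓝[>] 0) (𝓝 p₀)) :
    ReparamConverges h γ J p₀ univ := by
  refine reparamConverges_of_staysClose hR hf hg hc hbound hRc hγ hp hlim isOpen_univ
    isPreconnected_univ (mem_univ _) fun s _ => ?_
  refine ⟨|s| + 1, lt_add_one _, staysClose_of_radius_lt ?_ fun ρ hρ => ?_⟩
  · exact (hγ.endpointsTendsto_of_cuspidal hR hf hg hc hbound hRc hosc h0).eventually_subset hR
      (eventually_lt_atBot _) (eventually_gt_atTop _)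
  · exact eventually_radius_lt_of_cuspidal hR hf hc hRc hosc
      (fun _ hδ => hγ.radialMotion hf hg hc hbound hδ)
      (fun _ hδ _ hρ => hγ.exists_radius_gt hf hg hc hbound hRc hδ hρ) h0 _ hρ

end Uniform

end WarpedGeodesics

end

theorem theoremC
    {m : ℕ} {Y : Type*} [UniformSpace Y] [T2Space Y] [CompactSpace Y]
    [ChartedSpace (EuclideanSpace ℝ (Fin m)) Y] [IsManifold (𝓡 m) ∞ Y]
    (R : ℝ) (hR : 0 < R) (f : ℝ → ℝ) (hf : WarpedGeodesics.IsWarpingFunction R f)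
    (h : ℝ → WarpedGeodesics.RiemMetric m Y)
    (hg : WarpedGeodesics.IsGeneralizedWarpedProduct R f h)
    (c : ℝ) (hc : 0 ≤ c) (hbound : WarpedGeodesics.RadialVariationBound R c h) (hRc : R * c < 1)
    (hosc : WarpedGeodesics.NonOscillation R f) :
    -- The constant `C_f` is well defined, lies in `[2, π]`, and is `π` in the conical case.
    (IntervalIntegrable (fun ϑ => WarpedGeodesics.frakF R f (1 / Real.cos ϑ)) volume
        (-(Real.pi / 2)) (Real.pi / 2) ∧
      2 ≤ WarpedGeodesics.angularConst R f ∧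
      WarpedGeodesics.angularConst R f ≤ Real.pi ∧
      (0 < derivWithin f (Ico 0 R) 0 → WarpedGeodesics.angularConst R f = Real.pi)) ∧
    -- `C_f → 2` for `f(x) = x ^ α` as `α → ∞`.
    ((∀ α : ℝ, 1 ≤ α → WarpedGeodesics.NonOscillation R (fun x => x ^ α)) ∧
      Tendsto (fun α : ℝ => WarpedGeodesics.angularConst R (fun x => x ^ α)) atTop (𝓝 2)) ∧
    -- Monotonicity: the sharper the cusp, the smaller the constant.
    (∀ (R₁ R₂ : ℝ) (f₁ f₂ : ℝ → ℝ), 0 < R₁ → 0 < R₂ →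
      WarpedGeodesics.IsWarpingFunction R₁ f₁ → WarpedGeodesics.IsWarpingFunction R₂ f₂ →
      WarpedGeodesics.FrakFExists R₁ f₁ → WarpedGeodesics.FrakFExists R₂ f₂ →
      f₁ =O[𝓝[>] 0] f₂ →
      (∀ σ : ℝ, 1 ≤ σ → WarpedGeodesics.frakF R₁ f₁ σ ≤ WarpedGeodesics.frakF R₂ f₂ σ) ∧
        WarpedGeodesics.angularConst R₁ f₁ ≤ WarpedGeodesics.angularConst R₂ f₂) ∧
    -- For every family of geodesics with minimal distances `δ`:
    (∀ (γ : ℝ → ℝ → ℝ × Y) (J : ℝ → Set ℝ), WarpedGeodesics.IsGeodesicFamily R f h γ J →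
      -- the lengths are finite, and asymptotic to `C_f / f'(δ)`;
      ((∀ δ ∈ Ioo 0 R, IntegrableOn (WarpedGeodesics.projSpeed h (γ δ)) (J δ)) ∧
        Tendsto (fun δ => WarpedGeodesics.projLength h (γ δ) (J δ) /
          (WarpedGeodesics.angularConst R f / deriv f δ)) (𝓝[>] 0) (𝓝 1)) ∧
      -- the rescaled time is a change of parameter;
      (∀ δ ∈ Ioo 0 R, StrictMonoOn (WarpedGeodesics.projTime h (γ δ)) (J δ)) ∧
      -- and if the rescaled initial conditions converge, the `Y`-components converge.
      (∀ p₀ : TangentBundle (𝓡 m) Y, (h 0).inner p₀.1 p₀.2 p₀.2 = 1 →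
        Tendsto (fun δ => WarpedGeodesics.rescaledInitial f (γ δ) δ) (𝓝[>] 0) (𝓝 p₀) →
        (derivWithin f (Ico 0 R) 0 = 1 →
          WarpedGeodesics.EndpointsTendsto R
              (fun δ => WarpedGeodesics.projTime h (γ δ) '' J δ)
              (𝓝 (-(Real.pi / 2))) (𝓝 (Real.pi / 2)) ∧
            WarpedGeodesics.ReparamConverges h γ J p₀
              (Ioo (-(Real.pi / 2)) (Real.pi / 2))) ∧
        (derivWithin f (Ico 0 R) 0 = 0 →
          WarpedGeodesics.EndpointsTendsto R
              (fun δ => WarpedGeodesics.projTime h (γ δ) '' J δ) atBot atTop ∧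
            WarpedGeodesics.ReparamConverges h γ J p₀ univ))) := by
  open WarpedGeodesics in
  refine ⟨⟨intervalIntegrable_frakF hR hf hosc.1, two_le_angularConst hR hf hosc.1,
    angularConst_le_pi hR hf hosc.1, angularConst_eq_pi_of_conical hR hf⟩,
    ⟨fun α hα => nonOscillation_rpow hR hα, tendsto_angularConst_rpow hR⟩,
    fun R₁ R₂ f₁ f₂ hR₁ hR₂ hf₁ hf₂ hF₁ hF₂ hO =>
      ⟨fun σ hσ => frakF_le_of_isBigO hR₁ hR₂ hf₁ hf₂ hF₁ hF₂ hO hσ,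
        angularConst_le_of_isBigO hR₁ hR₂ hf₁ hf₂ hF₁ hF₂ hO⟩,
    fun γ J hγ => ⟨⟨fun δ hδ => (hγ.radialMotion hf hg hc hbound hδ).integrableOn_speed hf hc hRc,
      hγ.tendsto_projLength hR hf hg hc hbound hRc hosc⟩,
      fun δ hδ => strictMonoOn_projTime hf hc hRc (hγ.radialMotion hf hg hc hbound hδ),
      fun p₀ hp hlim => ⟨fun h1 => ⟨hγ.endpointsTendsto_of_conical hR hf hg hc hbound hRc hosc h1,
        hγ.reparamConverges_of_conical hR hf hg hc hbound hRc hosc h1 hp hlim⟩,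
        fun h0 => ⟨hγ.endpointsTendsto_of_cuspidal hR hf hg hc hbound hRc hosc h0,
        hγ.reparamConverges_of_cuspidal hR hf hg hc hbound hRc hosc h0 hp hlim⟩⟩⟩⟩
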